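/- Let $\mathfrak g$ be of type $A_n^{(1)}$ ($n\ge 1$) or $D_n^{(1)}$ ($n\ge 4$), with classical Dynkin nodes $1,\dots,n$ (in type $D$ the nodes $n-1,n$ are both joined to $n-2$), classical Cartan matrix $(A_{ab})$, simple roots $\alpha_a$ and fundamental weights $\overline\Lambda_a$. Let $L=(L_i^{(a)})_{1\le a\le n,\ i\ge1}$ be a finitely supported array of non-negative integers, where $L_i^{(a)}$ counts the tensor factors $B^{a,i}$ of a tensor product of Kirillov--Reshetikhin crystals; in type $D$ only factors $B^{1,s}$ are allowed. *Rigged configurations.* For a sequence of partitions $\nu=(\nu^{(1)},\dots,\nu^{(n)})$, where $\nu^{(a)}$ has $m_i^{(a)}$ parts of size $i$, put $p_i^{(a)}=\sum_j\min(i,j)L_j^{(a)}-\sum_b A_{ab}\sum_j\min(i,j)m_j^{(b)}$. An element of $\mathrm{RC}(L,\lambda)$ is such a $\nu$ with $\sum i\,m_i^{(a)}\alpha_a=\sum i\,L_i^{(a)}\overline\Lambda_a-\lambda$ and $p_i^{(a)}\ge0$ for all $a$ and $i\ge1$, together with a multiset $J^{(a,i)}$ of $m_i^{(a)}$ integers (riggings)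 in $[0,p_i^{(a)}]$ for all $a,i$. A string is a part $i$ of some $\nu^{(a)}$ together with one of the riggings in $J^{(a,i)}$; it is singular if its rigging is $p_i^{(a)}$ and cosingular if its rigging is $0$. Let $\mathrm{RC}(L)=\bigcup_\lambda \mathrm{RC}(L,\lambda)$, and let $\theta_L:\mathrm{RC}(L)\to\mathrm{RC}(L)$ replace each rigging $x$ of a string of length $i$ in $\nu^{(a)}$ by $p_i^{(a)}-x$. *The maps $\overline\delta,\widetilde\delta:\mathrm{RC}(L)\to\mathrm{RC}(L')$*, where $L$ contains $B^{1,1}$ and $L'$ is $L$ with one $B^{1,1}$ removed. Set $\ell^{(0)}=1$. In type $A$, for $a=1,\dots,n$ let $\ell^{(a)}$ be the smallest $i\ge\ell^{(a-1)}$ such that $\nu^{(a)}$ has a singular string of length $i$, and $\ell^{(a)}=\infty$ if there is none. In type $D$ do this for $a=1,\dots,n-2$, then choose $\ell^{(n-1)}$ and $\ell^{(n)}$ in the same way, both with lower bound $\ell^{(n-2)}$; put $\bar\ell^{(n-1)}=\max(\ell^{(n-1)},\ell^{(n)})$, and for $a=n-2,\dots,1$ let $\bar\ell^{(a)}$ be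 the smallest $i\ge\bar\ell^{(a+1)}$ such that $\nu^{(a)}$ has a singular string of length $i$ (two of them if $i=\ell^{(a)}$), and $\infty$ if there is none. The map $\overline\delta$ removes one box from each selected singular string (those of length $\ell^{(a)}<\infty$, and in type $D$ also those of length $\bar\ell^{(a)}<\infty$ for $a\le n-2$), deletes strings of length $0$, makes the shortened strings singular with respect to the new vacancy numbers (those of the new configuration and $L'$), and keeps all other strings and riggings. Put $\widetilde\delta=\theta_{L'}\circ\overline\delta\circ\theta_L$. *The maps $\overline j,\widetilde j$*, where $L$ contains $B^{r,s}$ with $s\ge2$. They map $\mathrm{RC}(L)$ to $\mathrm{RC}(L'')$, where $L''$ is $L$ with one $B^{r,s}$ replaced by $B^{r,1}$ and $B^{r,s-1}$: $\overline j(\nu,J)=(\nu,J)$, and $\widetilde j$ adds $1$ to the rigging of each string of length $<s$ in $\nu^{(r)}$. *The maps $\overline i,\widetilde i$* (type $A$ only), where $L$ contains $B^{r,1}$ with $r\ge2$. They map $\mathrm{RC}(L)$ to $\mathrm{RC}(L''')$, where $L'''$ is $L$ with one $B^{r,1}$ replaced by $B^{1,1}$ and $B^{r-1,1}$: $\overline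 i$ (resp. $\widetilde i$) adds one singular (resp. cosingular) string of length $1$ to $\nu^{(a)}$ for each $1\le a<r$ and keeps the other strings and riggings. **Theorem.** On $\mathrm{RC}(L)$ the following hold whenever $L$ contains the tensor factors to which the two maps in question refer, as two different factors: 1. $\overline\delta\circ\widetilde\delta=\widetilde\delta\circ\overline\delta$; 2. $\widetilde j\circ\overline\delta=\overline\delta\circ\widetilde j$ and $\overline j\circ\widetilde\delta=\widetilde\delta\circ\overline j$; 3. $\overline j\circ\widetilde j=\widetilde j\circ\overline j$, where $\overline j$ and $\widetilde j$ may refer to different factors $B^{r,s}$, $B^{r',s'}$ with $s,s'\ge2$; 4. in type $A_n^{(1)}$: $\widetilde i\circ\overline\delta=\overline\delta\circ\widetilde i$ and $\overline i\circ\widetilde\delta=\widetilde\delta\circ\overline i$; 5. in type $A_n^{(1)}$: $\widetilde i\circ\overline j=\overline j\circ\widetilde i$ and $\overline i\circ\widetilde j=\widetilde j\circ\overline i$. -/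

import Mathlib

namespace RiggedConfiguration

/-- The two families of simply-laced nonexceptional affine types, `A_n^{(1)}` and `D_n^{(1)}`. -/
inductive AffineType
  | A
  | D

variable {n : ℕ}

/-- The Cartan matrix of the classical subalgebra. The Dynkin nodes `1, …, n` are `0, …, n - 1`
in `Fin n`; in type `D` the last two are the spin nodes. -/
def cartan (t : AffineType) (n : ℕ) : Matrix (Fin n) (Fin n) ℤ :=
  match t with
  | .A => CartanMatrix.A n
  | .D => CartanMatrix.D n

/-- A multiplicity array, given as the finite multiset of the labels `(r, s)` of the tensor
factors `B^{r,s}` of a tensor product: `L_i^{(a)}` is the multiplicity of `(a, i)`. -/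
abbrev MultArray (n : ℕ) := Multiset (Fin n × ℕ)

/-- The arrays under consideration: any tensor product of `B^{r,s}`, `s ≥ 1`, in type `A`; only
`B^{1,s}`, `s ≥ 1`, in type `D`. -/
def IsKRArray (t : AffineType) [NeZero n] (L : MultArray n) : Prop :=
  (∀ x ∈ L, 1 ≤ x.2) ∧
    match t with
    | .A => True
    | .D => ∀ x ∈ L, x.1 = 0

/-- A sequence of partitions `ν^{(a)}`, each given as the multiset of its parts. -/
abbrev Config (n : ℕ) := Fin n → Multiset ℕ

/-- A sequence of partitions with riggings, each given as the multiset of its strings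
`(i, x)`: a part of size `i` with rigging `x`. The riggings of the strings of length `i` in
position `a` are the parts of the partition `J^{(a,i)}`. -/
abbrev Strings (n : ℕ) := Fin n → Multiset (ℕ × ℤ)

/-- The underlying sequence of partitions `ν`. -/
def shape (J : Strings n) : Config n := fun a => (J a).map Prod.fst

/-- The vacancy number `p_i^{(a)}`. -/
def vacancy (t : AffineType) (L : MultArray n) (ν : Config n) (a : Fin n) (i : ℕ) : ℤ :=
  (L.map fun x => if x.1 = a then ((min i x.2 : ℕ) : ℤ) else 0).sum
    - ∑ b, cartan t n a b * ((ν b).map fun j => ((min i j : ℕ) : ℤ)).sum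

/-- `ν` is an `(L, lam)`-configuration, where the weight `lam` is written in the basis of
fundamental weights; the simple root `α_a` is `∑ b, cartan t n b a • Λ_b`. -/
def IsConfiguration (t : AffineType) (L : MultArray n) (lam : Fin n → ℤ) (ν : Config n) : Prop :=
  (∀ a, ∀ i ∈ ν a, 1 ≤ i) ∧
    ∀ b, ∑ a, cartan t n b a * ((ν a).map fun i => (i : ℤ)).sum
      = (L.map fun x => if x.1 = b then (x.2 : ℤ) else 0).sum - lam b

/-- The set `RC(L, lam)` of rigged configurations. -/
def RC (t : AffineType) (L : MultArray n) (lam : Fin n → ℤ) : Set (Strings n) :=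
  {J | IsConfiguration t L lam (shape J) ∧
    (∀ a, ∀ i : ℕ, 1 ≤ i → 0 ≤ vacancy t L (shape J) a i) ∧
    ∀ a, ∀ x ∈ J a, 0 ≤ x.2 ∧ x.2 ≤ vacancy t L (shape J) a x.1}

/-- Complementation of all riggings with respect to the vacancy numbers. -/
def theta (t : AffineType) (L : MultArray n) (J : Strings n) : Strings n :=
  fun a => (J a).map fun x => (x.1, vacancy t L (shape J) a x.1 - x.2)

/-! ### Operations on multiplicity arrays -/

/-- Removal of one tensor factor `B^{1,1}`. -/
def MultArray.hat [NeZero n] (L : MultArray n) : MultArray n := L.erase (0, 1)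

/-- Replacement of one `B^{r,s}` by `B^{r,1}` and `B^{r,s-1}` (used for `s ≥ 2`). -/
def MultArray.split (r : Fin n) (s : ℕ) (L : MultArray n) : MultArray n :=
  (r, 1) ::ₘ (r, s - 1) ::ₘ L.erase (r, s)

/-- Replacement of one `B^{r,1}` by `B^{1,1}` and `B^{r-1,1}` (used when `r` is not the
first node). -/
def MultArray.boxSplit [NeZero n] (r : Fin n) (L : MultArray n) : MultArray n :=
  (0, 1) ::ₘ (⟨r.val - 1, lt_of_le_of_lt (Nat.sub_le _ _) r.isLt⟩, 1) ::ₘ L.erase (r, 1)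

/-! ### String selection -/

/-- The smallest `i ≥ lo` such that the riggings of the strings of length `i` at the node with
zero-based number `a` contain the value `p_i^{(a)}` at least `k i` times, where `k i ≥ 1`;
`⊤` if there is none (in particular if `lo = ⊤`). -/
def firstSingular (t : AffineType) (L : MultArray n) (J : Strings n) (a : ℕ) (lo : WithTop ℕ)
    (k : ℕ → ℕ) : WithTop ℕ :=
  if h : a < n then
    (((J ⟨a, h⟩).map Prod.fst).toFinset.filter fun i : ℕ =>
      lo ≤ (i : WithTop ℕ) ∧
        k i ≤ (J ⟨a, h⟩).count (i, vacancy t L (shape J) ⟨a, h⟩ i)).min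
  else ⊤

/-- Selection along the nodes `1, 2, 3, …` in this order: `chain t L J a` is `ℓ^{(a)}`, with
`ℓ^{(0)} = 1` and value `⊤` once the process has stopped. -/
def chain (t : AffineType) (L : MultArray n) (J : Strings n) : ℕ → WithTop ℕ
  | 0 => 1
  | a + 1 => firstSingular t L J a (chain t L J a) fun _ => 1

/-- `ℓ^{(a)}`. In type `D` the last node follows the node `n - 2` and not the node `n - 1`. -/
def ell (t : AffineType) (L : MultArray n) (J : Strings n) (a : ℕ) : WithTop ℕ :=
  match t with
  | .A => chain .A L J a
  | .D =>
    if a = n then firstSingular .D L J (n - 1) (chain .D L J (n - 2)) fun _ => 1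
    else chain .D L J a

/-- The return pass in type `D`: `ellBarAux L J k` is `ℓ̄^{(n-1-k)}`, with
`ℓ̄^{(n-1)} = max (ℓ^{(n-1)}, ℓ^{(n)})`. A length that was selected on the way out needs two
singular strings. -/
def ellBarAux (L : MultArray n) (J : Strings n) : ℕ → WithTop ℕ
  | 0 => max (ell .D L J (n - 1)) (ell .D L J n)
  | k + 1 => firstSingular .D L J (n - 3 - k) (ellBarAux L J k) fun i =>
      if (i : WithTop ℕ) = ell .D L J (n - 2 - k) then 2 else 1

/-- `ℓ̄^{(a)}` for `1 ≤ a ≤ n - 2` in type `D`; there is no return pass in type `A`. -/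
def ellBar (t : AffineType) (L : MultArray n) (J : Strings n) (a : ℕ) : WithTop ℕ :=
  match t with
  | .A => ⊤
  | .D => if a + 2 ≤ n then ellBarAux L J (n - 1 - a) else ⊤

/-- The multiset `{i}` for a finite length `i`, and the empty one for `⊤`. -/
def finiteLengths (x : WithTop ℕ) : Multiset ℕ :=
  WithTop.recTopCoe (C := fun _ => Multiset ℕ) 0 (fun i => {i}) x

/-- The lengths of the strings selected at the node `a`. -/
def selected (t : AffineType) (L : MultArray n) (J : Strings n) (a : Fin n) : Multiset ℕ :=
  finiteLengths (ell t L J (a.val + 1)) + finiteLengths (ellBar t L J (a.val + 1))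

/-- The lengths of the selected strings after the removal of a box from each of them; strings of
length zero disappear. -/
def shortened (t : AffineType) (L : MultArray n) (J : Strings n) (a : Fin n) : Multiset ℕ :=
  ((selected t L J a).map fun i => i - 1).filter fun i => 0 < i

/-! ### The basic operations

They are given by their algorithms on all sequences of strings; `L` is the multiplicity array
of the argument. -/

/-- The configuration after the removal of a box from each selected string. -/
def newShape (t : AffineType) (L : MultArray n) (J : Strings n) : Config n :=
  fun a => shape J a - selected t L J a + shortened t L J a

/-- `δ̄ : RC(L) → RC(hat L)`: the selected singular strings are shortened by one box and made
singular again, with respect to the new vacancy numbers. -/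
def deltaBar (t : AffineType) [NeZero n] (L : MultArray n) (J : Strings n) : Strings n :=
  fun a =>
    J a - (selected t L J a).map (fun i => (i, vacancy t L (shape J) a i))
      + (shortened t L J a).map (fun i => (i, vacancy t L.hat (newShape t L J) a i))

/-- `δ̃ = θ ∘ δ̄ ∘ θ : RC(L) → RC(hat L)`. -/
def deltaTilde (t : AffineType) [NeZero n] (L : MultArray n) (J : Strings n) : Strings n :=
  theta t L.hat (deltaBar t L (theta t L J))

/-- `j̄ : RC(L) → RC(split r s L)` leaves all strings and riggings unchanged. -/
def jBar (_r : Fin n) (_s : ℕ) (J : Strings n) : Strings n := J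

/-- `j̃ : RC(L) → RC(split r s L)` adds `1` to the rigging of each string of length less than
`s` at the node `r`. -/
def jTilde (r : Fin n) (s : ℕ) (J : Strings n) : Strings n :=
  fun a => (J a).map fun x => if a = r ∧ x.1 < s then (x.1, x.2 + 1) else x

/-- `ĩ : RC(L) → RC(boxSplit r L)` adds a cosingular string of length `1` at each node before
`r`. -/
def iTilde (r : Fin n) (J : Strings n) : Strings n :=
  fun a => if a < r then (1, 0) ::ₘ J a else J a

/-- `ī : RC(L) → RC(boxSplit r L)` adds a singular string of length `1` at each node before
`r`. -/
def iBar (t : AffineType) [NeZero n] (r : Fin n) (L : MultArray n) (J : Strings n) : Strings n :=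
  fun a =>
    if a < r then
      (1, vacancy t (L.boxSplit r) (shape (iTilde r J)) a 1) ::ₘ J a
    else J a

end RiggedConfiguration

/-! ### Two particles acting on strings, and their vacancy numbers -/

namespace RiggedConfiguration

/-! The substance is the commutation of `deltaBar` and `deltaTilde`. Each is read as the motion of a
particle that carries a weight of the vector representation and a level. At a node where its weight
is 1, the particle may shorten a singular (for the second particle: cosingular) string whose length
is its level, and its weight drops by the simple root; when no string can be shortened, the level
rises. A particle adds its weight to the vacancy numbers at all lengths from its level on. Hence
removing a box changes no vacancy number (`Q_xh`), and moving up changes only the one at the level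
being left (`Q_xu`). The weights are minuscule, so nodes that are active together are orthogonal,
and a run has only one outcome (`XRun.unique`).

Both particles are put on one configuration. `mirror` complements the riggings and exchanges them,
so each fact is needed for one particle only. The two orders of running are compared by induction on
`measure`, with the particles at a common level. Moves on different strings commute. Two
obstructions remain, both controlled by the concavity of the vacancy numbers
(`Q_second_difference`). First, both particles may need the same string. Then the vacancy numbers at
its length and one below are 0, both removals leave the same strings, and only the weights differ,
by a `swap`. Second, raising both particles may make a vacancy number negative. Then `Quiet.clash`
finds a string one longer than the level from which both particles take a box in either order, with
the same effect, `jump`. Since swaps and jumps lead to new states, `Below` carries four statements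
through one induction: commutation and invariance under swaps, for valid and for quiet states. The
outcome is `Valid.commutes`.

The selection of minimal lengths in the definition of `deltaBar` is such a run (`exists_track`,
`Represents.run`); the return pass in type D is the descent through the negative letters of the
vector representation.

The other commutations compare vacancy numbers. `jTilde` raises riggings by exactly what the vacancy
numbers gain, so singular strings stay singular. `iTilde` leaves the vacancy numbers unchanged, and
its new string can only interfere where concavity already provides an equal string
(`singular_of_chain_eq_one`). Conjugation with `theta` exchanges the barred and the tilded maps and
gives the remaining cases. -/

/-- A simply-laced Cartan matrix with a set of minuscule weights closed under the reflections in
simple roots, and the contributions to the vacancy numbers of the tensor factors that are not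
removed. The level `top` bounds the scanning of the strings. -/
structure PairData (n : ℕ) where
  A : Matrix (Fin n) (Fin n) ℤ
  W : Set (Fin n → ℤ)
  base : Fin n → ℕ → ℤ
  top : ℕ
  diag : ∀ a, A a a = 2
  offdiag : ∀ a b, a ≠ b → A a b = 0 ∨ A a b = -1
  symm : ∀ a b, A a b = A b a
  minuscule : ∀ w ∈ W, ∀ a, w a = -1 ∨ w a = 0 ∨ w a = 1
  lower : ∀ w ∈ W, ∀ a, w a = 1 → (fun b => w b - A b a) ∈ W
  raise : ∀ w ∈ W, ∀ a, w a = -1 → (fun b => w b + A b a) ∈ W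
  concave : ∀ a l, base a l + base a (l + 2) ≤ 2 * base a (l + 1)

/-- Strings together with two particles of weights `w`, `v` at the levels `i`, `j`. The first
particle removes boxes from singular strings, the second one from cosingular strings. -/
@[ext]
structure Pair (n : ℕ) where
  J : Strings n
  w : Fin n → ℤ
  v : Fin n → ℤ
  i : ℕ
  j : ℕ

/-- The number of boxes in the first `l` columns. -/
def boxes (K : Multiset (ℕ × ℤ)) (l : ℕ) : ℤ := (K.map fun x => ((min l x.1 : ℕ) : ℤ)).sum

@[simp] lemma boxes_zero (l : ℕ) : boxes 0 l = 0 := rfl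

@[simp] lemma boxes_cons (x : ℕ × ℤ) (K : Multiset (ℕ × ℤ)) (l : ℕ) :
    boxes (x ::ₘ K) l = ((min l x.1 : ℕ) : ℤ) + boxes K l := by
  simp [boxes]

lemma boxes_map (K : Multiset (ℕ × ℤ)) (f : ℕ × ℤ → ℕ × ℤ) (hf : ∀ x, (f x).1 = x.1) (l : ℕ) :
    boxes (K.map f) l = boxes K l := by
  simp [boxes, Multiset.map_map, hf]

/-- The number of strings of length `l`. -/
def mult (K : Multiset (ℕ × ℤ)) (l : ℕ) : ℤ := (K.countP fun x => x.1 = l : ℕ)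

lemma mult_nonneg (K : Multiset (ℕ × ℤ)) (l : ℕ) : 0 ≤ mult K l := by simp [mult]

lemma mult_pos {K : Multiset (ℕ × ℤ)} {x : ℕ × ℤ} (h : x ∈ K) : 1 ≤ mult K x.1 := by
  have : 0 < K.countP fun y => y.1 = x.1 := Multiset.countP_pos.2 ⟨x, h, rfl⟩
  simp only [mult]; omega

lemma exists_mem_of_mult_pos {K : Multiset (ℕ × ℤ)} {l : ℕ} (h : 1 ≤ mult K l) :
    ∃ r, (l, r) ∈ K := by
  have : 0 < K.countP fun y => y.1 = l := by simp only [mult] at h; omega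
  obtain ⟨⟨a, r⟩, h1, h2⟩ := Multiset.countP_pos.1 this
  simp only at h2; subst h2
  exact ⟨r, h1⟩

/-- As a function of `l`, the contribution of a single string is linear except for a kink at its own
length. -/
lemma boxes_second_difference (K : Multiset (ℕ × ℤ)) (l : ℕ) :
    2 * boxes K (l + 1) = boxes K l + boxes K (l + 2) + mult K (l + 1) := by
  induction K using Multiset.induction_on with
  | empty => simp [mult]
  | cons x K ih =>
    have : mult (x ::ₘ K) (l + 1) = mult K (l + 1) + if x.1 = l + 1 then 1 else 0 := by
      simp only [mult, Multiset.countP_cons]; split_ifs <;> simp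
    rw [boxes_cons, boxes_cons, boxes_cons, this]
    split_ifs with h
    · rw [h, min_eq_left le_rfl, min_eq_left (by omega), min_eq_right (by omega)]
      push_cast; linarith
    · rcases Nat.lt_or_gt_of_ne h with h | h
      · rw [min_eq_right (by omega), min_eq_right (by omega), min_eq_right (by omega)]
        linarith
      · rw [min_eq_left (by omega), min_eq_left (by omega), min_eq_left (by omega)]
        push_cast; linarith

namespace PairData

variable {n : ℕ} (D : PairData n)

/-- Vacancy numbers, including the contributions of the two particles. -/
def Q (s : Pair n) (a : Fin n) (l : ℕ) : ℤ :=
  D.base a l - ∑ b, D.A a b * boxes (s.J b) l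
    + (if s.i ≤ l then s.w a else 0) + (if s.j ≤ l then s.v a else 0)

/-- The first particle removes a box at `c`. -/
def xh (c : Fin n) (s : Pair n) : Pair n where
  J := Function.update s.J c
    ((s.i - 1, D.Q s c (s.i - 1)) ::ₘ (s.J c).erase (s.i, D.Q s c s.i))
  w := fun b => s.w b - D.A b c
  v := s.v
  i := s.i
  j := s.j

/-- The first particle moves up. -/
def xu (s : Pair n) : Pair n := { s with i := s.i + 1 }

/-- The second particle removes a box at `c`. -/
def yh (c : Fin n) (s : Pair n) : Pair n where
  J := Function.update s.J c ((s.j - 1, 0) ::ₘ (s.J c).erase (s.j, 0))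
  w := s.w
  v := fun b => s.v b - D.A b c
  i := s.i
  j := s.j

/-- The second particle moves up; coriggings are fixed. -/
def yu (s : Pair n) : Pair n where
  J := fun a => (s.J a).map fun x => (x.1, if x.1 = s.j then x.2 - s.v a else x.2)
  w := s.w
  v := s.v
  i := s.i
  j := s.j + 1

/-- Complementation of all riggings, and exchange of the particles. -/
def mirror (s : Pair n) : Pair n where
  J := fun a => (s.J a).map fun x => (x.1, D.Q s a x.1 - x.2)
  w := s.v
  v := s.w
  i := s.j
  j := s.i

lemma mirror_J (s : Pair n) (a : Fin n) :
    (D.mirror s).J a = (s.J a).map fun x => (x.1, D.Q s a x.1 - x.2) := rfl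

lemma xh_J (c : Fin n) (s : Pair n) : (D.xh c s).J = Function.update s.J c
    ((s.i - 1, D.Q s c (s.i - 1)) ::ₘ (s.J c).erase (s.i, D.Q s c s.i)) := rfl

lemma yh_J (c : Fin n) (s : Pair n) : (yh D c s).J = Function.update s.J c
    ((s.j - 1, 0) ::ₘ (s.J c).erase (s.j, 0)) := rfl

lemma yu_J (s : Pair n) (a : Fin n) : (yu s).J a =
    (s.J a).map fun x => (x.1, if x.1 = s.j then x.2 - s.v a else x.2) := rfl

@[simp] lemma mirror_w (s : Pair n) : (D.mirror s).w = s.v := rfl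
@[simp] lemma mirror_v (s : Pair n) : (D.mirror s).v = s.w := rfl
@[simp] lemma mirror_i (s : Pair n) : (D.mirror s).i = s.j := rfl
@[simp] lemma mirror_j (s : Pair n) : (D.mirror s).j = s.i := rfl
@[simp] lemma xh_i (c : Fin n) (s : Pair n) : (D.xh c s).i = s.i := rfl
@[simp] lemma xh_j (c : Fin n) (s : Pair n) : (D.xh c s).j = s.j := rfl
@[simp] lemma xh_v (c : Fin n) (s : Pair n) : (D.xh c s).v = s.v := rfl
@[simp] lemma xh_w (c : Fin n) (s : Pair n) : (D.xh c s).w = fun b => s.w b - D.A b c := rfl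
@[simp] lemma yh_i (c : Fin n) (s : Pair n) : (D.yh c s).i = s.i := rfl
@[simp] lemma yh_j (c : Fin n) (s : Pair n) : (D.yh c s).j = s.j := rfl
@[simp] lemma yh_w (c : Fin n) (s : Pair n) : (D.yh c s).w = s.w := rfl
@[simp] lemma yh_v (c : Fin n) (s : Pair n) : (D.yh c s).v = fun b => s.v b - D.A b c := rfl
@[simp] lemma xu_i (s : Pair n) : (xu s).i = s.i + 1 := rfl
@[simp] lemma xu_j (s : Pair n) : (xu s).j = s.j := rfl
@[simp] lemma xu_w (s : Pair n) : (xu s).w = s.w := rfl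
@[simp] lemma xu_v (s : Pair n) : (xu s).v = s.v := rfl
@[simp] lemma xu_J (s : Pair n) : (xu s).J = s.J := rfl
@[simp] lemma yu_i (s : Pair n) : (yu s).i = s.i := rfl
@[simp] lemma yu_j (s : Pair n) : (yu s).j = s.j + 1 := rfl
@[simp] lemma yu_w (s : Pair n) : (yu s).w = s.w := rfl
@[simp] lemma yu_v (s : Pair n) : (yu s).v = s.v := rfl

/-- The first particle can remove a box at `c`. -/
def XAvail (s : Pair n) (c : Fin n) : Prop := s.w c = 1 ∧ (s.i, D.Q s c s.i) ∈ s.J c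

/-- The second particle can remove a box at `c`. -/
def YAvail (s : Pair n) (c : Fin n) : Prop := s.v c = 1 ∧ (s.j, (0 : ℤ)) ∈ s.J c

lemma boxes_shorten {K : Multiset (ℕ × ℤ)} {i : ℕ} {r r' : ℤ} (hi : 1 ≤ i) (h : (i, r) ∈ K)
    (l : ℕ) : boxes ((i - 1, r') ::ₘ K.erase (i, r)) l = boxes K l - if i ≤ l then 1 else 0 := by
  obtain ⟨K, rfl⟩ := Multiset.exists_cons_of_mem h
  rw [Multiset.erase_cons_head, boxes_cons, boxes_cons]
  split_ifs with h'
  · rw [min_eq_right (by simp only; omega), min_eq_right (by simpa using h')]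
    push_cast [Nat.cast_sub hi]; ring
  · rw [min_eq_left (by simp only; omega), min_eq_left (by simp only; omega)]
    ring

lemma sum_boxes_update (J : Strings n) (c : Fin n) {i : ℕ} {r r' : ℤ} (hi : 1 ≤ i)
    (h : (i, r) ∈ J c) (a : Fin n) (l : ℕ) :
    ∑ b, D.A a b * boxes (Function.update J c ((i - 1, r') ::ₘ (J c).erase (i, r)) b) l
      = ∑ b, D.A a b * boxes (J b) l - if i ≤ l then D.A a c else 0 := by
  have : ∀ b, D.A a b * boxes (Function.update J c ((i - 1, r') ::ₘ (J c).erase (i, r)) b) l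
      = D.A a b * boxes (J b) l - if b = c then (if i ≤ l then D.A a c else 0) else 0 := by
    intro b
    by_cases hb : b = c
    · subst hb
      rw [Function.update_self, boxes_shorten hi h, if_pos rfl]
      split_ifs <;> ring
    · simp [hb]
  simp only [this, Finset.sum_sub_distrib]
  simp

/-- From level `s.i` on, the lost box raises the vacancy numbers by a column of the Cartan matrix,
and the lowered weight takes the same column away. -/
lemma Q_xh {s : Pair n} {c : Fin n} (hi : 1 ≤ s.i) (h : D.XAvail s c) :
    D.Q (D.xh c s) = D.Q s := by
  funext a l
  have := D.sum_boxes_update s.J c (r' := D.Q s c (s.i - 1)) hi h.2 a l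
  have e : D.Q (D.xh c s) a l = D.base a l - ∑ b, D.A a b * boxes ((D.xh c s).J b) l
    + (if s.i ≤ l then s.w a - D.A a c else 0) + (if s.j ≤ l then s.v a else 0) := rfl
  rw [e, Q, xh_J, this]
  split_ifs <;> ring

lemma Q_yh {s : Pair n} {c : Fin n} (hj : 1 ≤ s.j) (h : YAvail s c) :
    D.Q (D.yh c s) = D.Q s := by
  funext a l
  have := D.sum_boxes_update s.J c (r' := 0) hj h.2 a l
  have e : D.Q (D.yh c s) a l = D.base a l - ∑ b, D.A a b * boxes ((D.yh c s).J b) l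
    + (if s.i ≤ l then s.w a else 0) + (if s.j ≤ l then s.v a - D.A a c else 0) := rfl
  rw [e, Q, yh_J, this]
  split_ifs <;> ring

lemma Q_xu (s : Pair n) (a : Fin n) (l : ℕ) :
    D.Q (xu s) a l = D.Q s a l - if l = s.i then s.w a else 0 := by
  have e : D.Q (xu s) a l = D.base a l - ∑ b, D.A a b * boxes (s.J b) l
    + (if s.i + 1 ≤ l then s.w a else 0) + (if s.j ≤ l then s.v a else 0) := rfl
  rw [e, Q]
  split_ifs <;> omega

lemma Q_yu (s : Pair n) (a : Fin n) (l : ℕ) :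
    D.Q (yu s) a l = D.Q s a l - if l = s.j then s.v a else 0 := by
  have : ∀ b, boxes ((yu s).J b) l = boxes (s.J b) l := fun b =>
    by
    rw [yu_J]; apply boxes_map; exact fun _ => rfl
  have e : D.Q (yu s) a l = D.base a l - ∑ b, D.A a b * boxes ((yu s).J b) l
    + (if s.i ≤ l then s.w a else 0) + (if s.j + 1 ≤ l then s.v a else 0) := rfl
  rw [e, Q]
  simp only [this]
  split_ifs <;> omega

lemma Q_mirror (s : Pair n) : D.Q (D.mirror s) = D.Q s := by
  funext a l
  have : ∀ b, boxes ((D.mirror s).J b) l = boxes (s.J b) l := fun b =>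
    by
    rw [mirror_J]; apply boxes_map; exact fun _ => rfl
  simp only [Q, this, mirror_i, mirror_w, mirror_v, mirror_j]
  exact add_right_comm _ _ _

@[simp] lemma mirror_mirror (s : Pair n) : D.mirror (D.mirror s) = s := by
  have : (D.mirror (D.mirror s)).J = s.J := by
    funext a
    rw [mirror_J, mirror_J, Q_mirror, Multiset.map_map]
    simp
  exact Pair.ext this rfl rfl rfl rfl

lemma mem_mirror {s : Pair n} {a : Fin n} {l : ℕ} {r : ℤ} :
    (l, r) ∈ (D.mirror s).J a ↔ (l, D.Q s a l - r) ∈ s.J a := by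
  rw [mirror_J, Multiset.mem_map]
  constructor
  · rintro ⟨⟨l', r'⟩, h, he⟩
    simp only [Prod.mk.injEq] at he
    obtain ⟨rfl, rfl⟩ := he
    simpa using h
  · intro h
    exact ⟨_, h, by simp⟩

lemma xAvail_mirror {s : Pair n} {c : Fin n} : D.XAvail (D.mirror s) c ↔ YAvail s c := by
  simp [XAvail, YAvail, mem_mirror, Q_mirror]

lemma yAvail_mirror {s : Pair n} {c : Fin n} : YAvail (D.mirror s) c ↔ D.XAvail s c := by
  simp [XAvail, YAvail, mem_mirror]

/-- The first particle moves up with riggings fixed while the vacancy number at its level drops by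
its weight, so coriggings drop there. This explains the correction of the riggings in `yu`. -/
lemma mirror_xu (s : Pair n) : D.mirror (xu s) = yu (D.mirror s) := by
  refine Pair.ext ?_ rfl rfl rfl rfl
  funext a
  simp only [yu_J, mirror_J, Multiset.map_map, Function.comp_def, Q_xu, xu_J]
  refine Multiset.map_congr rfl fun x _ => Prod.ext rfl ?_
  change D.Q s a x.1 - (if x.1 = s.i then s.w a else 0) - x.2
    = if x.1 = s.i then D.Q s a x.1 - x.2 - s.w a else D.Q s a x.1 - x.2
  split_ifs <;> ring

lemma mirror_yu (s : Pair n) : D.mirror (yu s) = xu (D.mirror s) := by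
  rw [← D.mirror_mirror (xu (D.mirror s)), mirror_xu, mirror_mirror]

lemma mirror_xh {s : Pair n} {c : Fin n} (hi : 1 ≤ s.i) (h : D.XAvail s c) :
    D.mirror (D.xh c s) = D.yh c (D.mirror s) := by
  refine Pair.ext ?_ rfl rfl rfl rfl
  funext a
  rw [mirror_J, D.Q_xh hi h]
  by_cases ha : a = c
  · subst ha
    obtain ⟨K, hK⟩ := Multiset.exists_cons_of_mem h.2
    simp [xh, yh, mirror_J, hK]
  · simp [xh, yh, mirror_J, ha]

lemma mirror_yh {s : Pair n} {c : Fin n} (hj : 1 ≤ s.j) (h : YAvail s c) :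
    D.mirror (D.yh c s) = D.xh c (D.mirror s) := by
  rw [← D.mirror_mirror (D.xh c (D.mirror s)), D.mirror_xh hj (D.xAvail_mirror.2 h), mirror_mirror]

lemma Q_second_difference (s : Pair n) (a : Fin n) (l : ℕ) :
    D.Q s a l + D.Q s a (l + 2) + ∑ b, -D.A a b * mult (s.J b) (l + 1)
      + ((if s.i = l + 1 then s.w a else 0) - if s.i = l + 2 then s.w a else 0)
      + ((if s.j = l + 1 then s.v a else 0) - if s.j = l + 2 then s.v a else 0)
      ≤ 2 * D.Q s a (l + 1) := by
  have h : 2 * ∑ b, D.A a b * boxes (s.J b) (l + 1)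
      = ∑ b, D.A a b * boxes (s.J b) l + ∑ b, D.A a b * boxes (s.J b) (l + 2)
        - ∑ b, -D.A a b * mult (s.J b) (l + 1) := by
    rw [Finset.mul_sum, ← Finset.sum_add_distrib, ← Finset.sum_sub_distrib]
    refine Finset.sum_congr rfl fun b _ => ?_
    linear_combination D.A a b * boxes_second_difference (s.J b) l
  have := D.concave a l
  simp only [Q]
  generalize ∑ b, D.A a b * boxes (s.J b) (l + 1) = x1 at *
  generalize ∑ b, D.A a b * boxes (s.J b) (l + 2) = x2 at *
  generalize ∑ b, D.A a b * boxes (s.J b) l = x0 at *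
  generalize ∑ b, -D.A a b * mult (s.J b) (l + 1) = y at *
  -- The step function of a particle at level `i` has its kinks at `i - 1` and `i`.
  have key : ∀ (i : ℕ) (w : ℤ), 2 * (if i ≤ l + 1 then w else 0) =
      (if i ≤ l then w else 0) + (if i ≤ l + 2 then w else 0)
        + ((if i = l + 1 then w else 0) - if i = l + 2 then w else 0) := by
    intro i w
    rcases lt_trichotomy i (l + 1) with h | h | h
    · rw [if_pos (by omega), if_pos (by omega), if_pos (by omega), if_neg (by omega),
        if_neg (by omega)]; ring
    · rw [if_pos (by omega), if_neg (by omega), if_pos (by omega), if_pos (by omega),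
        if_neg (by omega)]; ring
    · rcases Nat.eq_or_lt_of_le (show l + 2 ≤ i from h) with h | h
      · rw [if_neg (by omega), if_neg (by omega), if_pos (by omega), if_neg (by omega),
          if_pos (by omega)]; ring
      · rw [if_neg (by omega), if_neg (by omega), if_neg (by omega), if_neg (by omega),
          if_neg (by omega)]; ring
  linarith [key s.i (s.w a), key s.j (s.v a)]

end PairData
end RiggedConfiguration

/-! ### Runs of one particle: confluence and termination -/

namespace RiggedConfiguration
namespace PairData

variable {n : ℕ} (D : PairData n)

/-- If the nodes were joined, lowering at `b` would raise the value at `a` to 2, which no minuscule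
weight allows. -/
lemma orthogonal {w : Fin n → ℤ} (hw : w ∈ D.W) {a b : Fin n} (ha : w a = 1) (hb : w b = 1)
    (hab : a ≠ b) : D.A a b = 0 := by
  have h1 : w a - D.A a b = -1 ∨ w a - D.A a b = 0 ∨ w a - D.A a b = 1 :=
    D.minuscule _ (D.lower w hw b hb) a
  have h2 := D.offdiag a b hab
  omega

/-- One step of the first particle. -/
inductive XStep : Pair n → Pair n → Prop
  | hor (s : Pair n) (c : Fin n) (hw : s.w ∈ D.W) (hi : 1 ≤ s.i) (ht : s.i < D.top)
      (h : D.XAvail s c) : XStep s (D.xh c s)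
  | up (s : Pair n) (hw : s.w ∈ D.W) (hi : 1 ≤ s.i) (ht : s.i < D.top)
      (h : ∀ c, ¬ D.XAvail s c) : XStep s (xu s)

/-- One step of the second particle. -/
def YStep (s t : Pair n) : Prop := D.XStep (D.mirror s) (D.mirror t)

lemma YStep.hor (s : Pair n) (c : Fin n) (hw : s.v ∈ D.W) (hi : 1 ≤ s.j) (ht : s.j < D.top)
    (h : YAvail s c) : D.YStep s (D.yh c s) := by
  rw [YStep, D.mirror_yh hi h]
  exact XStep.hor _ c hw hi ht (D.xAvail_mirror.2 h)

lemma YStep.up (s : Pair n) (hw : s.v ∈ D.W) (hi : 1 ≤ s.j) (ht : s.j < D.top)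
    (h : ∀ c, ¬ YAvail s c) : D.YStep s (yu s) := by
  rw [YStep, D.mirror_yu]
  exact XStep.up _ hw hi ht fun c hc => h c (D.xAvail_mirror.1 hc)

lemma xAvail_xh {s : Pair n} {c d : Fin n} (hw : s.w ∈ D.W) (hi : 1 ≤ s.i)
    (hc : D.XAvail s c) (hd : D.XAvail s d) (hcd : c ≠ d) : D.XAvail (D.xh c s) d := by
  refine ⟨?_, ?_⟩
  · have := D.orthogonal hw hd.1 hc.1 hcd.symm
    simp [this, hd.1]
  · rw [D.Q_xh hi hc, xh_J, Function.update_of_ne hcd.symm]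
    exact hd.2

lemma xh_xh {s : Pair n} {c d : Fin n} (hi : 1 ≤ s.i)
    (hc : D.XAvail s c) (hd : D.XAvail s d) (hcd : c ≠ d) :
    D.xh c (D.xh d s) = D.xh d (D.xh c s) := by
  refine Pair.ext ?_ ?_ rfl rfl rfl
  · simp only [xh_J, xh_i, D.Q_xh hi hc, D.Q_xh hi hd, Function.update_of_ne hcd,
      Function.update_of_ne hcd.symm]
    exact Function.update_comm hcd.symm _ _ _
  · funext b
    simp only [xh_w]; ring

open Relation

/-- A completed run of the first particle. -/
def XRun (s t : Pair n) : Prop := ReflTransGen D.XStep s t ∧ t.i = D.top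

variable {D}

lemma XRun.refl {s : Pair n} (h : s.i = D.top) : D.XRun s s := ⟨.refl, h⟩

lemma XRun.head {s s' t : Pair n} (h : D.XStep s s') (h' : D.XRun s' t) : D.XRun s t :=
  ⟨.head h h'.1, h'.2⟩

lemma XStep.lt_top {s t : Pair n} (h : D.XStep s t) : s.i < D.top := by
  cases h <;> assumption

lemma XRun.eq_of_top {s t : Pair n} (h : ReflTransGen D.XStep s t) (hs : s.i = D.top) :
    s = t := by
  rcases h.cases_head with h | ⟨u, hu, -⟩
  · exact h
  · exact absurd hu.lt_top (by omega)

/-- The diamond property: two removals available at once sit at orthogonal nodes and commute, and a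
move up occurs only if no removal is available. -/
lemma XRun.unique {s t u : Pair n} (ht : D.XRun s t) (hu : D.XRun s u) : t = u := by
  have : Join (ReflTransGen D.XStep) t u := by
    refine church_rosser (fun s t u h1 h2 => ?_) ht.1 hu.1
    cases h1 with
    | hor c hw hi htop hc =>
      cases h2 with
      | hor d _ _ _ hd =>
        by_cases hcd : c = d
        · subst hcd; exact ⟨_, .refl, .refl⟩
        · refine ⟨D.xh d (D.xh c s), .single ?_, .single ?_⟩
          · exact .hor _ d (D.lower _ hw _ hc.1) hi htop (D.xAvail_xh hw hi hc hd hcd)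
          · rw [← D.xh_xh hi hc hd hcd]
            exact .hor _ c (D.lower _ hw _ hd.1) hi htop (D.xAvail_xh hw hi hd hc (Ne.symm hcd))
      | up _ _ _ h => exact absurd hc (h c)
    | up hw hi htop h =>
      cases h2 with
      | hor d _ _ _ hd => exact absurd hd (h d)
      | up => exact ⟨_, .refl, .refl⟩
  obtain ⟨x, h1, h2⟩ := this
  rw [XRun.eq_of_top h1 ht.2, XRun.eq_of_top h2 hu.2]

variable (D)

/-- A bound for the number of remaining steps. -/
def measure (s : Pair n) : ℕ :=
  ∑ a, ((s.J a).map Prod.fst).sum + (D.top - s.i) + (D.top - s.j)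

lemma sum_lengths_shorten {K : Multiset (ℕ × ℤ)} {x : ℕ × ℤ} {m : ℕ} {r : ℤ} (h : x ∈ K)
    (hm : m < x.1) :
    (((m, r) ::ₘ K.erase x).map Prod.fst).sum < (K.map Prod.fst).sum := by
  obtain ⟨K, rfl⟩ := Multiset.exists_cons_of_mem h
  simp
  omega

lemma sum_lengths_update (J : Strings n) (c : Fin n) {x : ℕ × ℤ} {m : ℕ} {r : ℤ} (h : x ∈ J c)
    (hm : m < x.1) :
    ∑ a, ((Function.update J c ((m, r) ::ₘ (J c).erase x) a).map Prod.fst).sum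
      < ∑ a, ((J a).map Prod.fst).sum := by
  refine Finset.sum_lt_sum (fun a _ => ?_) ⟨c, Finset.mem_univ _, ?_⟩
  · by_cases hac : a = c
    · subst hac
      rw [Function.update_self]
      exact (sum_lengths_shorten h hm).le
    · rw [Function.update_of_ne hac]
  · rw [Function.update_self]
    exact sum_lengths_shorten h hm

lemma measure_xh {s : Pair n} {c : Fin n} (hi : 1 ≤ s.i) (h : D.XAvail s c) :
    D.measure (D.xh c s) < D.measure s := by
  have := sum_lengths_update s.J c (m := s.i - 1) (r := D.Q s c (s.i - 1)) h.2
    (by simp only; omega)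
  simp only [measure, xh_J, xh_i, xh_j]
  omega

lemma measure_yh {s : Pair n} {c : Fin n} (hj : 1 ≤ s.j) (h : YAvail s c) :
    D.measure (D.yh c s) < D.measure s := by
  have := sum_lengths_update s.J c (m := s.j - 1) (r := 0) h.2 (by simp only; omega)
  simp only [measure, yh_J, yh_i, yh_j]
  omega

lemma measure_xu {s : Pair n} (h : s.i < D.top) : D.measure (xu s) < D.measure s := by
  simp only [measure, xu_J, xu_i, xu_j]
  omega

lemma measure_yu {s : Pair n} (h : s.j < D.top) : D.measure (yu s) < D.measure s := by
  have : ∀ a, ((yu s).J a).map Prod.fst = (s.J a).map Prod.fst := fun a => by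
    simp [yu_J]
  simp only [measure, this, yu_i, yu_j]
  omega

lemma XRun.exists (s : Pair n) (hw : s.w ∈ D.W) (hi : 1 ≤ s.i) (ht : s.i ≤ D.top) :
    ∃ t, D.XRun s t := by
  induction hm : D.measure s using Nat.strong_induction_on generalizing s with
  | _ m ih =>
    rcases ht.eq_or_lt with h | h
    · exact ⟨s, XRun.refl h⟩
    · by_cases hc : ∃ c, D.XAvail s c
      · obtain ⟨c, hc⟩ := hc
        obtain ⟨t, h'⟩ := ih _ (hm ▸ D.measure_xh hi hc) (D.xh c s) (D.lower _ hw _ hc.1) hi ht rfl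
        exact ⟨t, h'.head (.hor _ c hw hi h hc)⟩
      · obtain ⟨t, h'⟩ := ih _ (hm ▸ D.measure_xu h) (xu s) hw (Nat.le_add_left _ _) h rfl
        exact ⟨t, h'.head (.up _ hw hi h (not_exists.1 hc))⟩

open Classical in
/-- The result of the complete run of the first particle. -/
noncomputable def RX (s : Pair n) : Pair n := if h : ∃ t, D.XRun s t then h.choose else s

/-- The result of the complete run of the second particle. -/
noncomputable def RY (s : Pair n) : Pair n := D.mirror (D.RX (D.mirror s))

variable {D}

lemma XRun.RX_eq {s t : Pair n} (h : D.XRun s t) : D.RX s = t := by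
  have h' : ∃ t, D.XRun s t := ⟨t, h⟩
  rw [RX, dif_pos h']
  exact h'.choose_spec.unique h

lemma XStep.RX_eq {s t : Pair n} (h : D.XStep s t) : D.RX s = D.RX t := by
  have ht : ∃ u, D.XRun t u := by
    cases h with
    | hor c hw hi htop hc => exact XRun.exists D _ (D.lower _ hw _ hc.1) hi htop.le
    | up hw hi htop hc => exact XRun.exists D _ hw (Nat.le_add_left _ _) htop
  obtain ⟨u, hu⟩ := ht
  rw [hu.RX_eq, (hu.head h).RX_eq]

lemma YStep.RY_eq {s t : Pair n} (h : D.YStep s t) : D.RY s = D.RY t := by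
  rw [RY, RY, XStep.RX_eq h]

variable (D)

/-- The first particle runs first. -/
noncomputable def xy (s : Pair n) : Pair n := D.RY (D.RX s)

/-- The second particle runs first. -/
noncomputable def yx (s : Pair n) : Pair n := D.RX (D.RY s)

lemma RX_mirror (s : Pair n) : D.RX (D.mirror s) = D.mirror (D.RY s) := by
  rw [RY, mirror_mirror]

lemma RY_mirror (s : Pair n) : D.RY (D.mirror s) = D.mirror (D.RX s) := by
  rw [RY, mirror_mirror]

lemma xy_mirror (s : Pair n) : D.xy (D.mirror s) = D.mirror (D.yx s) := by
  rw [xy, yx, RX_mirror, RY_mirror]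

variable {D}

lemma XStep.xy_eq {s t : Pair n} (h : D.XStep s t) : D.xy s = D.xy t := by
  rw [xy, xy, h.RX_eq]

lemma YStep.yx_eq {s t : Pair n} (h : D.YStep s t) : D.yx s = D.yx t := by
  rw [yx, yx, h.RY_eq]

lemma yx_eq_of_mirror {s t : Pair n} (h : D.xy (D.mirror s) = D.xy (D.mirror t)) :
    D.yx s = D.yx t := by
  rw [xy_mirror, xy_mirror] at h
  rw [← D.mirror_mirror (D.yx s), h, mirror_mirror]

variable (D)

/-- A step of the second particle that commutes with the run of the first one. -/
lemma xy_eq_of_invariant (P : Pair n → Prop) (g : Pair n → Pair n)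
    (hg : ∀ s, (g s).i = s.i) (hY : ∀ s, P s → D.YStep s (g s))
    (hX : ∀ s t, P s → D.XStep s t → P t ∧ D.XStep (g s) (g t))
    {s : Pair n} (hs : P s) (hw : s.w ∈ D.W) (hi : 1 ≤ s.i) (ht : s.i ≤ D.top) :
    D.xy s = D.xy (g s) := by
  obtain ⟨t, hrun, htop⟩ := XRun.exists D s hw hi ht
  -- The map `g` is carried along the whole run of the first particle; at its end `P` still makes
  -- `g` a step of the second particle, which the following run absorbs.
  have key : P t ∧ ReflTransGen D.XStep (g s) (g t) := by
    clear htop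
    induction hrun with
    | refl => exact ⟨hs, .refl⟩
    | tail _ h ih => exact ⟨(hX _ _ ih.1 h).1, ih.2.tail (hX _ _ ih.1 h).2⟩
  rw [xy, xy, XRun.RX_eq ⟨hrun, htop⟩, XRun.RX_eq ⟨key.2, (hg t).trans htop⟩, (hY t key.1).RY_eq]

end PairData
end RiggedConfiguration

/-! ### Steps of one particle against a run of the other -/

namespace RiggedConfiguration
namespace PairData

variable {n : ℕ} (D : PairData n)

/-- At a common node two separate strings are required. This excludes a single string that is both
singular and cosingular, the case that leads to swaps. -/
lemma yAvail_xh {s : Pair n} {c d : Fin n} (hd : YAvail s d)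
    (hcd : c = d → ∃ K, s.J c = (s.i, D.Q s c s.i) ::ₘ (s.j, 0) ::ₘ K) :
    YAvail (D.xh c s) d := by
  refine ⟨hd.1, ?_⟩
  by_cases h : c = d
  · obtain ⟨K, hK⟩ := hcd h
    subst h
    simp [xh_J, hK]
  · rw [xh_J, Function.update_of_ne (Ne.symm h)]
    exact hd.2

lemma xAvail_yh {s : Pair n} {c d : Fin n} (hj : 1 ≤ s.j) (hc : D.XAvail s c) (hd : YAvail s d)
    (hcd : c = d → ∃ K, s.J c = (s.i, D.Q s c s.i) ::ₘ (s.j, 0) ::ₘ K) :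
    D.XAvail (D.yh d s) c := by
  refine ⟨hc.1, ?_⟩
  rw [D.Q_yh hj hd]
  by_cases h : c = d
  · obtain ⟨K, hK⟩ := hcd h
    subst h
    rw [Multiset.cons_swap] at hK
    simp [yh_J, hK]
  · rw [yh_J, Function.update_of_ne h]
    exact hc.2

lemma xh_yh {s : Pair n} {c d : Fin n} (hj : 1 ≤ s.j) (hd : YAvail s d)
    (hcd : c = d → ∃ K, s.J c = (s.i, D.Q s c s.i) ::ₘ (s.j, 0) ::ₘ K) :
    D.xh c (D.yh d s) = D.yh d (D.xh c s) := by
  refine Pair.ext ?_ rfl rfl rfl rfl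
  simp only [xh_J, yh_J, D.Q_yh hj hd, xh_j, yh_i]
  by_cases h : c = d
  · obtain ⟨K, hK⟩ := hcd h
    subst h
    simp only [Function.update_self, Function.update_idem, hK, Multiset.erase_cons_head]
    congr 1
    rw [Multiset.cons_swap (s.i, _) (s.j, _), Multiset.erase_cons_head,
      Multiset.cons_swap (s.j - 1, _) (s.i, _), Multiset.erase_cons_head,
      Multiset.cons_swap (s.i - 1, _) (s.j, _), Multiset.erase_cons_head, Multiset.cons_swap]
  · simp only [Function.update_of_ne h, Function.update_of_ne (Ne.symm h)]
    exact Function.update_comm (Ne.symm h) _ _ _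

lemma mem_yu {s : Pair n} {a : Fin n} {l : ℕ} {r : ℤ} :
    (l, r) ∈ (yu s).J a ↔ (l, if l = s.j then r + s.v a else r) ∈ s.J a := by
  rw [yu_J, Multiset.mem_map]
  constructor
  · rintro ⟨⟨l', r'⟩, h, he⟩
    simp only [Prod.mk.injEq] at he
    obtain ⟨rfl, rfl⟩ := he
    split_ifs <;> simpa using h
  · intro h
    refine ⟨_, h, ?_⟩
    simp only [Prod.mk.injEq, true_and]
    split_ifs <;> simp

/-- At length `s.j` the riggings and the vacancy number drop by the same amount, so singularity is
not affected. -/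
lemma xAvail_yu {s : Pair n} {c : Fin n} : D.XAvail (yu s) c ↔ D.XAvail s c := by
  rw [XAvail, XAvail, mem_yu, Q_yu, yu_i, yu_w]
  split_ifs <;> simp

lemma xh_yu {s : Pair n} {c : Fin n} (hc : D.XAvail s c) :
    D.xh c (yu s) = yu (D.xh c s) := by
  refine Pair.ext ?_ rfl rfl rfl rfl
  funext a
  obtain ⟨K, hK⟩ := Multiset.exists_cons_of_mem hc.2
  rw [yu_J, xh_J, xh_J]
  by_cases h : a = c
  · subst h
    simp only [Function.update_self, yu_i, Q_yu, yu_J, hK, Multiset.map_cons,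
      Multiset.erase_cons_head]
    have : D.Q s a s.i - (if s.i = s.j then s.v a else 0) =
        if s.i = s.j then D.Q s a s.i - s.v a else D.Q s a s.i := by
      split_ifs <;> simp
    rw [this, Multiset.erase_cons_head]
    congr 2
    change D.Q s a (s.i - 1) - (if s.i - 1 = s.j then s.v a else 0) =
      if s.i - 1 = s.j then D.Q s a (s.i - 1) - s.v a else D.Q s a (s.i - 1)
    split_ifs <;> simp
  · rw [Function.update_of_ne h, Function.update_of_ne h]; rfl

lemma xu_yu (s : Pair n) : xu (yu s) = yu (xu s) := rfl

lemma xu_yh (s : Pair n) (c : Fin n) : xu (D.yh c s) = D.yh c (xu s) := rfl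

lemma exists_cons_cons {α : Type*} {K : Multiset α} {x y : α} (hx : x ∈ K) (hy : y ∈ K)
    (h : x ≠ y) : ∃ K', K = x ::ₘ y ::ₘ K' := by
  obtain ⟨K, rfl⟩ := Multiset.exists_cons_of_mem hx
  rcases Multiset.mem_cons.1 hy with h' | h'
  · exact absurd h'.symm h
  · obtain ⟨K, rfl⟩ := Multiset.exists_cons_of_mem h'
    exact ⟨K, rfl⟩

/-- The particles have admissible weights and levels. -/
structure Ok (s : Pair n) : Prop where
  w : s.w ∈ D.W
  v : s.v ∈ D.W
  i : 1 ≤ s.i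
  j : 1 ≤ s.j
  it : s.i ≤ D.top
  jt : s.j ≤ D.top

variable {D}

lemma Ok.mirror {s : Pair n} (h : D.Ok s) : D.Ok (D.mirror s) :=
  ⟨h.v, h.w, h.j, h.i, h.jt, h.it⟩

lemma Ok.xh {s : Pair n} (h : D.Ok s) {c : Fin n} (hc : D.XAvail s c) : D.Ok (D.xh c s) :=
  ⟨D.lower _ h.w _ hc.1, h.v, h.i, h.j, h.it, h.jt⟩

lemma Ok.yh {s : Pair n} (h : D.Ok s) {c : Fin n} (hc : YAvail s c) : D.Ok (D.yh c s) :=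
  ⟨h.w, D.lower _ h.v _ hc.1, h.i, h.j, h.it, h.jt⟩

lemma Ok.xu {s : Pair n} (h : D.Ok s) (ht : s.i < D.top) : D.Ok (xu s) :=
  ⟨h.w, h.v, Nat.le_add_left _ _, h.j, ht, h.jt⟩

lemma Ok.yu {s : Pair n} (h : D.Ok s) (ht : s.j < D.top) : D.Ok (yu s) :=
  ⟨h.w, h.v, h.i, Nat.le_add_left _ _, h.it, ht⟩

lemma mem_erase_cons {α : Type*} [DecidableEq α] {K : Multiset α} {x y z : α}
    (h : z ∈ y ::ₘ K.erase x) : z = y ∨ z ∈ K := by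
  rcases Multiset.mem_cons.1 h with h | h
  · exact .inl h
  · exact .inr (Multiset.mem_of_mem_erase h)

lemma mem_xh {s : Pair n} {a c : Fin n} {x : ℕ × ℤ} (h : x ∈ (D.xh c s).J a) :
    (a = c ∧ x = (s.i - 1, D.Q s c (s.i - 1))) ∨ x ∈ s.J a := by
  rw [xh_J] at h
  by_cases ha : a = c
  · subst ha
    rw [Function.update_self] at h
    exact (mem_erase_cons h).imp (fun h => ⟨rfl, h⟩) id
  · rw [Function.update_of_ne ha] at h
    exact .inr h

lemma mem_yh {s : Pair n} {a c : Fin n} {x : ℕ × ℤ} (h : x ∈ (D.yh c s).J a) :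
    (a = c ∧ x = (s.j - 1, 0)) ∨ x ∈ s.J a := by
  rw [yh_J] at h
  by_cases ha : a = c
  · subst ha
    rw [Function.update_self] at h
    exact (mem_erase_cons h).imp (fun h => ⟨rfl, h⟩) id
  · rw [Function.update_of_ne ha] at h
    exact .inr h

/-- The only new string has length `s.j - 1`, below the level of the first particle. -/
lemma not_xAvail_yh {s : Pair n} {c : Fin n} (hj : 1 ≤ s.j) (hji : s.j ≤ s.i)
    (hc : YAvail s c) (h : ∀ d, ¬ D.XAvail s d) (d : Fin n) : ¬ D.XAvail (D.yh c s) d := by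
  rintro ⟨h1, h2⟩
  rw [D.Q_yh hj hc] at h2
  rcases mem_yh h2 with ⟨-, h2⟩ | h2
  · simp only [yh_i, Prod.mk.injEq] at h2
    omega
  · exact h d ⟨h1, h2⟩

lemma not_yAvail_xh {s : Pair n} {c : Fin n} (hi : 1 ≤ s.i) (hij : s.i ≤ s.j)
    (h : ∀ d, ¬ YAvail s d) (d : Fin n) : ¬ YAvail (D.xh c s) d := by
  rintro ⟨h1, h2⟩
  rcases mem_xh h2 with ⟨-, h2⟩ | h2
  · simp only [xh_j, Prod.mk.injEq] at h2
    omega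
  · exact h d ⟨h1, h2⟩

/-- The second particle lags behind, so the string it shortens is too short to be touched by the
first one, and the removal can be made before or after that run. -/
lemma xy_yh {s : Pair n} {c : Fin n} (hs : D.Ok s) (hji : s.j < s.i) (hc : YAvail s c) :
    D.xy s = D.xy (D.yh c s) := by
  refine D.xy_eq_of_invariant
    (fun s => D.Ok s ∧ s.j < s.i ∧ YAvail s c) (D.yh c) (fun _ => rfl) ?_ ?_
    ⟨hs, hji, hc⟩ hs.w hs.i hs.it
  · rintro s ⟨hs, hji, hc⟩
    exact YStep.hor _ s c hs.v hs.j (hji.trans_le hs.it) hc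
  · rintro s t ⟨hs, hji, hc⟩ hst
    cases hst with
    | hor d hw hi ht hd =>
      have key : d = c → ∃ K, s.J d = (s.i, D.Q s d s.i) ::ₘ (s.j, 0) ::ₘ K := by
        rintro rfl
        exact exists_cons_cons hd.2 hc.2 (by simp only [ne_eq, Prod.mk.injEq]; omega)
      refine ⟨⟨hs.xh hd, hji, D.yAvail_xh hc key⟩, ?_⟩
      rw [← D.xh_yh hs.j hc key]
      exact XStep.hor _ _ hw hi ht (D.xAvail_yh hs.j hd hc key)
    | up hw hi ht h =>
      exact ⟨⟨hs.xu ht, Nat.lt_succ_of_lt hji, hc⟩,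
        XStep.up _ hw hi ht (not_xAvail_yh hs.j hji.le hc h)⟩

/-- The first particle may create a string of length `s.i - 1 = s.j`. Its rigging is the vacancy
number, so positivity at active nodes keeps it from being cosingular, and the lagging particle
remains blocked. -/
lemma xy_yu {s : Pair n} (hs : D.Ok s) (hji : s.j < s.i) (hY : ∀ c, ¬ YAvail s c)
    (hQ : ∀ a, s.v a = 1 → 0 < D.Q s a s.j) : D.xy s = D.xy (yu s) := by
  refine D.xy_eq_of_invariant
    (fun s => D.Ok s ∧ s.j < s.i ∧ (∀ c, ¬ YAvail s c) ∧ ∀ a, s.v a = 1 → 0 < D.Q s a s.j)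
    yu (fun _ => rfl) ?_ ?_ ⟨hs, hji, hY, hQ⟩ hs.w hs.i hs.it
  · rintro s ⟨hs, hji, hY, hQ⟩
    exact YStep.up _ s hs.v hs.j (hji.trans_le hs.it) hY
  · rintro s t ⟨hs, hji, hY, hQ⟩ hst
    cases hst with
    | hor d hw hi ht hd =>
      refine ⟨⟨hs.xh hd, hji, ?_, ?_⟩, ?_⟩
      · rintro c ⟨h1, h2⟩
        rcases mem_xh h2 with ⟨h3, h4⟩ | h2
        · subst h3
          simp only [xh_j, Prod.mk.injEq] at h4
          have := hQ c h1
          rw [h4.1, ← h4.2] at this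
          exact lt_irrefl _ this
        · exact hY c ⟨h1, h2⟩
      · rw [D.Q_xh hi hd]
        exact hQ
      · rw [← D.xh_yu hd]
        exact XStep.hor _ _ hw hi ht (D.xAvail_yu.2 hd)
    | up hw hi ht h =>
      refine ⟨⟨hs.xu ht, Nat.lt_succ_of_lt hji, hY, ?_⟩,
        XStep.up _ hw hi ht fun c hc => h c (D.xAvail_yu.1 hc)⟩
      intro a ha
      rw [Q_xu, xu_j, if_neg (by omega), sub_zero]
      exact hQ a ha

lemma yx_xh {s : Pair n} {c : Fin n} (hs : D.Ok s) (hij : s.i < s.j) (hc : D.XAvail s c) :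
    D.yx s = D.yx (D.xh c s) := by
  apply yx_eq_of_mirror
  rw [D.mirror_xh hs.i hc]
  exact xy_yh hs.mirror hij (D.yAvail_mirror.2 hc)

lemma yx_xu {s : Pair n} (hs : D.Ok s) (hij : s.i < s.j) (hX : ∀ c, ¬ D.XAvail s c)
    (hQ : ∀ a, s.w a = 1 → 0 < D.Q s a s.i) : D.yx s = D.yx (xu s) := by
  apply yx_eq_of_mirror
  rw [D.mirror_xu]
  refine xy_yu hs.mirror hij (fun c hc => hX c (D.yAvail_mirror.1 hc)) ?_
  rw [Q_mirror]
  exact hQ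

lemma RX_of_top {s : Pair n} (h : s.i = D.top) : D.RX s = s := (XRun.refl h).RX_eq

lemma RY_of_top {s : Pair n} (h : s.j = D.top) : D.RY s = s := by
  rw [RY, RX_of_top (by exact h), mirror_mirror]

lemma xy_of_top {s : Pair n} (hi : s.i = D.top) (hj : s.j = D.top) : D.xy s = s := by
  rw [xy, RX_of_top hi, RY_of_top hj]

lemma yx_of_top {s : Pair n} (hi : s.i = D.top) (hj : s.j = D.top) : D.yx s = s := by
  rw [yx, RY_of_top hj, RX_of_top hi]

end PairData
end RiggedConfiguration

/-! ### Particles at a common level: concavity, swaps and jumps -/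

namespace RiggedConfiguration
namespace PairData

variable {n : ℕ} (D : PairData n)

/-- The contribution of the neighbours of `a` to the second difference of the vacancy numbers. -/
def nbr (s : Pair n) (a : Fin n) (l : ℕ) : ℤ :=
  ∑ b ∈ Finset.univ.erase a, -D.A a b * mult (s.J b) l

lemma nbr_term_nonneg (s : Pair n) {a b : Fin n} (l : ℕ) (h : a ≠ b) :
    0 ≤ -D.A a b * mult (s.J b) l := by
  have h1 := mult_nonneg (s.J b) l
  rcases D.offdiag a b h with h2 | h2 <;> rw [h2] <;> linarith

lemma nbr_nonneg (s : Pair n) (a : Fin n) (l : ℕ) : 0 ≤ D.nbr s a l :=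
  Finset.sum_nonneg fun _ hb => D.nbr_term_nonneg s l (Finset.ne_of_mem_erase hb).symm

/-- Each string of length `l` at a node joined to `a` would contribute 1 to a sum of non-negative
terms. -/
lemma orthogonal_of_nbr {s : Pair n} {a b : Fin n} {l : ℕ} {r : ℤ} (h : D.nbr s a l ≤ 0)
    (hab : a ≠ b) (hx : (l, r) ∈ s.J b) : D.A a b = 0 := by
  have h1 : -D.A a b * mult (s.J b) l ≤ D.nbr s a l :=
    Finset.single_le_sum (f := fun b => -D.A a b * mult (s.J b) l)
      (fun b hb => D.nbr_term_nonneg s l (Finset.ne_of_mem_erase hb).symm)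
      (Finset.mem_erase.2 ⟨hab.symm, Finset.mem_univ b⟩)
  have h2 : 1 ≤ mult (s.J b) l := mult_pos hx
  rcases D.offdiag a b hab with h3 | h3
  · exact h3
  · rw [h3] at h1; linarith

lemma sum_eq_nbr (s : Pair n) (a : Fin n) (l : ℕ) :
    ∑ b, -D.A a b * mult (s.J b) l = D.nbr s a l - 2 * mult (s.J a) l := by
  rw [← Finset.add_sum_erase _ _ (Finset.mem_univ a), D.diag, nbr]
  ring

lemma second_difference_at_level {s : Pair n} (hi : 1 ≤ s.i) (hs : s.j = s.i) (a : Fin n) :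
    D.Q s a (s.i - 1) + D.Q s a (s.i + 1) + D.nbr s a s.i - 2 * mult (s.J a) s.i
      + s.w a + s.v a ≤ 2 * D.Q s a s.i := by
  obtain ⟨l, hl⟩ := Nat.exists_eq_add_of_le' hi
  have h := D.Q_second_difference s a l
  rw [sum_eq_nbr] at h
  rw [hs, ← hl, if_pos rfl, if_pos rfl, if_neg (by omega), if_neg (by omega)] at h
  rw [show l = s.i - 1 by omega, show s.i - 1 + 2 = s.i + 1 by omega] at h
  linarith

lemma second_difference_above_level {s : Pair n} (hs : s.j = s.i) (a : Fin n) :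
    D.Q s a s.i + D.Q s a (s.i + 2) + D.nbr s a (s.i + 1) - 2 * mult (s.J a) (s.i + 1)
      ≤ 2 * D.Q s a (s.i + 1) := by
  have h := D.Q_second_difference s a s.i
  rw [sum_eq_nbr] at h
  rw [hs, if_neg (by omega), if_neg (by omega), if_neg (by omega), if_neg (by omega)] at h
  linarith

/-- Both particles are at the same level of a rigged configuration. -/
structure Valid (s : Pair n) : Prop where
  ok : D.Ok s
  sync : s.j = s.i
  len : ∀ a, ∀ x ∈ s.J a, x.1 < D.top
  nonneg : ∀ a l, 0 ≤ D.Q s a l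
  rig : ∀ a, ∀ x ∈ s.J a, 0 ≤ x.2 ∧ x.2 ≤ D.Q s a x.1

/-- Both particles are at the same level, where no box can be removed, and all strings will be
admissible after both particles have moved up. -/
structure Quiet (s : Pair n) : Prop where
  ok : D.Ok s
  sync : s.j = s.i
  lt : s.i < D.top
  len : ∀ a, ∀ x ∈ s.J a, x.1 < D.top
  nonneg : ∀ a l, l ≠ s.i → 0 ≤ D.Q s a l
  rig : ∀ a, ∀ x ∈ s.J a, x.1 ≠ s.i → 0 ≤ x.2 ∧ x.2 ≤ D.Q s a x.1
  rig_level : ∀ a r, (s.i, r) ∈ s.J a → s.v a ≤ r ∧ r ≤ D.Q s a s.i - s.w a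

/-- The vacancy number at the common level after both particles have moved up. -/
def after (s : Pair n) (a : Fin n) : ℤ := D.Q s a s.i - s.w a - s.v a

/-- Both particles remove a box from the same string of length one more than their level. -/
def jump (c : Fin n) (s : Pair n) : Pair n where
  J := Function.update s.J c ((s.i - 1, 0) ::ₘ (s.J c).erase (s.i + 1, 0))
  w := fun b => s.w b - D.A b c
  v := fun b => s.v b - D.A b c
  i := s.i
  j := s.j

/-- A box removal at `c` is transferred from the first particle to the second one. -/
def swap (c : Fin n) (s : Pair n) : Pair n where
  J := s.J
  w := fun b => s.w b + D.A b c
  v := fun b => s.v b - D.A b c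
  i := s.i
  j := s.j

/-- The condition under which a swap at `c` does not influence the result. -/
structure Swappable (c : Fin n) (s : Pair n) : Prop where
  w : s.w c = -1
  v : s.v c = 1
  below : D.Q s c (s.i - 1) = 0
  level : D.Q s c s.i = 0

@[simp] lemma swap_i (c : Fin n) (s : Pair n) : (D.swap c s).i = s.i := rfl
@[simp] lemma swap_j (c : Fin n) (s : Pair n) : (D.swap c s).j = s.j := rfl
@[simp] lemma swap_J (c : Fin n) (s : Pair n) : (D.swap c s).J = s.J := rfl
@[simp] lemma swap_w (c : Fin n) (s : Pair n) : (D.swap c s).w = fun b => s.w b + D.A b c := rfl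
@[simp] lemma swap_v (c : Fin n) (s : Pair n) : (D.swap c s).v = fun b => s.v b - D.A b c := rfl

@[simp] lemma jump_i (c : Fin n) (s : Pair n) : (D.jump c s).i = s.i := rfl
@[simp] lemma jump_j (c : Fin n) (s : Pair n) : (D.jump c s).j = s.j := rfl
@[simp] lemma jump_w (c : Fin n) (s : Pair n) : (D.jump c s).w = fun b => s.w b - D.A b c := rfl
@[simp] lemma jump_v (c : Fin n) (s : Pair n) : (D.jump c s).v = fun b => s.v b - D.A b c := rfl

lemma jump_J (c : Fin n) (s : Pair n) : (D.jump c s).J =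
    Function.update s.J c ((s.i - 1, 0) ::ₘ (s.J c).erase (s.i + 1, 0)) := rfl

/-- At a common level the two weight changes cancel. -/
lemma Q_swap {s : Pair n} (hs : s.j = s.i) (c : Fin n) : D.Q (D.swap c s) = D.Q s := by
  funext a l
  have e : D.Q (D.swap c s) a l = D.base a l - ∑ b, D.A a b * boxes (s.J b) l
    + (if s.i ≤ l then s.w a + D.A a c else 0) + (if s.j ≤ l then s.v a - D.A a c else 0) := rfl
  rw [e, Q, hs]
  split_ifs <;> ring

variable {D}

lemma Valid.xh {s : Pair n} (h : D.Valid s) {c : Fin n} (hc : D.XAvail s c) :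
    D.Valid (D.xh c s) := by
  refine ⟨h.ok.xh hc, h.sync, fun a x hx => ?_, ?_, fun a x hx => ?_⟩
  · rcases mem_xh hx with ⟨-, rfl⟩ | hx
    · have := h.ok.it; have := h.ok.i; simp only; omega
    · exact h.len a x hx
  · rw [D.Q_xh h.ok.i hc]; exact h.nonneg
  · rw [D.Q_xh h.ok.i hc]
    rcases mem_xh hx with ⟨rfl, rfl⟩ | hx
    · exact ⟨h.nonneg _ _, le_rfl⟩
    · exact h.rig a x hx

lemma Valid.yh {s : Pair n} (h : D.Valid s) {c : Fin n} (hc : YAvail s c) :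
    D.Valid (D.yh c s) := by
  refine ⟨h.ok.yh hc, h.sync, fun a x hx => ?_, ?_, fun a x hx => ?_⟩
  · rcases mem_yh hx with ⟨-, rfl⟩ | hx
    · have := h.ok.jt; have := h.ok.j; simp only; omega
    · exact h.len a x hx
  · rw [D.Q_yh h.ok.j hc]; exact h.nonneg
  · rw [D.Q_yh h.ok.j hc]
    rcases mem_yh hx with ⟨rfl, rfl⟩ | hx
    · exact ⟨le_rfl, h.nonneg _ _⟩
    · exact h.rig a x hx

lemma Swappable.ok_swap {s : Pair n} {c : Fin n} (h : D.Swappable c s) (hs : D.Ok s) :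
    D.Ok (D.swap c s) :=
  ⟨D.raise _ hs.w _ h.w, D.lower _ hs.v _ h.v, hs.i, hs.j, hs.it, hs.jt⟩

lemma Valid.swap {s : Pair n} (h : D.Valid s) {c : Fin n} (hc : D.Swappable c s) :
    D.Valid (D.swap c s) := by
  refine ⟨hc.ok_swap h.ok, h.sync, h.len, ?_, ?_⟩
  · rw [D.Q_swap h.sync]; exact h.nonneg
  · rw [D.Q_swap h.sync]; exact h.rig

/-- A blocked particle of weight 1 at a node sees no string of its level there with extremal
rigging, so by integrality there is one unit of slack; for weights 0 and −1 no slack is needed. -/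
lemma Valid.quiet {s : Pair n} (h : D.Valid s) (ht : s.i < D.top) (hX : ∀ c, ¬ D.XAvail s c)
    (hY : ∀ c, ¬ YAvail s c) : D.Quiet s := by
  refine ⟨h.ok, h.sync, ht, h.len, fun a l _ => h.nonneg a l, fun a x hx _ => h.rig a x hx,
    fun a r hr => ?_⟩
  have h1 := h.rig a _ hr
  simp only at h1
  have h2 : ¬ (s.v a = 1 ∧ r = 0) := by
    rintro ⟨h2, rfl⟩
    exact hY a ⟨h2, h.sync ▸ hr⟩
  have h3 : ¬ (s.w a = 1 ∧ r = D.Q s a s.i) := by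
    rintro ⟨h3, rfl⟩
    exact hX a ⟨h3, hr⟩
  have h4 := D.minuscule _ h.ok.v a
  have h5 := D.minuscule _ h.ok.w a
  omega

lemma Quiet.not_xAvail {s : Pair n} (h : D.Quiet s) (c : Fin n) : ¬ D.XAvail s c := by
  rintro ⟨h1, h2⟩
  have := (h.rig_level c _ h2).2
  omega

lemma Quiet.not_yAvail {s : Pair n} (h : D.Quiet s) (c : Fin n) : ¬ YAvail s c := by
  rintro ⟨h1, h2⟩
  rw [h.sync] at h2
  have := (h.rig_level c _ h2).1
  omega

/-- The weights change only at `c` and its neighbours, where no string has the length of the level.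
-/
lemma Quiet.swap {s : Pair n} (h : D.Quiet s) {c : Fin n} (hc : D.Swappable c s)
    (hm : mult (s.J c) s.i = 0) (hn : D.nbr s c s.i ≤ 0) : D.Quiet (D.swap c s) := by
  refine ⟨hc.ok_swap h.ok, h.sync, h.lt, h.len, ?_, ?_, fun a r hr => ?_⟩
  · rw [D.Q_swap h.sync]; exact h.nonneg
  · rw [D.Q_swap h.sync]; exact h.rig
  · rw [D.Q_swap h.sync]
    have hac : c ≠ a := by
      rintro rfl
      have : 1 ≤ mult (s.J c) s.i := mult_pos hr
      omega
    have h0 : D.A a c = 0 := by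
      rw [D.symm]
      exact D.orthogonal_of_nbr (s := s) (l := s.i) hn hac hr
    simp only [swap_v, swap_w, h0, sub_zero, add_zero]
    exact h.rig_level a r hr

lemma Q_xu_yu {s : Pair n} (hs : s.j = s.i) (a : Fin n) (l : ℕ) :
    D.Q (xu (yu s)) a l = if l = s.i then D.after s a else D.Q s a l := by
  rw [Q_xu, Q_yu, yu_i, yu_w, hs, after]
  split_ifs with h
  · subst h; ring
  · ring

lemma Quiet.valid_xu_yu {s : Pair n} (h : D.Quiet s) (hT : ∀ a, 0 ≤ D.after s a) :
    D.Valid (xu (yu s)) := by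
  refine ⟨(h.ok.yu (h.sync ▸ h.lt)).xu h.lt, congrArg (· + 1) h.sync, fun a x hx => ?_,
    fun a l => ?_, ?_⟩
  · have := mem_yu.1 (show (x.1, x.2) ∈ (yu s).J a from hx)
    have := h.len a _ this
    exact this
  · rw [Q_xu_yu h.sync]
    split_ifs with hl
    · exact hT a
    · exact h.nonneg a l hl
  · rintro a ⟨l, r⟩ hx
    rw [Q_xu_yu h.sync]
    have hx := mem_yu.1 hx
    rw [h.sync] at hx
    simp only at hx ⊢
    split_ifs at hx ⊢ with hl
    · subst hl
      have := h.rig_level a _ hx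
      rw [after]
      omega
    · exact h.rig a _ hx hl

/-- Once the first particle is up, the vacancy number at the old level is `after` plus the weight of
the second one, hence positive where that weight is 1; this is what `xy_yu` needs. -/
lemma Quiet.xy_xu_yu {s : Pair n} (h : D.Quiet s) (hT : ∀ a, 0 ≤ D.after s a) :
    D.xy s = D.xy (xu (yu s)) := by
  rw [(XStep.up _ h.ok.w h.ok.i h.lt h.not_xAvail).xy_eq, xu_yu]
  refine xy_yu (h.ok.xu h.lt) (by simp [h.sync]) h.not_yAvail fun a ha => ?_
  rw [Q_xu, xu_j, h.sync, if_pos rfl]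
  have := hT a
  rw [after] at this
  simp only [xu_v] at ha
  omega

lemma Quiet.yx_xu_yu {s : Pair n} (h : D.Quiet s) (hT : ∀ a, 0 ≤ D.after s a) :
    D.yx s = D.yx (xu (yu s)) := by
  have ht : s.j < D.top := h.sync ▸ h.lt
  rw [(YStep.up _ _ h.ok.v h.ok.j ht h.not_yAvail).yx_eq]
  refine yx_xu (h.ok.yu ht) (by simp [h.sync])
    (fun c hc => h.not_xAvail c (D.xAvail_yu.1 hc)) fun a ha => ?_
  rw [Q_yu, yu_i, h.sync, if_pos rfl]
  have := hT a
  rw [after] at this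
  simp only [yu_w] at ha
  omega

/-- The situation in which both particles act on the same string of length `i + 1`. -/
structure Clash (D : PairData n) (s : Pair n) (a : Fin n) : Prop where
  w : s.w a = 1
  v : s.v a = 1
  level : D.Q s a s.i = 1
  below : D.Q s a (s.i - 1) = 0
  above : D.Q s a (s.i + 1) = 0
  mult : mult (s.J a) s.i = 0
  nbr : D.nbr s a s.i ≤ 0
  mem : (s.i + 1, (0 : ℤ)) ∈ s.J a

/-- A string of the common level at `a` would satisfy `rig_level` and force `after` to be
non-negative, so there is none. Concavity at the level then reads `w + v ≤ 2 Q` up to non-negative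
terms, while `Q < w + v` and `w + v ≤ 2`; this leaves only `w = v = Q = 1`, with all other terms
zero. Concavity one level higher now forces a string of that length, and its rigging must be 0. -/
lemma Quiet.clash {s : Pair n} (h : D.Quiet s) {a : Fin n} (hT : D.after s a < 0) :
    D.Clash s a := by
  have hm : mult (s.J a) s.i = 0 := by
    by_contra hm
    have h0 := mult_nonneg (s.J a) s.i
    obtain ⟨r, hr⟩ := exists_mem_of_mult_pos (show 1 ≤ RiggedConfiguration.mult (s.J a) s.i by omega)
    have := h.rig_level a r hr
    rw [after] at hT
    omega
  have h1 := D.second_difference_at_level h.ok.i h.sync a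
  have h2 := D.second_difference_above_level h.sync a
  have h3 := h.nonneg a (s.i - 1) (by have := h.ok.i; omega)
  have h4 := h.nonneg a (s.i + 1) (by omega)
  have h5 := h.nonneg a (s.i + 2) (by omega)
  have h6 := D.nbr_nonneg s a s.i
  have h7 := D.nbr_nonneg s a (s.i + 1)
  have h8 := D.minuscule _ h.ok.w a
  have h9 := D.minuscule _ h.ok.v a
  rw [after] at hT
  have h10 : D.Q s a (s.i + 1) = 0 := by omega
  refine ⟨by omega, by omega, by omega, by omega, h10, hm, by omega, ?_⟩
  obtain ⟨r, hr⟩ := exists_mem_of_mult_pos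
    (show 1 ≤ RiggedConfiguration.mult (s.J a) (s.i + 1) by omega)
  have := h.rig a _ hr (by simp)
  simp only [h10] at this
  obtain rfl : r = 0 := by omega
  exact hr

/-- Raising the first particle lowers the vacancy number at the old level from 1 to 0, so the string
it shortens becomes cosingular there and the second particle shortens it again. -/
lemma xu_jump {s : Pair n} {a : Fin n} (hs : s.j = s.i) (h : D.Clash s a) :
    xu (D.jump a s) = D.yh a (D.xh a (xu s)) := by
  refine Pair.ext ?_ rfl rfl rfl rfl
  obtain ⟨K, hK⟩ := Multiset.exists_cons_of_mem h.mem
  simp only [xu_J, jump_J, yh_J, xh_J, xu_i, xh_j, xu_j, hs, Q_xu, Function.update_self,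
    Function.update_idem, hK, h.above, h.level, h.w, Nat.add_sub_cancel]
  simp

/-- The same double removal in the other order. The rigging correction made by `yu` is harmless: `a`
has no strings of that length, and those at other nodes lie at nodes orthogonal to `a`, where the
weight is unchanged by the jump. -/
lemma yu_jump {s : Pair n} {a : Fin n} (hi : 1 ≤ s.i) (hs : s.j = s.i) (h : D.Clash s a) :
    yu (D.jump a s) = D.xh a (D.yh a (yu s)) := by
  refine Pair.ext ?_ rfl rfl rfl rfl
  obtain ⟨K, hK⟩ := Multiset.exists_cons_of_mem h.mem
  have hya : YAvail (yu s) a := by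
    refine ⟨h.v, mem_yu.2 ?_⟩
    rw [yu_j, if_neg (by omega), hs]
    exact h.mem
  have hKi : ∀ x ∈ K, x.1 ≠ s.i := by
    intro x hx hx'
    have := mult_pos (show x ∈ s.J a by rw [hK]; exact Multiset.mem_cons_of_mem hx)
    rw [hx', h.mult] at this
    omega
  have hmap : ∀ z : ℤ, K.map (fun x => (x.1, if x.1 = s.i then x.2 - z else x.2)) = K := by
    intro z
    conv_rhs => rw [← Multiset.map_id K]
    refine Multiset.map_congr rfl fun x hx => ?_
    rw [if_neg (hKi x hx)]; rfl
  have hi' : s.i - 1 ≠ s.i := by omega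
  funext b
  by_cases hb : b = a
  · subst hb
    simp only [xh_J, yu_J, jump_J, yh_J, yh_i, yu_i, D.Q_yh (Nat.le_add_left 1 _) hya, Q_yu,
      Function.update_self, hK, yu_j, jump_j, hs, Multiset.map_cons, Multiset.erase_cons_head,
      hmap, h.level, h.v, h.below, Nat.add_sub_cancel, if_neg hi', if_neg (Nat.succ_ne_self s.i),
      if_true, sub_self]
  · rw [xh_J, Function.update_of_ne hb, yh_J, Function.update_of_ne hb, yu_J, yu_J, jump_J,
      Function.update_of_ne hb]
    refine Multiset.map_congr rfl fun x hx => ?_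
    rw [jump_j, hs]
    split_ifs with hx'
    · have : D.A b a = 0 := by
        rw [D.symm]
        exact D.orthogonal_of_nbr (s := s) (l := x.1) (r := x.2) (by rw [hx']; exact h.nbr) (Ne.symm hb) hx
      simp [this]
    · rfl

/-- By `xu_jump` a jump followed by a move up consists of steps whose effect on the vacancy numbers
is known. At `a` the value at the level falls from 1 to −1, which is why `Quiet` does not ask for
non-negativity there. -/
lemma Quiet.Q_jump {s : Pair n} (h : D.Quiet s) {a : Fin n} (hc : D.Clash s a) (b : Fin n)
    (l : ℕ) : D.Q (D.jump a s) b l = D.Q s b l - if l = s.i then D.A b a else 0 := by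
  have hx : D.XAvail (xu s) a := by
    refine ⟨hc.w, ?_⟩
    rw [Q_xu, xu_i, if_neg (by omega), hc.above]
    exact hc.mem
  have hy : YAvail (D.xh a (xu s)) a := by
    refine ⟨hc.v, ?_⟩
    rw [xh_J, Function.update_self, xh_j, xu_j, xu_i, Q_xu, h.sync, Nat.add_sub_cancel,
      if_pos rfl, hc.level, hc.w]
    exact Multiset.mem_cons_self _ _
  have h1 := D.Q_xu (D.jump a s) b l
  rw [xu_jump h.sync hc, D.Q_yh (show 1 ≤ (D.xh a (xu s)).j from h.ok.j) hy,
    D.Q_xh (show 1 ≤ (xu s).i from Nat.le_add_left _ _) hx, Q_xu] at h1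
  change D.Q s b l - (if l = s.i then s.w b else 0) = D.Q (D.jump a s) b l
    - (if l = s.i then s.w b - D.A b a else 0) at h1
  split_ifs at h1 ⊢ <;> linarith

lemma mem_jump {s : Pair n} {a c : Fin n} {x : ℕ × ℤ} (h : x ∈ (D.jump c s).J a) :
    (a = c ∧ x = (s.i - 1, 0)) ∨ x ∈ s.J a := by
  rw [jump_J] at h
  by_cases ha : a = c
  · subst ha
    rw [Function.update_self] at h
    exact (mem_erase_cons h).imp (fun h => ⟨rfl, h⟩) id
  · rw [Function.update_of_ne ha] at h
    exact .inr h

lemma Quiet.jump {s : Pair n} (h : D.Quiet s) {a : Fin n} (hc : D.Clash s a) :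
    D.Quiet (D.jump a s) := by
  have hi := h.ok.i
  refine ⟨⟨D.lower _ h.ok.w _ hc.w, D.lower _ h.ok.v _ hc.v, h.ok.i, h.ok.j, h.ok.it, h.ok.jt⟩,
    h.sync, h.lt, fun b x hx => ?_, fun b l hl => ?_, fun b x hx hl => ?_, fun b r hr => ?_⟩
  · rcases mem_jump hx with ⟨-, rfl⟩ | hx
    · have := h.lt; simp only; omega
    · exact h.len b x hx
  · rw [h.Q_jump hc, if_neg (by exact hl), sub_zero]
    exact h.nonneg b l hl
  · rw [h.Q_jump hc, if_neg (by exact hl), sub_zero]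
    rcases mem_jump hx with ⟨rfl, rfl⟩ | hx
    · rw [hc.below]; simp
    · exact h.rig b x hx hl
  · rcases mem_jump hr with ⟨-, hr⟩ | hr
    · simp only [jump_i, Prod.mk.injEq] at hr
      omega
    · rw [jump_i] at hr
      have hab : a ≠ b := by
        rintro rfl
        have h1 : 1 ≤ RiggedConfiguration.mult (s.J a) s.i := mult_pos hr
        have h2 := hc.mult
        omega
      have h0 : D.A b a = 0 := by
        rw [D.symm]
        exact D.orthogonal_of_nbr (s := s) (l := s.i) hc.nbr hab hr
      rw [h.Q_jump hc]
      simp only [jump_i, jump_v, jump_w, h0, sub_zero, ite_self]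
      exact h.rig_level b r hr

lemma Quiet.xy_jump {s : Pair n} (h : D.Quiet s) {a : Fin n} (hc : D.Clash s a) :
    D.xy s = D.xy (D.jump a s) := by
  have h' := h.jump hc
  have ht : s.i + 1 < D.top := h.len a _ hc.mem
  have hx : D.XAvail (xu s) a := by
    refine ⟨hc.w, ?_⟩
    rw [Q_xu, xu_i, if_neg (by omega), hc.above]
    exact hc.mem
  have hy : YAvail (D.xh a (xu s)) a := by
    refine ⟨hc.v, ?_⟩
    rw [xh_J, Function.update_self, xh_j, xu_j, xu_i, Q_xu, h.sync, Nat.add_sub_cancel,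
      if_pos rfl, hc.level, hc.w]
    exact Multiset.mem_cons_self _ _
  -- Forward: up, then a removal by each particle. The result is the jump followed by the same move
  -- up, which is then undone.
  rw [(XStep.up _ h.ok.w h.ok.i h.lt h.not_xAvail).xy_eq,
    (XStep.hor (xu s) a h.ok.w (Nat.le_add_left _ _) ht hx).xy_eq,
    xy_yh ((h.ok.xu h.lt).xh hx) (by simp [h.sync]) hy, ← xu_jump h.sync hc,
    (XStep.up _ h'.ok.w h'.ok.i h'.lt h'.not_xAvail).xy_eq]

lemma Quiet.yx_jump {s : Pair n} (h : D.Quiet s) {a : Fin n} (hc : D.Clash s a) :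
    D.yx s = D.yx (D.jump a s) := by
  have h' := h.jump hc
  have ht : s.j < D.top := h.sync ▸ h.lt
  have ht' : s.j + 1 < D.top := h.sync ▸ h.len a _ hc.mem
  have hy : YAvail (yu s) a := by
    refine ⟨hc.v, mem_yu.2 ?_⟩
    rw [yu_j, if_neg (by omega), h.sync]
    exact hc.mem
  have hx : D.XAvail (D.yh a (yu s)) a := by
    refine ⟨hc.w, ?_⟩
    rw [D.Q_yh (show 1 ≤ (yu s).j from Nat.le_add_left _ _) hy, yh_J, Function.update_self, yh_i, yu_j, yu_i, Q_yu,
      h.sync, Nat.add_sub_cancel, if_pos rfl, hc.level, hc.v]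
    exact Multiset.mem_cons_self _ _
  rw [(YStep.up _ _ h.ok.v h.ok.j ht h.not_yAvail).yx_eq,
    (YStep.hor _ (yu s) a h.ok.v (Nat.le_add_left _ _) ht' hy).yx_eq,
    yx_xh ((h.ok.yu ht).yh hy) (by simp [h.sync]) hx, ← yu_jump h.ok.i h.sync hc,
    (YStep.up _ _ h'.ok.v h'.ok.j (h'.sync ▸ h'.lt) h'.not_yAvail).yx_eq]

lemma measure_jump {s : Pair n} {a : Fin n} (h : D.Clash s a) :
    D.measure (D.jump a s) < D.measure s := by
  have := sum_lengths_update s.J a (m := s.i - 1) (r := 0) h.mem (by simp only; omega)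
  simp only [measure, jump_J, jump_i, jump_j]
  omega

end PairData
end RiggedConfiguration

/-! ### The simultaneous induction for commutation and swap invariance -/

namespace RiggedConfiguration
namespace PairData

variable {n : ℕ} {D : PairData n}

lemma after_swap {s : Pair n} (hs : s.j = s.i) (c a : Fin n) :
    D.after (D.swap c s) a = D.after s a := by
  have e : D.after (D.swap c s) a
    = D.Q (D.swap c s) a s.i - (s.w a + D.A a c) - (s.v a - D.A a c) := rfl
  rw [e, Q_swap D hs, after]
  ring

lemma jump_swap (s : Pair n) (a c : Fin n) :
    D.jump a (D.swap c s) = D.swap c (D.jump a s) := by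
  refine Pair.ext rfl ?_ ?_ rfl rfl
  · funext b; simp only [jump_w, swap_w]; ring
  · funext b; simp only [jump_v, swap_v]; ring

lemma xh_swap {s : Pair n} (hs : s.j = s.i) (d c : Fin n) :
    D.xh d (D.swap c s) = D.swap c (D.xh d s) := by
  refine Pair.ext ?_ ?_ rfl rfl rfl
  · rw [xh_J, Q_swap D hs]; rfl
  · funext b; simp only [xh_w, swap_w]; ring

lemma yh_swap (s : Pair n) (d c : Fin n) :
    D.yh d (D.swap c s) = D.swap c (D.yh d s) := by
  refine Pair.ext rfl rfl ?_ rfl rfl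
  funext b; simp only [yh_v, swap_v]; ring

lemma yu_swap {s : Pair n} {c : Fin n} (hs : s.j = s.i) (hm : mult (s.J c) s.i = 0)
    (hn : D.nbr s c s.i ≤ 0) : yu (D.swap c s) = D.swap c (yu s) := by
  refine Pair.ext ?_ rfl rfl rfl rfl
  funext b
  rw [swap_J, yu_J, yu_J]
  refine Multiset.map_congr rfl fun x hx => Prod.ext rfl ?_
  change (if x.1 = s.j then x.2 - (s.v b - D.A b c) else x.2)
    = if x.1 = s.j then x.2 - s.v b else x.2
  split_ifs with h
  · rw [hs] at h
    have hbc : c ≠ b := by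
      rintro rfl
      have := mult_pos hx
      rw [h] at this
      omega
    have : D.A b c = 0 := by
      rw [D.symm]
      exact D.orthogonal_of_nbr (s := s) (l := x.1) (r := x.2) (by rw [h]; exact hn) hbc hx
    rw [this, sub_zero]
  · rfl

/-- The two particles commute on `s`. -/
def Commutes (D : PairData n) (s : Pair n) : Prop := (D.xy s).J = (D.yx s).J

/-- The swap at `c` does not influence the result. -/
def SwapInvariant (D : PairData n) (c : Fin n) (s : Pair n) : Prop :=
  (D.xy s).J = (D.xy (D.swap c s)).J

/-- The induction hypothesis of the proof of commutation. -/
structure Below (D : PairData n) (m : ℕ) : Prop where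
  valid : ∀ s, D.measure s < m → D.Valid s → D.Commutes s
  quiet : ∀ s, D.measure s < m → D.Quiet s → D.Commutes s
  valid_swap : ∀ s c, D.measure s < m → D.Valid s → D.Swappable c s → D.SwapInvariant c s
  quiet_swap : ∀ s c, D.measure s < m → D.Quiet s → D.Swappable c s → mult (s.J c) s.i = 0 →
    D.SwapInvariant c s

lemma measure_xu_yu {s : Pair n} (hs : s.j = s.i) (h : s.i < D.top) :
    D.measure (xu (yu s)) < D.measure s :=
  (D.measure_xu (s := yu s) h).trans (D.measure_yu (hs ▸ h))

lemma Below.commutes_of_quiet {s : Pair n} (ih : D.Below (D.measure s)) (h : D.Quiet s) :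
    D.Commutes s := by
  by_cases hT : ∀ a, 0 ≤ D.after s a
  · rw [Commutes, h.xy_xu_yu hT, h.yx_xu_yu hT]
    exact ih.valid _ (measure_xu_yu h.sync h.lt) (h.valid_xu_yu hT)
  · push Not at hT
    obtain ⟨a, ha⟩ := hT
    have hc := h.clash ha
    rw [Commutes, h.xy_jump hc, h.yx_jump hc]
    exact ih.quiet _ (measure_jump hc) (h.jump hc)

/-- The weights −1 and 1 cancel when both particles rise, and concavity forces the vacancy number
one level higher to be 0, so the swap condition passes to the next level. If a jump intervenes, its
node is orthogonal to `c`, since the second weight is 1 at both. -/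
lemma Below.swapInvariant_of_quiet {s : Pair n} {c : Fin n} (ih : D.Below (D.measure s))
    (h : D.Quiet s) (hc : D.Swappable c s) (hm : mult (s.J c) s.i = 0) :
    D.SwapInvariant c s := by
  have h1 := D.second_difference_at_level h.ok.i h.sync c
  rw [hc.w, hc.v, hc.below, hc.level, hm] at h1
  have h2 := h.nonneg c (s.i + 1) (by omega)
  have h3 := D.nbr_nonneg s c s.i
  have hn : D.nbr s c s.i ≤ 0 := by omega
  have habove : D.Q s c (s.i + 1) = 0 := by omega
  have h' := h.swap hc hm hn
  by_cases hT : ∀ a, 0 ≤ D.after s a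
  · have hT' : ∀ a, 0 ≤ D.after (D.swap c s) a := fun a => by
      rw [after_swap h.sync]; exact hT a
    have e : xu (yu (D.swap c s)) = D.swap c (xu (yu s)) := by
      rw [yu_swap h.sync hm hn]; rfl
    rw [SwapInvariant, h.xy_xu_yu hT, h'.xy_xu_yu hT', e]
    refine ih.valid_swap _ c (measure_xu_yu h.sync h.lt) (h.valid_xu_yu hT) ⟨hc.w, hc.v, ?_, ?_⟩
    · rw [xu_i, yu_i, Nat.add_sub_cancel, Q_xu_yu h.sync, if_pos rfl, after, hc.level, hc.w, hc.v]
      rfl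
    · rw [xu_i, yu_i, Q_xu_yu h.sync, if_neg (by omega), habove]
  · push Not at hT
    obtain ⟨a, ha⟩ := hT
    have hcl := h.clash ha
    have hcl' := h'.clash (a := a) (by rw [after_swap h.sync]; exact ha)
    have hca : c ≠ a := by
      rintro rfl
      have := hcl.w
      have := hc.w
      omega
    have h0 : D.A c a = 0 := D.orthogonal h.ok.v hc.v hcl.v hca
    rw [SwapInvariant, h.xy_jump hcl, h'.xy_jump hcl', jump_swap]
    refine ih.quiet_swap _ c (measure_jump hcl) (h.jump hcl) ⟨?_, ?_, ?_, ?_⟩ ?_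
    · rw [jump_w]; simp only [h0, hc.w, sub_zero]
    · rw [jump_v]; simp only [h0, hc.v, sub_zero]
    · rw [h.Q_jump hcl, h0, ite_self, sub_zero]; exact hc.below
    · rw [h.Q_jump hcl, h0, ite_self, sub_zero]; exact hc.level
    · rw [jump_J, Function.update_of_ne hca]; exact hm

lemma Below.commutes_of_valid {s : Pair n} (ih : D.Below (D.measure s)) (h : D.Valid s) :
    D.Commutes s := by
  have hi := h.ok.i
  have hj := h.ok.j
  rcases h.ok.it.eq_or_lt with ht | ht
  · rw [Commutes, xy_of_top ht (h.sync.trans ht), yx_of_top ht (h.sync.trans ht)]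
  have ht' : s.j < D.top := h.sync ▸ ht
  by_cases hX : ∃ c, D.XAvail s c
  · obtain ⟨c, hc⟩ := hX
    have hx := (XStep.hor _ c h.ok.w hi ht hc).xy_eq
    have ihx := ih.valid _ (D.measure_xh hi hc) (h.xh hc)
    rw [Commutes] at ihx ⊢
    by_cases hY : ∃ d, YAvail s d
    · obtain ⟨d, hd⟩ := hY
      have hy := (YStep.hor _ _ d h.ok.v hj ht' hd).yx_eq
      have ihy := ih.valid _ (D.measure_yh hj hd) (h.yh hd)
      rw [Commutes] at ihy
      by_cases hK : c = d → ∃ K, s.J c = (s.i, D.Q s c s.i) ::ₘ (s.j, 0) ::ₘ K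
      · have hd' := D.yAvail_xh hd hK
        have hc' := D.xAvail_yh hj hc hd hK
        have ihxy := ih.valid _ ((D.measure_yh (s := D.xh c s) hj hd').trans (D.measure_xh hi hc))
          ((h.xh hc).yh hd')
        rw [Commutes] at ihxy
        rw [hx, ihx, (YStep.hor _ (D.xh c s) d h.ok.v hj ht' hd').yx_eq, ← ihxy,
          ← D.xh_yh hj hd hK, ← (XStep.hor (D.yh d s) c h.ok.w hi ht hc').xy_eq, ihy, hy]
      -- Both particles need the same string. It is the only one of its length at `c`, and its
      -- vacancy number is 0.
      · push Not at hK
        obtain ⟨rfl, hK⟩ := hK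
        have hmem := hd.2
        obtain ⟨K, hK'⟩ := Multiset.exists_cons_of_mem hc.2
        have hnot : (s.i, (0 : ℤ)) ∉ K := by
          intro h0
          obtain ⟨K', rfl⟩ := Multiset.exists_cons_of_mem h0
          exact hK K' (by rw [hK', h.sync])
        have hQ : D.Q s c s.i = 0 := by
          rw [hK', h.sync, Multiset.mem_cons] at hmem
          rcases hmem with h0 | h0
          · exact (Prod.mk.inj h0).2.symm
          · exact absurd h0 hnot
        have hmK : mult K s.i ≤ 0 := by
          by_contra hmK
          obtain ⟨r, hr⟩ := exists_mem_of_mult_pos (show 1 ≤ mult K s.i by omega)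
          have := h.rig c _ (hK' ▸ Multiset.mem_cons_of_mem hr)
          simp only [hQ] at this
          obtain rfl : r = 0 := by omega
          exact hnot hr
        have hm : mult (s.J c) s.i ≤ 1 := by
          rw [hK', mult, Multiset.countP_cons_of_pos (p := fun x : ℕ × ℤ => x.1 = s.i) _ rfl]
          rw [mult] at hmK
          omega
        -- With both weights 1, one string and vacancy number 0 at the level, concavity forces the
        -- vacancy number below to be 0.
        have h1 := D.second_difference_at_level hi h.sync c
        rw [hc.1, hd.1, hQ] at h1
        have h2 := h.nonneg c (s.i - 1)
        have h3 := h.nonneg c (s.i + 1)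
        have h4 := D.nbr_nonneg s c s.i
        have hbelow : D.Q s c (s.i - 1) = 0 := by omega
        have hsw : D.Swappable c (D.xh c s) := by
          refine ⟨?_, hd.1, ?_, ?_⟩
          · rw [xh_w]; simp only [hc.1, D.diag]; rfl
          · rw [D.Q_xh hi hc]; exact hbelow
          · rw [D.Q_xh hi hc]; exact hQ
        -- Both removals put rigging 0 on the shortened string; only the weights remember which
        -- particle acted.
        have e : D.swap c (D.xh c s) = D.yh c s := by
          refine Pair.ext ?_ ?_ rfl rfl rfl
          · rw [swap_J, xh_J, yh_J, hQ, hbelow, h.sync]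
          · funext b; simp only [swap_w, xh_w, yh_w]; ring
        have ihs := ih.valid_swap _ c (D.measure_xh hi hc) (h.xh hc) hsw
        rw [SwapInvariant, e] at ihs
        rw [hx, ihs, ihy, hy]
    -- Only the first particle can act. Its removal does not unblock the second one, and after the
    -- second has moved up the first lags behind, so `yx_xh` applies.
    · have hY := not_exists.1 hY
      rw [hx, ihx, (YStep.up _ _ h.ok.v hj ht' hY).yx_eq,
        yx_xh (h.ok.yu ht') (by simp [h.sync]) (D.xAvail_yu.2 hc), D.xh_yu hc,
        (YStep.up _ (D.xh c s) h.ok.v hj ht' (not_yAvail_xh hi h.sync.ge hY)).yx_eq]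
  · have hX := not_exists.1 hX
    by_cases hY : ∃ d, YAvail s d
    · obtain ⟨d, hd⟩ := hY
      have ihy := ih.valid _ (D.measure_yh hj hd) (h.yh hd)
      rw [Commutes] at ihy ⊢
      rw [(YStep.hor _ _ d h.ok.v hj ht' hd).yx_eq, ← ihy,
        (XStep.up _ h.ok.w hi ht hX).xy_eq, xy_yh (h.ok.xu ht) (by simp [h.sync]) hd, ← D.xu_yh,
        (XStep.up (D.yh d s) h.ok.w hi ht (not_xAvail_yh hj h.sync.le hd hX)).xy_eq]
    · exact ih.commutes_of_quiet (h.quiet ht hX (not_exists.1 hY))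

/-- Without a string of the level's length at `c`, concavity removes such strings from its
neighbours too, so every available removal is at a node orthogonal to `c` and commutes with the
swap. With such a string, the swap only decides which particle shortens it. -/
lemma Below.swapInvariant_of_valid {s : Pair n} {c : Fin n} (ih : D.Below (D.measure s))
    (h : D.Valid s) (hc : D.Swappable c s) : D.SwapInvariant c s := by
  have hi := h.ok.i
  have hj := h.ok.j
  have h' := h.swap hc
  rcases h.ok.it.eq_or_lt with ht | ht
  · rw [SwapInvariant, xy_of_top ht (h.sync.trans ht),
      xy_of_top (s := D.swap c s) ht (h.sync.trans ht)]
    rfl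
  have ht' : s.j < D.top := h.sync ▸ ht
  -- A swap preserves the measure, so commutation is available for both states and allows steps of
  -- the second particle to be performed first.
  have hcom := ih.commutes_of_valid h
  have hcom' := Below.commutes_of_valid (s := D.swap c s) ih h'
  rw [Commutes] at hcom hcom'
  rw [SwapInvariant]
  have hm0 := mult_nonneg (s.J c) s.i
  rcases hm0.eq_or_lt with hm | hm
  · have h1 := D.second_difference_at_level hi h.sync c
    rw [hc.w, hc.v, hc.below, hc.level, ← hm] at h1
    have h2 := h.nonneg c (s.i + 1)
    have h3 := D.nbr_nonneg s c s.i
    have hn : D.nbr s c s.i ≤ 0 := by omega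
    by_cases hX : ∃ d, D.XAvail s d
    · obtain ⟨d, hd⟩ := hX
      have hcd : c ≠ d := by
        rintro rfl
        have h1 := hd.1
        have h2 := hc.w
        omega
      have h0 : D.A c d = 0 := D.orthogonal_of_nbr (s := s) (l := s.i) hn hcd hd.2
      have h0' : D.A d c = 0 := by rw [D.symm]; exact h0
      have hd' : D.XAvail (D.swap c s) d := by
        refine ⟨?_, ?_⟩
        · rw [swap_w]; simp only [h0', hd.1, add_zero]
        · rw [Q_swap D h.sync]; exact hd.2
      rw [(XStep.hor _ d h.ok.w hi ht hd).xy_eq, (XStep.hor (D.swap c s) d h'.ok.w hi ht hd').xy_eq,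
        xh_swap h.sync]
      refine ih.valid_swap _ c (D.measure_xh hi hd) (h.xh hd) ⟨?_, hc.v, ?_, ?_⟩
      · rw [xh_w]; simp only [h0, hc.w, sub_zero]
      · rw [D.Q_xh hi hd]; exact hc.below
      · rw [D.Q_xh hi hd]; exact hc.level
    · by_cases hY : ∃ d, YAvail s d
      · obtain ⟨d, hd⟩ := hY
        have hmem : (s.i, (0 : ℤ)) ∈ s.J d := h.sync ▸ hd.2
        have hcd : c ≠ d := by
          rintro rfl
          have : 1 ≤ mult (s.J c) s.i := mult_pos hmem
          omega
        have h0 : D.A c d = 0 := D.orthogonal_of_nbr (s := s) (l := s.i) hn hcd hmem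
        have h0' : D.A d c = 0 := by rw [D.symm]; exact h0
        have hd' : YAvail (D.swap c s) d := by
          refine ⟨?_, hd.2⟩
          rw [swap_v]; simp only [h0', hd.1, sub_zero]
        have ih1 := ih.valid _ (D.measure_yh hj hd) (h.yh hd)
        have ih2 := ih.valid _ (D.measure_yh (s := D.swap c s) hj hd') (h'.yh hd')
        rw [Commutes] at ih1 ih2
        rw [hcom, hcom', (YStep.hor _ _ d h.ok.v hj ht' hd).yx_eq,
          (YStep.hor _ (D.swap c s) d h'.ok.v hj ht' hd').yx_eq, ← ih1, ← ih2, yh_swap]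
        refine ih.valid_swap _ c (D.measure_yh hj hd) (h.yh hd) ⟨hc.w, ?_, ?_, ?_⟩
        · rw [yh_v]; simp only [h0, hc.v, sub_zero]
        · rw [D.Q_yh hj hd]; exact hc.below
        · rw [D.Q_yh hj hd]; exact hc.level
      · exact ih.swapInvariant_of_quiet (h.quiet ht (not_exists.1 hX) (not_exists.1 hY)) hc hm.symm
  · obtain ⟨r, hr⟩ := exists_mem_of_mult_pos (show 1 ≤ mult (s.J c) s.i by omega)
    have hr0 := h.rig c _ hr
    simp only [hc.level] at hr0
    obtain rfl : r = 0 := by omega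
    have hd : YAvail s c := ⟨hc.v, by rw [h.sync]; exact hr⟩
    have hd' : D.XAvail (D.swap c s) c := by
      refine ⟨?_, ?_⟩
      · rw [swap_w]; simp only [hc.w, D.diag]; rfl
      · rw [Q_swap D h.sync, swap_i, hc.level]; exact hr
    -- The zero vacancy numbers at the level and below make both removals replace rigging 0 by
    -- rigging 0, and the weights agree after the swap.
    have e : D.yh c s = D.xh c (D.swap c s) := by
      refine Pair.ext ?_ ?_ rfl rfl rfl
      · rw [xh_J, yh_J, Q_swap D h.sync, swap_i, hc.level, hc.below, h.sync]; rfl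
      · funext b; simp only [swap_w, xh_w, yh_w]; ring
    have ih1 := ih.valid _ (D.measure_yh hj hd) (h.yh hd)
    rw [Commutes] at ih1
    rw [hcom, (YStep.hor _ _ c h.ok.v hj ht' hd).yx_eq, ← ih1, e,
      (XStep.hor (D.swap c s) c h'.ok.w hi ht hd').xy_eq]

lemma below (D : PairData n) (m : ℕ) : D.Below m := by
  induction m with
  | zero => exact ⟨fun _ h => by omega, fun _ h => by omega, fun _ _ h => by omega,
      fun _ _ h => by omega⟩
  | succ m ih =>
    have key : ∀ s, D.measure s < m + 1 → D.Below (D.measure s) := by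
      intro s hs
      exact ⟨fun t h => ih.valid t (by omega), fun t h => ih.quiet t (by omega),
        fun t c h => ih.valid_swap t c (by omega), fun t c h => ih.quiet_swap t c (by omega)⟩
    exact ⟨fun s h => (key s h).commutes_of_valid, fun s h => (key s h).commutes_of_quiet,
      fun s c h => (key s h).swapInvariant_of_valid,
      fun s c h => (key s h).swapInvariant_of_quiet⟩

theorem Valid.commutes {s : Pair n} (h : D.Valid s) : (D.xy s).J = (D.yx s).J :=
  (below D (D.measure s + 1)).valid s (Nat.lt_succ_self _) h

end PairData
end RiggedConfiguration

/-! ### Reading off the selected strings from a run -/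

namespace RiggedConfiguration
namespace PairData

variable {n : ℕ} (D : PairData n)

open Relation

/-- The first particle has arrived at `s` from `s₀`, having removed boxes from strings of the
lengths `S`. -/
structure Track (s₀ s : Pair n) (S : Fin n → Multiset ℕ) : Prop where
  run : ReflTransGen D.XStep s₀ s
  w : s.w ∈ D.W
  v : s.v = s₀.v
  j : s.j = s₀.j
  i : 1 ≤ s.i
  top : s.i ≤ D.top
  Q : ∀ a l, s.i ≤ l → D.Q s a l = D.Q s₀ a l
  range : ∀ a, ∀ i ∈ S a, 1 ≤ i ∧ i ≤ s.i
  count : ∀ a i, (S a).count i ≤ (s₀.J a).count (i, D.Q s₀ a i)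
  J : ∀ a, s.J a = s₀.J a - (S a).map (fun i => (i, D.Q s₀ a i))
    + (S a).map (fun i => (i - 1, D.Q s a (i - 1)))

/-- There is a singular string of length `l` at `a` beyond the selected ones. -/
def Free (s₀ : Pair n) (S : Fin n → Multiset ℕ) (a : Fin n) (l : ℕ) : Prop :=
  (S a).count l < (s₀.J a).count (l, D.Q s₀ a l)

variable {D}

/-- Strings created so far are shorter than the current level, so a singular string of that length
is an original one that has not been selected. -/
lemma Track.xAvail_iff {s₀ s : Pair n} {S : Fin n → Multiset ℕ} (h : D.Track s₀ s S) (a : Fin n) :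
    D.XAvail s a ↔ s.w a = 1 ∧ D.Free s₀ S a s.i := by
  have h1 : (s.i, D.Q s a s.i) ∉ (S a).map (fun i => (i - 1, D.Q s a (i - 1))) := by
    intro hm
    obtain ⟨i, hi, he⟩ := Multiset.mem_map.1 hm
    have := h.range a i hi
    simp only [Prod.mk.injEq] at he
    omega
  have h2 : ((S a).map (fun i => (i, D.Q s₀ a i))).count (s.i, D.Q s₀ a s.i)
      = (S a).count s.i :=
    Multiset.count_map_eq_count' (fun i => (i, D.Q s₀ a i)) _
      (fun i j hij => (Prod.mk.inj hij).1) s.i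
  rw [XAvail, h.J a, Multiset.mem_add, or_iff_left h1, h.Q a _ le_rfl, ← Multiset.count_pos,
    Multiset.count_sub, h2, Free, tsub_pos_iff_lt]

lemma Track.up {s₀ s : Pair n} {S : Fin n → Multiset ℕ} (h : D.Track s₀ s S)
    (ht : s.i < D.top) (hs : ∀ a, s.w a = 1 → ¬ D.Free s₀ S a s.i) : D.Track s₀ (xu s) S := by
  refine ⟨h.run.tail (.up _ h.w h.i ht fun c hc => ?_), h.w, h.v, h.j, Nat.le_add_left _ _, ht,
    fun a l hl => ?_, fun a i hi => ?_, h.count, fun a => ?_⟩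
  · have := (h.xAvail_iff c).1 hc
    exact hs c this.1 this.2
  · rw [xu_i] at hl
    rw [Q_xu, if_neg (by omega), sub_zero]
    exact h.Q a l (by omega)
  · have := h.range a i hi
    rw [xu_i]; omega
  · rw [xu_J, h.J a]
    congr 1
    refine Multiset.map_congr rfl fun i hi => ?_
    have := h.range a i hi
    rw [Q_xu, if_neg (by omega), sub_zero]

lemma Track.advance {s₀ s : Pair n} {S : Fin n → Multiset ℕ} (h : D.Track s₀ s S) {l : ℕ}
    (hl : s.i ≤ l) (ht : l ≤ D.top)
    (hs : ∀ l', s.i ≤ l' → l' < l → ∀ a, s.w a = 1 → ¬ D.Free s₀ S a l') :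
    D.Track s₀ { s with i := l } S := by
  induction l, hl using Nat.le_induction with
  | base => exact h
  | succ l hl ih =>
    exact (ih (by omega) fun l' h1 h2 => hs l' h1 (by omega)).up ht (hs l hl (Nat.lt_succ_self l))

lemma Track.hor {s₀ s : Pair n} {S : Fin n → Multiset ℕ} (h : D.Track s₀ s S)
    (ht : s.i < D.top) {c : Fin n} (hw : s.w c = 1) (hc : D.Free s₀ S c s.i) :
    D.Track s₀ (D.xh c s) (fun a => S a + if a = c then {s.i} else 0) := by
  have hx := (h.xAvail_iff c).2 ⟨hw, hc⟩
  refine ⟨h.run.tail (.hor _ c h.w h.i ht hx), D.lower _ h.w _ hw, h.v, h.j, h.i, h.top,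
    ?_, fun a i hi => ?_, fun a i => ?_, fun a => ?_⟩
  · rw [D.Q_xh h.i hx]; exact h.Q
  · rcases Multiset.mem_add.1 hi with hi | hi
    · exact h.range a i hi
    · split_ifs at hi
      · rw [Multiset.mem_singleton.1 hi]
        exact ⟨h.i, le_rfl⟩
      · exact absurd hi (Multiset.notMem_zero _)
  · rw [Multiset.count_add]
    have := h.count a i
    split_ifs with hac
    · subst hac
      rw [Multiset.count_singleton]
      split_ifs with hi
      · subst hi; exact hc
      · exact this
    · simpa using this
  · rw [D.Q_xh h.i hx, xh_J]
    by_cases hac : a = c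
    · subst hac
      have h1 : (s.i, D.Q s a s.i) ∉ (S a).map (fun i => (i - 1, D.Q s a (i - 1))) := by
        intro hm
        obtain ⟨i, hi, he⟩ := Multiset.mem_map.1 hm
        have := h.range a i hi
        simp only [Prod.mk.injEq] at he
        omega
      have h2 := hx.2
      rw [h.J a, Multiset.mem_add, or_iff_left h1] at h2
      rw [Function.update_self, if_pos rfl, Multiset.map_add, Multiset.map_add,
        Multiset.map_singleton, Multiset.map_singleton, tsub_add_eq_tsub_tsub,
        Multiset.sub_singleton, h.J a, Multiset.erase_add_left_pos _ h2, h.Q a s.i le_rfl,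
        ← Multiset.singleton_add]
      abel
    · rw [Function.update_of_ne hac, if_neg hac, add_zero]
      exact h.J a

@[simp] lemma finiteLengths_top : finiteLengths ⊤ = 0 := rfl

@[simp] lemma finiteLengths_coe (l : ℕ) : finiteLengths (l : WithTop ℕ) = {l} := rfl

lemma eq_top_or_exists_nat (x : WithTop ℕ) : x = ⊤ ∨ ∃ l : ℕ, x = l := by
  induction x using WithTop.recTopCoe with
  | top => exact .inl rfl
  | coe l => exact .inr ⟨l, rfl⟩

lemma count_finiteLengths (x : WithTop ℕ) (l : ℕ) :
    (finiteLengths x).count l = if (l : WithTop ℕ) = x then 1 else 0 := by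
  obtain rfl | ⟨x, rfl⟩ := eq_top_or_exists_nat x
  · simp
  · simp [Multiset.count_singleton, Nat.cast_inj]

variable (D)

/-- The selection of strings has reached the length `lo` and the weight `w`, or has stopped if
`lo = ⊤`. -/
def Selected (s₀ : Pair n) (S : Fin n → Multiset ℕ) (lo : WithTop ℕ) (w : Fin n → ℤ) : Prop :=
  ∃ s, D.Track s₀ s S ∧ ((∃ l : ℕ, lo = l ∧ s.i = l ∧ s.w = w) ∨ (lo = ⊤ ∧ s.i = D.top))

/-- `f` is the smallest length, from `lo` on, of a free singular string at `c`. -/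
structure IsFirst (s₀ : Pair n) (S : Fin n → Multiset ℕ) (c : Fin n) (lo f : WithTop ℕ) :
    Prop where
  le : lo ≤ f
  free : ∀ l : ℕ, f = l → l < D.top ∧ D.Free s₀ S c l
  not_free : ∀ l : ℕ, lo ≤ l → (l : WithTop ℕ) < f → ¬ D.Free s₀ S c l

variable {D}

lemma Track.select {s₀ s : Pair n} {S : Fin n → Multiset ℕ} (h : D.Track s₀ s S) {c : Fin n}
    {f : WithTop ℕ} (hc : s.w c = 1) (hvis : ∀ a, s.w a = 1 → a = c)
    (hf : D.IsFirst s₀ S c s.i f) :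
    D.Selected s₀ (fun a => S a + if a = c then finiteLengths f else 0) f
      (fun b => s.w b - D.A b c) := by
  obtain rfl | ⟨l, rfl⟩ := eq_top_or_exists_nat f
  · refine ⟨{ s with i := D.top }, ?_, .inr ⟨rfl, rfl⟩⟩
    have := h.advance h.top le_rfl fun l' h1 h2 a ha => by
      rw [hvis a ha]
      exact hf.not_free l' (by exact_mod_cast h1) (WithTop.coe_lt_top _)
    simpa using this
  · obtain ⟨h1, h2⟩ := hf.free l rfl
    have hl : s.i ≤ l := by exact_mod_cast hf.le
    have := h.advance hl h1.le fun l' h1 h2 a ha => by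
      rw [hvis a ha]
      exact hf.not_free l' (by exact_mod_cast h1) (by exact_mod_cast h2)
    exact ⟨_, this.hor h1 hc h2, .inl ⟨l, rfl, rfl, rfl⟩⟩

lemma Selected.step {s₀ : Pair n} {S : Fin n → Multiset ℕ} {lo : WithTop ℕ} {w : Fin n → ℤ}
    (h : D.Selected s₀ S lo w) {c : Fin n} {f : WithTop ℕ} (hc : w c = 1)
    (hvis : ∀ a, w a = 1 → a = c) (hf : D.IsFirst s₀ S c lo f) :
    D.Selected s₀ (fun a => S a + if a = c then finiteLengths f else 0) f
      (fun b => w b - D.A b c) := by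
  obtain ⟨s, hs, ⟨l, rfl, rfl, rfl⟩ | ⟨rfl, ht⟩⟩ := h
  · exact hs.select hc hvis hf
  · have : f = ⊤ := top_le_iff.1 hf.le
    subst this
    exact ⟨s, by simpa using hs, .inr ⟨rfl, ht⟩⟩

/-- The active nodes `p`, `q` are orthogonal. The particle first meets the shorter length at `p`;
this leaves `q` active and its free strings untouched, and nothing at `q` was passed over because `f
≤ g`. -/
lemma Selected.fork_of_le {s₀ : Pair n} {S : Fin n → Multiset ℕ} {lo : WithTop ℕ} {w : Fin n → ℤ}
    (h : D.Selected s₀ S lo w) {p q : Fin n} {f g : WithTop ℕ} (hpq : p ≠ q)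
    (hp : w p = 1) (hq : w q = 1) (hvis : ∀ a, w a = 1 → a = p ∨ a = q)
    (hvis' : ∀ a, w a - D.A a p = 1 → a = q)
    (hf : D.IsFirst s₀ S p lo f) (hg : D.IsFirst s₀ S q lo g) (hfg : f ≤ g) :
    D.Selected s₀ (fun a => S a + (if a = p then finiteLengths f else 0)
      + if a = q then finiteLengths g else 0) g (fun b => w b - D.A b p - D.A b q) := by
  obtain ⟨s, hs, ⟨l, rfl, rfl, rfl⟩ | ⟨rfl, ht⟩⟩ := h
  · obtain rfl | ⟨l, rfl⟩ := eq_top_or_exists_nat f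
    · have : g = ⊤ := top_le_iff.1 hfg
      subst this
      refine ⟨{ s with i := D.top }, ?_, .inr ⟨rfl, rfl⟩⟩
      have := hs.advance hs.top le_rfl fun l' h1 h2 a ha => by
        rcases hvis a ha with rfl | rfl
        · exact hf.not_free l' (by exact_mod_cast h1) (WithTop.coe_lt_top _)
        · exact hg.not_free l' (by exact_mod_cast h1) (WithTop.coe_lt_top _)
      simpa using this
    · obtain ⟨h1, h2⟩ := hf.free l rfl
      have hl : s.i ≤ l := by exact_mod_cast hf.le
      have ha := hs.advance hl h1.le fun l' h3 h4 a ha => by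
        rcases hvis a ha with rfl | rfl
        · exact hf.not_free l' (by exact_mod_cast h3) (by exact_mod_cast h4)
        · exact hg.not_free l' (by exact_mod_cast h3)
            (lt_of_lt_of_le (by exact_mod_cast h4) hfg)
      have hb := ha.hor h1 hp h2
      have h0 : D.A q p = 0 := by
        have := D.orthogonal hs.w hq hp hpq.symm
        exact this
      have hfree : ∀ l', D.Free s₀ (fun a => S a + if a = p then {l} else 0) q l'
          ↔ D.Free s₀ S q l' := by
        intro l'
        simp [Free, hpq.symm]
      refine hb.select (by simp [h0, hq]) hvis' ⟨hfg, fun l' hl' => ?_, fun l' h3 h4 => ?_⟩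
      · rw [hfree]; exact hg.free l' hl'
      · rw [hfree]; exact hg.not_free l' (hf.le.trans h3) h4
  · have h1 : f = ⊤ := top_le_iff.1 hf.le
    have h2 : g = ⊤ := top_le_iff.1 hg.le
    subst h1 h2
    exact ⟨s, by simpa using hs, .inr ⟨rfl, ht⟩⟩

lemma Selected.fork {s₀ : Pair n} {S : Fin n → Multiset ℕ} {lo : WithTop ℕ} {w : Fin n → ℤ}
    (h : D.Selected s₀ S lo w) {p q : Fin n} {f g : WithTop ℕ} (hpq : p ≠ q)
    (hp : w p = 1) (hq : w q = 1) (hvis : ∀ a, w a = 1 → a = p ∨ a = q)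
    (hvisp : ∀ a, w a - D.A a p = 1 → a = q) (hvisq : ∀ a, w a - D.A a q = 1 → a = p)
    (hf : D.IsFirst s₀ S p lo f) (hg : D.IsFirst s₀ S q lo g) :
    D.Selected s₀ (fun a => S a + (if a = p then finiteLengths f else 0)
      + if a = q then finiteLengths g else 0) (max f g) (fun b => w b - D.A b p - D.A b q) := by
  rcases le_total f g with hfg | hfg
  · rw [max_eq_right hfg]
    exact h.fork_of_le hpq hp hq hvis hvisp hf hg hfg
  · rw [max_eq_left hfg]
    have := h.fork_of_le hpq.symm hq hp (fun a ha => (hvis a ha).symm) hvisq hg hf hfg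
    simpa only [add_right_comm, sub_right_comm] using this

lemma Selected.finish {s₀ : Pair n} {S : Fin n → Multiset ℕ} {lo : WithTop ℕ} {w : Fin n → ℤ}
    (h : D.Selected s₀ S lo w) (hw : ∀ a, w a ≠ 1) : ∃ s, D.Track s₀ s S ∧ s.i = D.top := by
  obtain ⟨s, hs, ⟨l, rfl, rfl, rfl⟩ | ⟨rfl, ht⟩⟩ := h
  · exact ⟨_, hs.advance hs.top le_rfl fun l' _ _ a ha => absurd ha (hw a), rfl⟩
  · exact ⟨s, hs, ht⟩

lemma Selected.start {s : Pair n} (hw : s.w ∈ D.W) (hi : s.i = 1) (ht : 1 ≤ D.top) :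
    D.Selected s (fun _ => 0) 1 s.w :=
  ⟨s, ⟨.refl, hw, rfl, rfl, hi.ge, hi ▸ ht, fun _ _ _ => rfl, by simp, by simp, by simp⟩,
    .inl ⟨1, rfl, hi, rfl⟩⟩

end PairData
end RiggedConfiguration

/-! ### Weights of the vector representation in types A and D -/

namespace RiggedConfiguration

variable {n : ℕ}

/-- The pairing of the `k`-th unit vector with the simple roots. -/
def eps (t : AffineType) (n k : ℕ) (a : Fin n) : ℤ :=
  match t with
  | .A => (if a.val = k then 1 else 0) - if a.val + 1 = k then 1 else 0
  | .D => if a.val + 1 < n then (if a.val = k then 1 else 0) - if a.val + 1 = k then 1 else 0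
      else (if k + 2 = n then 1 else 0) + if k + 1 = n then 1 else 0

/-- The weights of the vector representation. -/
def vectorWeights (t : AffineType) (n : ℕ) : Set (Fin n → ℤ) :=
  match t with
  | .A => {w | ∃ k, w = eps .A n k}
  | .D => {w | ∃ k < n, w = eps .D n k ∨ w = fun a => -eps .D n k a}

lemma cartan_diag (t : AffineType) (a : Fin n) : cartan t n a a = 2 := by
  cases t
  · simp [cartan, CartanMatrix.A]
  · simp [cartan, CartanMatrix.D]

lemma cartan_offdiag (t : AffineType) {a b : Fin n} (h : a ≠ b) :
    cartan t n a b = 0 ∨ cartan t n a b = -1 := by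
  cases t
  · simp only [cartan, CartanMatrix.A, Matrix.of_apply, if_neg h]
    split_ifs <;> simp
  · simp only [cartan, CartanMatrix.D, Matrix.of_apply, if_neg h]
    split_ifs <;> simp

lemma cartan_symm (t : AffineType) (a b : Fin n) : cartan t n a b = cartan t n b a := by
  cases t
  · exact (CartanMatrix.A_isSymm n).apply b a
  · exact (CartanMatrix.D_isSymm n).apply b a

lemma cartan_A_eq (a b : Fin n) : cartan .A n b a = eps .A n a b - eps .A n (a + 1) b := by
  simp only [cartan, CartanMatrix.A, Matrix.of_apply, eps, Fin.ext_iff]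
  split_ifs <;> omega

lemma cartan_D_eq (hn : 4 ≤ n) {a : Fin n} (ha : a.val + 1 < n) (b : Fin n) :
    cartan .D n b a = eps .D n a b - eps .D n (a + 1) b := by
  simp only [cartan, CartanMatrix.D, Matrix.of_apply, eps, Fin.ext_iff]
  have := b.isLt
  split_ifs <;> omega

lemma cartan_D_last (hn : 4 ≤ n) {a : Fin n} (ha : a.val + 1 = n) (b : Fin n) :
    cartan .D n b a = eps .D n (n - 2) b + eps .D n (n - 1) b := by
  simp only [cartan, CartanMatrix.D, Matrix.of_apply, eps, Fin.ext_iff]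
  have := b.isLt
  split_ifs <;> omega

lemma eps_minuscule {t : AffineType} (k : ℕ) (a : Fin n) :
    eps t n k a = -1 ∨ eps t n k a = 0 ∨ eps t n k a = 1 := by
  cases t <;> simp only [eps] <;> split_ifs <;> omega

lemma vectorWeights_minuscule (t : AffineType) (w : Fin n → ℤ) (hw : w ∈ vectorWeights t n)
    (a : Fin n) : w a = -1 ∨ w a = 0 ∨ w a = 1 := by
  cases t
  · obtain ⟨k, rfl⟩ := hw
    exact eps_minuscule k a
  · obtain ⟨k, -, rfl | rfl⟩ := hw
    · exact eps_minuscule k a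
    · have := eps_minuscule (t := .D) k a
      simp only
      omega

lemma neg_mem_vectorWeights_D {w : Fin n → ℤ} (hw : w ∈ vectorWeights .D n) :
    (fun a => -w a) ∈ vectorWeights .D n := by
  obtain ⟨k, hk, rfl | rfl⟩ := hw
  · exact ⟨k, hk, .inr rfl⟩
  · exact ⟨k, hk, .inl (by simp)⟩

lemma eps_A_eq_one {k : ℕ} {a : Fin n} (h : eps .A n k a = 1) : a.val = k := by
  simp only [eps] at h
  split_ifs at h <;> omega

lemma eps_A_eq_neg_one {k : ℕ} {a : Fin n} (h : eps .A n k a = -1) : a.val + 1 = k := by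
  simp only [eps] at h
  split_ifs at h <;> omega

lemma eps_D_eq_one {k : ℕ} {a : Fin n} (h : eps .D n k a = 1) :
    (a.val + 1 < n ∧ a.val = k) ∨ (a.val + 1 = n ∧ (k + 2 = n ∨ k + 1 = n)) := by
  have := a.isLt
  simp only [eps] at h
  split_ifs at h <;> omega

lemma eps_D_eq_neg_one {k : ℕ} {a : Fin n} (h : eps .D n k a = -1) :
    a.val + 1 < n ∧ a.val + 1 = k := by
  have := a.isLt
  simp only [eps] at h
  split_ifs at h <;> omega

/-- Lowering moves to the next letter. In type D the last node sends the letters `n - 2` and `n - 1`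
to the negatives of `n - 1` and `n - 2`, and the negative letters then run backwards. -/
lemma vectorWeights_lower (t : AffineType) (hn : t = .D → 4 ≤ n) (w : Fin n → ℤ)
    (hw : w ∈ vectorWeights t n) (a : Fin n) (ha : w a = 1) :
    (fun b => w b - cartan t n b a) ∈ vectorWeights t n := by
  cases t
  · obtain ⟨k, rfl⟩ := hw
    obtain rfl := eps_A_eq_one ha
    exact ⟨a + 1, funext fun b => by rw [cartan_A_eq]; ring⟩
  · have hn := hn rfl
    obtain ⟨k, hk, rfl | rfl⟩ := hw
    · rcases eps_D_eq_one ha with ⟨h, rfl⟩ | ⟨h, hk'⟩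
      · exact ⟨a + 1, h, .inl (funext fun b => by rw [cartan_D_eq hn h]; ring)⟩
      · rcases hk' with hk' | hk'
        · obtain rfl : k = n - 2 := by omega
          exact ⟨n - 1, by omega, .inr (funext fun b => by rw [cartan_D_last hn h]; ring)⟩
        · obtain rfl : k = n - 1 := by omega
          exact ⟨n - 2, by omega, .inr (funext fun b => by rw [cartan_D_last hn h]; ring)⟩
    · obtain ⟨h, rfl⟩ := eps_D_eq_neg_one (neg_eq_iff_eq_neg.1 ha)
      exact ⟨a, a.isLt, .inr (funext fun b => by rw [cartan_D_eq hn h]; ring)⟩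

lemma vectorWeights_raise (t : AffineType) (hn : t = .D → 4 ≤ n) (w : Fin n → ℤ)
    (hw : w ∈ vectorWeights t n) (a : Fin n) (ha : w a = -1) :
    (fun b => w b + cartan t n b a) ∈ vectorWeights t n := by
  cases t
  · obtain ⟨k, rfl⟩ := hw
    obtain rfl := eps_A_eq_neg_one ha
    exact ⟨a, funext fun b => by rw [cartan_A_eq]; ring⟩
  -- The type D weights are closed under negation, which turns raising into lowering.
  · have := neg_mem_vectorWeights_D (vectorWeights_lower .D hn _ (neg_mem_vectorWeights_D hw) a
      (neg_eq_iff_eq_neg.2 ha))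
    convert this using 2
    ring

/-- The contribution of a multiplicity array to the vacancy numbers. -/
def resource (L : MultArray n) (a : Fin n) (l : ℕ) : ℤ :=
  (L.map fun x => if x.1 = a then ((min l x.2 : ℕ) : ℤ) else 0).sum

@[simp] lemma resource_cons (x : Fin n × ℕ) (L : MultArray n) (a : Fin n) (l : ℕ) :
    resource (x ::ₘ L) a l = (if x.1 = a then ((min l x.2 : ℕ) : ℤ) else 0) + resource L a l := by
  simp [resource]

lemma resource_concave (L : MultArray n) (a : Fin n) (l : ℕ) :
    resource L a l + resource L a (l + 2) ≤ 2 * resource L a (l + 1) := by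
  induction L using Multiset.induction_on with
  | empty => simp [resource]
  | cons x L ih =>
    simp only [resource_cons]
    split_ifs
    · have : ((min l x.2 : ℕ) : ℤ) + ((min (l + 2) x.2 : ℕ) : ℤ)
        ≤ 2 * ((min (l + 1) x.2 : ℕ) : ℤ) := by omega
      linarith
    · linarith

lemma resource_zero (L : MultArray n) (a : Fin n) : resource L a 0 = 0 := by
  simp [resource]

/-- The pair data belonging to the vector representation. -/
def vectorData (t : AffineType) (hn : t = .D → 4 ≤ n) (L : MultArray n) (M : ℕ) : PairData n where
  A := cartan t n
  W := vectorWeights t n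
  base := resource L
  top := M
  diag := cartan_diag t
  offdiag := fun _ _ => cartan_offdiag t
  symm := cartan_symm t
  minuscule := vectorWeights_minuscule t
  lower := vectorWeights_lower t hn
  raise := vectorWeights_raise t hn
  concave := resource_concave L

lemma vacancy_shape (t : AffineType) (L : MultArray n) (J : Strings n) (a : Fin n) (l : ℕ) :
    vacancy t L (shape J) a l = resource L a l - ∑ b, cartan t n a b * boxes (J b) l := by
  simp only [vacancy, resource, boxes, shape, Multiset.map_map, Function.comp_def]

lemma eps_zero_mem (t : AffineType) [NeZero n] : eps t n 0 ∈ vectorWeights t n := by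
  cases t
  · exact ⟨0, rfl⟩
  · exact ⟨0, Nat.pos_of_ne_zero (NeZero.ne n), .inl rfl⟩

lemma eps_zero (t : AffineType) [NeZero n] (hn : t = .D → 4 ≤ n) (a : Fin n) :
    eps t n 0 a = if 0 = a then 1 else 0 := by
  have h1 := a.isLt
  have h0 : (0 = a) = (a.val = 0) := by
    rw [eq_comm (a := (0 : Fin n)), Fin.ext_iff, Fin.val_zero]
  simp only [h0]
  cases t
  · simp only [eps]
    split_ifs <;> first | contradiction | omega
  · have := hn rfl
    simp only [eps]
    split_ifs <;> first | contradiction | omega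

end RiggedConfiguration

/-! ### The selection algorithm as a particle run -/

namespace RiggedConfiguration

variable {n : ℕ}

lemma le_firstSingular (t : AffineType) (L : MultArray n) (J : Strings n) (a : ℕ)
    (lo : WithTop ℕ) (k : ℕ → ℕ) : lo ≤ firstSingular t L J a lo k := by
  rw [firstSingular]
  split_ifs
  · exact Finset.le_min fun i hi => (Finset.mem_filter.1 hi).2.1
  · exact le_top

lemma one_le_chain (t : AffineType) (L : MultArray n) (J : Strings n) (k : ℕ) :
    1 ≤ chain t L J k := by
  induction k with
  | zero => exact le_rfl
  | succ k ih => exact ih.trans (le_firstSingular _ _ _ _ _ _)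

lemma one_le_ell (t : AffineType) (L : MultArray n) (J : Strings n) (a : ℕ) :
    1 ≤ ell t L J a := by
  cases t
  · exact one_le_chain _ _ _ _
  · rw [ell]
    split_ifs
    · exact (one_le_chain _ _ _ _).trans (le_firstSingular _ _ _ _ _ _)
    · exact one_le_chain _ _ _ _

lemma one_le_ellBarAux (L : MultArray n) (J : Strings n) (k : ℕ) : 1 ≤ ellBarAux L J k := by
  induction k with
  | zero => exact (one_le_ell _ _ _ _).trans (le_max_left _ _)
  | succ k ih => exact ih.trans (le_firstSingular _ _ _ _ _ _)

lemma boxes_filter (K : Multiset (ℕ × ℤ)) (l : ℕ) :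
    boxes (K.filter fun x => 0 < x.1) l = boxes K l := by
  induction K using Multiset.induction_on with
  | empty => rfl
  | cons x K ih =>
    by_cases hx : 0 < x.1
    · rw [Multiset.filter_cons_of_pos (p := fun x : ℕ × ℤ => 0 < x.1) _ hx, boxes_cons, boxes_cons,
        ih]
    · rw [Multiset.filter_cons_of_neg (p := fun x : ℕ × ℤ => 0 < x.1) _ hx, boxes_cons, ih]
      have : x.1 = 0 := by omega
      simp [this]

namespace PairData

/-- Up to strings of length zero and above the top level, `s` is the sequence of strings `J` with
the vacancy numbers given by `L`. -/
structure Represents (D : PairData n) (t : AffineType) (L : MultArray n) (J : Strings n)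
    (s : Pair n) : Prop where
  filter : ∀ a, (s.J a).filter (fun x => 0 < x.1) = J a
  len : ∀ a, ∀ x ∈ s.J a, x.1 < D.top
  Q : ∀ a l, 1 ≤ l → l < D.top → D.Q s a l = vacancy t L (shape J) a l

variable {D : PairData n} {t : AffineType} {L : MultArray n} {J : Strings n} {s : Pair n}

lemma Represents.count (h : D.Represents t L J s) (a : Fin n) {l : ℕ} (hl : 1 ≤ l) (r : ℤ) :
    (J a).count (l, r) = (s.J a).count (l, r) := by
  rw [← h.filter a]
  exact Multiset.count_filter_of_pos (p := fun x : ℕ × ℤ => 0 < x.1) hl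

lemma Represents.mem (h : D.Represents t L J s) {a : Fin n} {x : ℕ × ℤ} :
    x ∈ J a ↔ x ∈ s.J a ∧ 0 < x.1 := by
  rw [← h.filter a, Multiset.mem_filter]

lemma shape_theta (t : AffineType) (L : MultArray n) (J : Strings n) :
    shape (theta t L J) = shape J := by
  funext a
  simp [shape, theta]

lemma Represents.mirror (h : D.Represents t L J s) :
    D.Represents t L (theta t L J) (D.mirror s) := by
  refine ⟨fun a => ?_, fun a x hx => ?_, ?_⟩
  · rw [mirror_J, Multiset.filter_map]
    simp only [Function.comp_def]
    rw [h.filter a, theta]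
    refine Multiset.map_congr rfl fun x hx => ?_
    have := h.mem.1 hx
    rw [h.Q a x.1 this.2 (h.len a x this.1)]
  · rw [mirror_J] at hx
    obtain ⟨y, hy, rfl⟩ := Multiset.mem_map.1 hx
    exact h.len a y hy
  · rw [Q_mirror, shape_theta]
    exact h.Q

/-- The threshold `k` is one more than the number of strings already selected, so the demand for two
singular strings on the return pass is exactly `Free`. -/
lemma Represents.isFirst (h : D.Represents t L J s) (S : Fin n → Multiset ℕ) (c : Fin n)
    {lo : WithTop ℕ} (hlo : 1 ≤ lo) {k : ℕ → ℕ}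
    (hk : ∀ l : ℕ, lo ≤ l → k l = (S c).count l + 1) :
    D.IsFirst s S c lo (firstSingular t L J c lo k) := by
  have key : ∀ l : ℕ, lo ≤ l →
      (k l ≤ (J c).count (l, vacancy t L (shape J) c l) ∧ l < D.top ↔
        l < D.top ∧ D.Free s S c l) := by
    intro l hl
    have h1 : 1 ≤ l := by exact_mod_cast hlo.trans hl
    rw [and_comm, and_congr_right_iff]
    intro ht
    rw [hk l hl, h.count c h1, Free, h.Q c l h1 ht, Nat.succ_le_iff]
  have hlen : ∀ l, l ∈ (J c).map Prod.fst → l < D.top := by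
    intro l hl
    obtain ⟨x, hx, rfl⟩ := Multiset.mem_map.1 hl
    exact h.len c x (h.mem.1 hx).1
  refine ⟨le_firstSingular _ _ _ _ _ _, fun l hl => ?_, fun l hl hlt hfree => ?_⟩
  · rw [firstSingular, dif_pos c.isLt] at hl
    obtain ⟨h1, h2, h3⟩ := Finset.mem_filter.1 (Finset.mem_of_min hl)
    exact (key l h2).1 ⟨h3, hlen l (Multiset.mem_toFinset.1 h1)⟩
  · have h1 : 1 ≤ l := by exact_mod_cast hlo.trans hl
    have hmem : (l, D.Q s c l) ∈ s.J c := Multiset.count_pos.1 (Nat.zero_lt_of_lt hfree)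
    have ht : l < D.top := h.len c _ hmem
    rw [firstSingular, dif_pos c.isLt] at hlt
    refine absurd hlt (not_lt.2 (Finset.min_le (Finset.mem_filter.2
      ⟨Multiset.mem_toFinset.2 (Multiset.mem_map.2 ⟨_, h.mem.2 ⟨hmem, h1⟩, rfl⟩), hl, ?_⟩)))
    exact ((key l hl).2 ⟨ht, hfree⟩).1

end PairData

open PairData

variable {t : AffineType} {hn : t = .D → 4 ≤ n} {L L' : MultArray n} {M : ℕ} {J : Strings n}
  {s : Pair n}

/-- The nodes `k < K` at which exactly the `k`-th letter can be lowered, to the next letter. -/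
def Linear (t : AffineType) (n K : ℕ) : Prop :=
  ∀ a : Fin n, a.val < K → eps t n a a = 1 ∧ (∀ b, eps t n a b = 1 → b = a) ∧
    ∀ b, eps t n a b - cartan t n b a = eps t n (a + 1) b

lemma linear_A (n : ℕ) : Linear .A n n := by
  intro a _
  refine ⟨by simp [eps], fun b hb => Fin.ext (eps_A_eq_one hb), fun b => ?_⟩
  rw [cartan_A_eq]; ring

lemma linear_D (hn : 4 ≤ n) : Linear .D n (n - 2) := by
  intro a ha
  have ha' : a.val + 1 < n := by omega
  refine ⟨by simp [eps, ha'], fun b hb => Fin.ext ?_, fun b => ?_⟩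
  · rcases eps_D_eq_one hb with h | h <;> omega
  · rw [cartan_D_eq hn ha']; ring

/-- Each letter before `K` has a single active node and is lowered to the next letter, so the
particle visits the nodes in the order of `chain`. -/
lemma selected_chain [NeZero n] (h : (vectorData t hn L' M).Represents t L J s) (hi : s.i = 1)
    (hw : s.w = eps t n 0) (hM : 1 ≤ M) {K : ℕ} (hK : Linear t n K) (hKn : K ≤ n) (k : ℕ)
    (hk : k ≤ K) :
    (vectorData t hn L' M).Selected s
      (fun a => if a.val < k then finiteLengths (chain t L J (a + 1)) else 0)
      (chain t L J k) (eps t n k) := by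
  induction k with
  | zero =>
    rw [← hw]
    exact Selected.start (hw ▸ eps_zero_mem t) hi hM
  | succ k ih =>
    let c : Fin n := ⟨k, by omega⟩
    obtain ⟨h1, h2, h3⟩ := hK c hk
    have hf := h.isFirst (fun a => if a.val < k then finiteLengths (chain t L J (a + 1)) else 0) c
      (one_le_chain t L J k) (k := fun _ => 1) (fun l _ => by simp [c])
    have := (ih (by omega)).step h1 h2 hf
    convert this using 1
    · funext a
      by_cases ha : a = c
      · subst ha
        simp [c, chain]
      · have : a.val ≠ k := fun h => ha (Fin.ext h)
        simp only [if_neg ha, add_zero]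
        split_ifs <;> first | rfl | omega
    · rfl
    · exact funext fun b => (h3 b).symm

lemma exists_track_A [NeZero n] {hn : AffineType.A = .D → 4 ≤ n}
    (h : (vectorData .A hn L' M).Represents .A L J s) (hi : s.i = 1)
    (hw : s.w = eps .A n 0) (hM : 1 ≤ M) :
    ∃ m, (vectorData .A hn L' M).Track s m (selected .A L J) ∧ m.i = M := by
  have := (selected_chain h hi hw hM (linear_A n) le_rfl n le_rfl).finish fun a ha => by
    have := eps_A_eq_one ha
    have := a.isLt
    omega
  have e : selected .A L J = fun a : Fin n =>
      if a.val < n then finiteLengths (chain .A L J (a + 1)) else 0 := by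
    funext a
    simp [selected, ellBar, ell, a.isLt]
  rw [e]
  exact this

/-- At letter `n - 2` both spin nodes are active. They can be used in either order, each leaving
only the other one active, and the return starts at the larger of the two lengths. -/
lemma selected_fork [NeZero n] {hn : AffineType.D = .D → 4 ≤ n}
    (h : (vectorData .D hn L' M).Represents .D L J s) (hi : s.i = 1)
    (hw : s.w = eps .D n 0) (hM : 1 ≤ M) :
    (vectorData .D hn L' M).Selected s
      (fun a => finiteLengths (ell .D L J (a + 1))) (ellBarAux L J 0)
      (fun b => -eps .D n (n - 2) b) := by
  have hn4 := hn rfl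
  let p : Fin n := ⟨n - 2, by omega⟩
  let q : Fin n := ⟨n - 1, by omega⟩
  have hpq : p ≠ q := by simp only [p, q, ne_eq, Fin.mk.injEq]; omega
  have hp1 : p.val + 1 < n := by simp only [p]; omega
  have hp2 : p.val + 1 = n - 1 := by simp only [p]; omega
  have hq1 : q.val + 1 = n := by simp only [q]; omega
  have hq2 : ¬ q.val + 1 < n := by omega
  set S : Fin n → Multiset ℕ :=
    fun a => if a.val < n - 2 then finiteLengths (chain .D L J (a + 1)) else 0 with hS
  have h0 := selected_chain h hi hw hM (linear_D hn4) (by omega) (n - 2) le_rfl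
  have hfp := h.isFirst S p (one_le_chain .D L J (n - 2)) (k := fun _ => 1)
    (fun l _ => by simp [S, p])
  have hfq := h.isFirst S q (one_le_chain .D L J (n - 2)) (k := fun _ => 1)
    (fun l _ => by
      have : ¬ q.val < n - 2 := by omega
      simp [S, this])
  have ep : firstSingular .D L J p (chain .D L J (n - 2)) (fun _ => 1) = ell .D L J (n - 1) := by
    rw [ell, if_neg (by omega), show n - 1 = n - 2 + 1 by omega]
    rfl
  have eq : firstSingular .D L J q (chain .D L J (n - 2)) (fun _ => 1) = ell .D L J n := by
    rw [ell, if_pos rfl]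
  rw [ep] at hfp
  rw [eq] at hfq
  have e1 : ∀ b, eps .D n (n - 2) b - cartan .D n b p = eps .D n (n - 1) b := by
    intro b
    rw [cartan_D_eq hn4 hp1, hp2]
    simp only [p]; ring
  have e2 : ∀ b, eps .D n (n - 2) b - cartan .D n b q = -eps .D n (n - 1) b := by
    intro b
    rw [cartan_D_last hn4 hq1]; ring
  have hwp : eps .D n (n - 2) p = 1 := by simp [eps, hp1]; simp [p]
  have hwq : eps .D n (n - 2) q = 1 := by
    simp only [eps, if_neg hq2]
    rw [if_pos (by omega), if_neg (by omega)]; rfl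
  have := h0.fork hpq hwp hwq (fun a ha => ?_) (fun a ha => ?_) (fun a ha => ?_) hfp hfq
  · convert this using 1
    · funext a
      by_cases hap : a = p
      · subst hap
        rw [if_pos rfl, if_neg hpq, hp2]
        simp [p]
      · by_cases haq : a = q
        · subst haq
          rw [if_neg hpq.symm, if_pos rfl, hq1]
          have : ¬ q.val < n - 2 := by omega
          simp [this]
        · have h1 : a.val ≠ n - 2 := fun h => hap (Fin.ext h)
          have h2 : a.val ≠ n - 1 := fun h => haq (Fin.ext h)
          have h3 := a.isLt
          rw [if_neg hap, if_neg haq, ell, if_neg (by omega)]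
          rw [if_pos (by omega), add_zero, add_zero]
    · rfl
    · funext b
      change _ = eps .D n (n - 2) b - cartan .D n b p - cartan .D n b q
      rw [e1, cartan_D_last hn4 hq1]
      ring
  · rcases eps_D_eq_one ha with ⟨-, h⟩ | ⟨h, -⟩
    · exact .inl (Fin.ext h)
    · exact .inr (Fin.ext (by simp only [q]; omega))
  · have ha := (e1 a).symm.trans ha
    rcases eps_D_eq_one ha with ⟨-, h⟩ | ⟨h, -⟩
    · exact Fin.ext h
    · exact Fin.ext (by simp only [q]; omega)
  · have ha := (e2 a).symm.trans ha
    have := eps_D_eq_neg_one (neg_eq_iff_eq_neg.1 ha)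
    exact Fin.ext (by simp only [p]; omega)

/-- A negative letter can be lowered only at the preceding node, so the nodes are visited again in
decreasing order. -/
lemma selected_return [NeZero n] {hn : AffineType.D = .D → 4 ≤ n}
    (h : (vectorData .D hn L' M).Represents .D L J s) (hi : s.i = 1)
    (hw : s.w = eps .D n 0) (hM : 1 ≤ M) (k : ℕ) (hk : k ≤ n - 2) :
    (vectorData .D hn L' M).Selected s
      (fun a => finiteLengths (ell .D L J (a + 1)) + if n - 2 - k ≤ a ∧ a + 2 < n then
        finiteLengths (ellBarAux L J (n - 2 - a)) else 0) (ellBarAux L J k)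
      (fun b => -eps .D n (n - 2 - k) b) := by
  have hn4 := hn rfl
  induction k with
  | zero =>
    convert selected_fork h hi hw hM using 1
    · funext a
      rw [if_neg (by omega), add_zero]
    · rfl
  | succ k ih =>
    let c : Fin n := ⟨n - 3 - k, by omega⟩
    have hc1 : c.val + 1 = n - 2 - k := by simp only [c]; omega
    have hc2 : c.val = n - 2 - (k + 1) := by simp only [c]; omega
    have hc3 : c.val + 1 < n := by omega
    set S : Fin n → Multiset ℕ := fun a => finiteLengths (ell .D L J (a + 1)) +
      if n - 2 - k ≤ a ∧ a + 2 < n then finiteLengths (ellBarAux L J (n - 2 - a)) else 0 with hS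
    have hf := h.isFirst S c (one_le_ellBarAux L J k)
      (k := fun i => if (i : WithTop ℕ) = ell .D L J (n - 2 - k) then 2 else 1) (fun l _ => by
        have : S c = finiteLengths (ell .D L J (c.val + 1)) := by
          simp only [S]
          rw [if_neg (by omega), add_zero]
        rw [this, count_finiteLengths, hc1]
        split_ifs <;> rfl)
    have := (ih (by omega)).step (c := c) ?_ (fun a ha => ?_) hf
    · convert this using 1
      · funext a
        simp only [S]
        by_cases hac : a = c
        · subst hac
          rw [if_pos (by omega), if_neg (by omega), if_pos rfl, add_zero,
            show n - 2 - c.val = k + 1 by omega]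
          rfl
        · have h1 : a.val ≠ n - 2 - (k + 1) := fun h => hac (Fin.ext (h.trans hc2.symm))
          rw [if_neg hac, add_zero]
          congr 1
          split_ifs <;> first | rfl | omega
      · rfl
      · funext b
        change _ = -eps .D n (n - 2 - k) b - cartan .D n b c
        rw [cartan_D_eq hn4 hc3, hc1, ← hc2]
        ring
    · rw [← hc1]
      simp [eps, hc3]
    · have := eps_D_eq_neg_one (neg_eq_iff_eq_neg.1 ha)
      exact Fin.ext (by omega)

lemma exists_track_D [NeZero n] {hn : AffineType.D = .D → 4 ≤ n}
    (h : (vectorData .D hn L' M).Represents .D L J s) (hi : s.i = 1)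
    (hw : s.w = eps .D n 0) (hM : 1 ≤ M) :
    ∃ m, (vectorData .D hn L' M).Track s m (selected .D L J) ∧ m.i = M := by
  have hn4 := hn rfl
  have := (selected_return h hi hw hM (n - 2) le_rfl).finish fun a ha => by
    have := eps_D_eq_neg_one (neg_eq_iff_eq_neg.1 ha)
    omega
  have e : selected .D L J = fun a : Fin n => finiteLengths (ell .D L J (a + 1)) +
      if n - 2 - (n - 2) ≤ a ∧ a + 2 < n then finiteLengths (ellBarAux L J (n - 2 - a)) else 0 := ?_
  · rw [e]
    exact this
  funext a
  rw [selected, ellBar]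
  congr 1
  by_cases ha : a.val + 2 < n
  · rw [if_pos (by omega), if_pos (by omega), show n - 1 - (a.val + 1) = n - 2 - a.val by omega]
  · rw [if_neg (by omega), if_neg (by omega)]
    rfl

lemma exists_track [NeZero n] (h : (vectorData t hn L' M).Represents t L J s) (hi : s.i = 1)
    (hw : s.w = eps t n 0) (hM : 1 ≤ M) :
    ∃ m, (vectorData t hn L' M).Track s m (selected t L J) ∧ m.i = M := by
  cases t
  · exact exists_track_A h hi hw hM
  · exact exists_track_D h hi hw hM

end RiggedConfiguration

/-! ### The map `deltaBar` as a complete run, and its commutation with `deltaTilde` -/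

namespace RiggedConfiguration

variable {n : ℕ}

open PairData

lemma resource_hat [NeZero n] {L : MultArray n} (h : ((0, 1) : Fin n × ℕ) ∈ L) (a : Fin n) {l : ℕ}
    (hl : 1 ≤ l) : resource L a l = (if 0 = a then 1 else 0) + resource L.hat a l := by
  conv_lhs => rw [← Multiset.cons_erase h]
  rw [resource_cons, min_eq_right hl]
  rfl

/-- The strings that remain after removing a box from each selected string. -/
lemma shape_add_filter (X : Multiset (ℕ × ℤ)) (T : Multiset ℕ) (f g : ℕ → ℤ) :
    (X + (T.map fun i => (i - 1, g (i - 1))).filter fun x : ℕ × ℤ => 0 < x.1).map Prod.fst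
      = (T.map (fun i => (i, f i)) + X).map Prod.fst - T
        + (T.map fun i => i - 1).filter fun i => 0 < i := by
  rw [Multiset.map_add, Multiset.map_add, Multiset.map_map, Multiset.filter_map, Multiset.filter_map,
    Multiset.map_map]
  simp

namespace PairData

variable {t : AffineType} {hn : t = .D → 4 ≤ n} {L L' : MultArray n} {M : ℕ} {J : Strings n}
  {s : Pair n}

/-- At level 1 the particle contributes exactly one factor `B^{1,1}`; at level `M` it no longer
contributes at the lengths in use, which turns `L` into `L.hat`. Strings of length zero are kept by
the run and discarded by the filter. -/
lemma Represents.run [NeZero n] (h : (vectorData t hn L' M).Represents t L J s) (hi : s.i = 1)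
    (hw : s.w = eps t n 0) (hM : 1 ≤ M) (hL : ((0, 1) : Fin n × ℕ) ∈ L) :
    (vectorData t hn L' M).Represents t L.hat (deltaBar t L J) ((vectorData t hn L' M).RX s) ∧
      ((vectorData t hn L' M).RX s).v = s.v ∧ ((vectorData t hn L' M).RX s).j = s.j ∧
      ((vectorData t hn L' M).RX s).i = M := by
  obtain ⟨m, hm, hmi⟩ := exists_track h hi hw hM
  set D := vectorData t hn L' M with hD
  rw [XRun.RX_eq ⟨hm.run, hmi⟩]
  refine ⟨?_, hm.v, hm.j, hmi⟩
  have hmem : ∀ a, ∀ i ∈ selected t L J a, (i, D.Q s a i) ∈ s.J a := fun a i hi' =>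
    Multiset.count_pos.1 ((Multiset.count_pos.2 hi').trans_le (hm.count a i))
  have hTop : ∀ a, ∀ i ∈ selected t L J a, i < M := fun a i hi' => h.len a _ (hmem a i hi')
  have hle : ∀ a, (selected t L J a).map (fun i => (i, D.Q s a i)) ≤ J a := by
    intro a
    rw [← h.filter a, Multiset.le_filter]
    refine ⟨Multiset.le_iff_count.2 fun x => ?_, fun x hx => ?_⟩
    · by_cases hx : x.2 = D.Q s a x.1
      · have := Multiset.count_map_eq_count' (fun i => (i, D.Q s a i)) (selected t L J a)
          (fun i j hij => (Prod.mk.inj hij).1) x.1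
        rw [← hx] at this
        rw [this, show x = (x.1, D.Q s a x.1) from Prod.ext rfl hx]
        exact hm.count a x.1
      · rw [Multiset.count_eq_zero_of_notMem]
        · exact Nat.zero_le _
        · intro hx'
          obtain ⟨i, -, rfl⟩ := Multiset.mem_map.1 hx'
          exact hx rfl
    · obtain ⟨i, hi', rfl⟩ := Multiset.mem_map.1 hx
      exact (hm.range a i hi').1
  have hfilter : ∀ a, (m.J a).filter (fun x => 0 < x.1)
      = J a - (selected t L J a).map (fun i => (i, D.Q s a i))
        + ((selected t L J a).map (fun i => (i - 1, D.Q m a (i - 1)))).filter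
          fun x => 0 < x.1 := by
    intro a
    rw [hm.J a, Multiset.filter_add, Multiset.filter_sub, h.filter a]
    congr 2
    refine Multiset.filter_eq_self.2 fun x hx => ?_
    obtain ⟨i, hi', rfl⟩ := Multiset.mem_map.1 hx
    exact (hm.range a i hi').1
  have hshape : shape (fun a => (m.J a).filter fun x => 0 < x.1) = newShape t L J := by
    funext a
    obtain ⟨X, hX⟩ := Multiset.le_iff_exists_add.1 (hle a)
    rw [shape, hfilter a, newShape, shortened, shape, hX, add_tsub_cancel_left]
    exact shape_add_filter X _ _ _
  have hQ : ∀ a l, 1 ≤ l → l < M → D.Q m a l = vacancy t L.hat (newShape t L J) a l := by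
    intro a l hl hlM
    have h1 := h.Q a l hl hlM
    rw [vacancy_shape, resource_hat hL a hl, ← eps_zero t hn a] at h1
    rw [← hshape, vacancy_shape]
    have h2 : D.Q s a l = resource L' a l - ∑ b, cartan t n a b * boxes (s.J b) l
      + (if s.i ≤ l then s.w a else 0) + (if s.j ≤ l then s.v a else 0) := rfl
    have h3 : D.Q m a l = resource L' a l - ∑ b, cartan t n a b * boxes (m.J b) l
      + (if m.i ≤ l then m.w a else 0) + (if m.j ≤ l then m.v a else 0) := rfl
    have h4 : ∀ b, boxes (J b) l = boxes (s.J b) l := fun b => by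
      rw [← h.filter b, boxes_filter]
    simp only [boxes_filter, h4] at h1 ⊢
    rw [h2, hi, if_pos hl, hw] at h1
    rw [h3, hmi, if_neg (by omega), hm.v, hm.j]
    linarith
  have hJ : ∀ a, (m.J a).filter (fun x => 0 < x.1) = deltaBar t L J a := by
    intro a
    rw [hfilter a, deltaBar, shortened, Multiset.filter_map, Multiset.filter_map, Multiset.map_map]
    refine congrArg₂ (· + ·) (congrArg (J a - ·) ?_) ?_
    · refine Multiset.map_congr rfl fun i hi' => ?_
      rw [h.Q a i (hm.range a i hi').1 (hTop a i hi')]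
    · refine Multiset.map_congr rfl fun i hi' => ?_
      obtain ⟨h1, h2⟩ := Multiset.mem_filter.1 hi'
      have := hTop a i h1
      simp only [Function.comp_apply] at h2 ⊢
      rw [hQ a (i - 1) h2 (by omega)]
  refine ⟨hJ, fun a x hx => ?_, ?_⟩
  · rw [hm.J a] at hx
    rcases Multiset.mem_add.1 hx with hx | hx
    · exact h.len a x (Multiset.mem_of_le tsub_le_self hx)
    · obtain ⟨i, hi', rfl⟩ := Multiset.mem_map.1 hx
      have := hTop a i hi'
      change i - 1 < M
      omega
  · rw [show deltaBar t L J = fun a => (m.J a).filter fun x => 0 < x.1 from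
      funext fun a => (hJ a).symm, hshape]
    exact hQ

end PairData

/-- All strings have positive length. -/
def Positive (J : Strings n) : Prop := ∀ a, ∀ x ∈ J a, 1 ≤ x.1

lemma RC.positive {t : AffineType} {L : MultArray n} {lam : Fin n → ℤ} {J : Strings n}
    (hJ : J ∈ RC t L lam) : Positive J :=
  fun a _ hx => hJ.1.1 a _ (Multiset.mem_map_of_mem _ hx)

lemma vacancy_zero (t : AffineType) (L : MultArray n) (J : Strings n) (a : Fin n) :
    vacancy t L (shape J) a 0 = 0 := by
  rw [vacancy_shape, resource_zero]
  simp [boxes]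

lemma RC.vacancy_nonneg {t : AffineType} {L : MultArray n} {lam : Fin n → ℤ} {J : Strings n}
    (hJ : J ∈ RC t L lam) (a : Fin n) (l : ℕ) : 0 ≤ vacancy t L (shape J) a l := by
  rcases Nat.eq_zero_or_pos l with rfl | hl
  · rw [vacancy_zero]
  · exact hJ.2.1 a l hl

lemma exists_bound (J : Strings n) : ∃ M, 1 < M ∧ ∀ a, ∀ x ∈ J a, x.1 < M := by
  refine ⟨∑ a, ((J a).map Prod.fst).sum + 2, by omega, fun a x hx => ?_⟩
  have h1 : x.1 ≤ ((J a).map Prod.fst).sum :=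
    Multiset.le_sum_of_mem (Multiset.mem_map_of_mem _ hx)
  have h2 : ((J a).map Prod.fst).sum ≤ ∑ a, ((J a).map Prod.fst).sum :=
    Finset.single_le_sum (f := fun a => ((J a).map Prod.fst).sum) (fun _ _ => Nat.zero_le _)
      (Finset.mem_univ a)
  omega

/-- Two particles of highest weight at level 1 replace the two removed factors `B^{1,1}`, so the
initial vacancy numbers are those of `L` and the state is valid. -/
theorem deltaBar_deltaTilde (t : AffineType) [NeZero n] (hn : t = .D → 4 ≤ n) (L : MultArray n)
    (lam : Fin n → ℤ) (J : Strings n) (hJ : J ∈ RC t L lam)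
    (hL : ({(0, 1), (0, 1)} : MultArray n) ≤ L) :
    deltaBar t L.hat (deltaTilde t L J) = deltaTilde t L.hat (deltaBar t L J) := by
  have h1 : ((0, 1) : Fin n × ℕ) ∈ L := Multiset.mem_of_le hL (by simp)
  have h2 : ((0, 1) : Fin n × ℕ) ∈ L.hat := by
    have := Multiset.erase_le_erase (0, 1) hL
    exact Multiset.mem_of_le this (by simp)
  obtain ⟨M, hM, hlen⟩ := exists_bound J
  set D := vectorData t hn L.hat.hat M
  let s : Pair n := ⟨J, eps t n 0, eps t n 0, 1, 1⟩
  have hQ : D.Q s = vacancy t L (shape J) := by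
    funext a l
    have e : D.Q s a l = resource L.hat.hat a l - ∑ b, cartan t n a b * boxes (J b) l
      + (if 1 ≤ l then eps t n 0 a else 0) + (if 1 ≤ l then eps t n 0 a else 0) := rfl
    rw [e, vacancy_shape]
    rcases Nat.eq_zero_or_pos l with rfl | hl
    · simp [resource_zero]
    · replace hl : 1 ≤ l := hl
      rw [resource_hat h1 a hl, resource_hat h2 a hl, if_pos hl, eps_zero t hn]
      ring
  have hrep : D.Represents t L J s := by
    refine ⟨fun a => ?_, hlen, fun a l _ _ => by rw [hQ]⟩
    exact Multiset.filter_eq_self.2 fun x hx => RC.positive hJ a x hx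
  have hvalid : D.Valid s := by
    refine ⟨⟨eps_zero_mem t, eps_zero_mem t, le_rfl, le_rfl, hM.le, hM.le⟩, rfl, hlen, ?_, ?_⟩
    · rw [hQ]; exact RC.vacancy_nonneg hJ
    · rw [hQ]; exact hJ.2.2
  -- The pair `r1`, `r2` reads `xy` as `deltaTilde` after `deltaBar`; the pair `r3`, `r4` reads `yx`
  -- as the opposite order.
  obtain ⟨r1, v1, j1, -⟩ := hrep.run rfl rfl hM.le h1
  obtain ⟨r2, -, -, -⟩ := r1.mirror.run j1 v1 hM.le h2
  obtain ⟨r3, v3, j3, -⟩ := hrep.mirror.run rfl rfl hM.le h1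
  obtain ⟨r4, -, -, -⟩ := r3.mirror.run j3 v3 hM.le h2
  funext a
  refine (r4.filter a).symm.trans (Eq.trans ?_ (r2.mirror.filter a))
  congr 1
  exact (congrFun hvalid.commutes a).symm

end RiggedConfiguration

/-! ### Splitting off columns and boxes -/

namespace RiggedConfiguration

variable {n : ℕ}

open PairData

/-! ### Multiplicity arrays -/

lemma erase_cons_cons {α : Type*} [DecidableEq α] (a b x : α) (K : Multiset α) :
    (a ::ₘ b ::ₘ x ::ₘ K).erase x = a ::ₘ b ::ₘ K := by
  rw [Multiset.cons_swap b, Multiset.cons_swap a, Multiset.erase_cons_head]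

lemma exists_eq_cons_cons {α : Type*} {x y : α} {L : Multiset α} (h : {x, y} ≤ L) :
    ∃ K, L = x ::ₘ y ::ₘ K := by
  obtain ⟨K, rfl⟩ := Multiset.le_iff_exists_add.1 h
  exact ⟨K, by simp [Multiset.insert_eq_cons]⟩

lemma split_hat [NeZero n] {L : MultArray n} {r : Fin n} {s : ℕ}
    (h : ({(0, 1), (r, s)} : MultArray n) ≤ L) : (L.split r s).hat = L.hat.split r s := by
  obtain ⟨K, rfl⟩ := exists_eq_cons_cons h
  rw [MultArray.hat, MultArray.hat, MultArray.split, MultArray.split, Multiset.erase_cons_head,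
    Multiset.erase_cons_head, Multiset.cons_swap (0, 1), Multiset.erase_cons_head, erase_cons_cons]

lemma boxSplit_hat [NeZero n] {L : MultArray n} {r : Fin n}
    (h : ({(0, 1), (r, 1)} : MultArray n) ≤ L) : (L.boxSplit r).hat = L.hat.boxSplit r := by
  obtain ⟨K, rfl⟩ := exists_eq_cons_cons h
  rw [MultArray.hat, MultArray.hat, MultArray.boxSplit, MultArray.boxSplit, Multiset.erase_cons_head,
    Multiset.erase_cons_head, Multiset.cons_swap (0, 1), Multiset.erase_cons_head,
    Multiset.erase_cons_head, Multiset.cons_swap]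

lemma split_boxSplit [NeZero n] {L : MultArray n} {r r' : Fin n} {s : ℕ}
    (h : ({(r, 1), (r', s)} : MultArray n) ≤ L) :
    (L.split r' s).boxSplit r = (L.boxSplit r).split r' s := by
  obtain ⟨K, rfl⟩ := exists_eq_cons_cons h
  rw [MultArray.boxSplit, MultArray.boxSplit, MultArray.split, MultArray.split,
    Multiset.erase_cons_head, erase_cons_cons, Multiset.cons_swap (r, 1), Multiset.erase_cons_head,
    erase_cons_cons]
  simp only [← Multiset.singleton_add]
  abel

lemma mem_hat_of_pair_le [NeZero n] {L : MultArray n} {x : Fin n × ℕ} (h : {(0, 1), x} ≤ L) :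
    x ∈ L.hat := by
  obtain ⟨K, rfl⟩ := exists_eq_cons_cons h
  simp [MultArray.hat]

/-! ### Selected strings -/

lemma firstSingular_congr {t : AffineType} {L L' : MultArray n} {J J' : Strings n}
    (hp : Positive J) (hs : shape J = shape J')
    (hc : ∀ a l, 1 ≤ l → (J a).count (l, vacancy t L (shape J) a l)
      = (J' a).count (l, vacancy t L' (shape J') a l)) (a : ℕ) (lo : WithTop ℕ) (k : ℕ → ℕ) :
    firstSingular t L J a lo k = firstSingular t L' J' a lo k := by
  rw [firstSingular, firstSingular]
  split_ifs with h
  · have e : (J ⟨a, h⟩).map Prod.fst = (J' ⟨a, h⟩).map Prod.fst := congrFun hs ⟨a, h⟩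
    rw [← e]
    refine congrArg Finset.min (Finset.filter_congr fun l hl => ?_)
    obtain ⟨x, hx, rfl⟩ := Multiset.mem_map.1 (Multiset.mem_toFinset.1 hl)
    rw [hc _ _ (hp _ x hx)]
  · rfl

lemma selected_congr {t : AffineType} {L L' : MultArray n} {J J' : Strings n}
    (h : ∀ a lo k, firstSingular t L J a lo k = firstSingular t L' J' a lo k) :
    selected t L J = selected t L' J' := by
  have h1 : ∀ k, chain t L J k = chain t L' J' k := by
    intro k
    induction k with
    | zero => rfl
    | succ k ih => rw [chain, chain, ih, h]
  have h2 : ∀ k, ell t L J k = ell t L' J' k := by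
    intro k
    cases t <;> simp only [ell, h, h1]
  cases t
  · funext a
    simp only [selected, ellBar, h2]
  · have h3 : ∀ k, ellBarAux L J k = ellBarAux L' J' k := by
      intro k
      induction k with
      | zero => simp only [ellBarAux, h2]
      | succ k ih => simp only [ellBarAux, ih, h, h2]
    funext a
    simp only [selected, ellBar, h2, h3]

lemma mem_finiteLengths {x : WithTop ℕ} {l : ℕ} : l ∈ finiteLengths x ↔ (l : WithTop ℕ) = x := by
  rw [← Multiset.count_pos, count_finiteLengths]
  split_ifs with h <;> simp [h]

lemma one_le_ellBar (t : AffineType) (L : MultArray n) (J : Strings n) (a : ℕ) :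
    1 ≤ ellBar t L J a := by
  cases t
  · exact le_top
  · rw [ellBar]
    split_ifs
    · exact one_le_ellBarAux _ _ _
    · exact le_top

lemma one_le_of_mem_selected {t : AffineType} {L : MultArray n} {J : Strings n} {a : Fin n} {l : ℕ}
    (h : l ∈ selected t L J a) : 1 ≤ l := by
  rw [selected, Multiset.mem_add, mem_finiteLengths, mem_finiteLengths] at h
  have : (1 : WithTop ℕ) ≤ l := by
    rcases h with h | h <;> rw [h]
    · exact one_le_ell _ _ _ _
    · exact one_le_ellBar _ _ _ _
  exact_mod_cast this

lemma Positive.deltaBar {t : AffineType} [NeZero n] {L : MultArray n} {J : Strings n}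
    (h : Positive J) : Positive (deltaBar t L J) := by
  intro a x hx
  rcases Multiset.mem_add.1 hx with hx | hx
  · exact h a x (Multiset.mem_of_le tsub_le_self hx)
  · obtain ⟨l, hl, rfl⟩ := Multiset.mem_map.1 hx
    exact (Multiset.mem_filter.1 hl).2

lemma Positive.theta {t : AffineType} {L : MultArray n} {J : Strings n} (h : Positive J) :
    Positive (theta t L J) := by
  intro a x hx
  obtain ⟨y, hy, rfl⟩ := Multiset.mem_map.1 hx
  exact h a y hy

lemma theta_mem_RC {t : AffineType} {L : MultArray n} {lam : Fin n → ℤ} {J : Strings n}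
    (hJ : J ∈ RC t L lam) : theta t L J ∈ RC t L lam := by
  refine ⟨?_, ?_, fun a x hx => ?_⟩
  · rw [shape_theta]
    exact hJ.1
  · rw [shape_theta]
    exact hJ.2.1
  · rw [shape_theta]
    obtain ⟨y, hy, rfl⟩ := Multiset.mem_map.1 hx
    have := hJ.2.2 a y hy
    simp only
    omega

lemma map_sub_of_injective {α β : Type*} [DecidableEq α] [DecidableEq β] {f : α → β}
    (hf : Function.Injective f) (A B : Multiset α) : (A - B).map f = A.map f - B.map f := by
  ext b
  by_cases hb : ∃ a, f a = b
  · obtain ⟨a, rfl⟩ := hb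
    rw [Multiset.count_sub, Multiset.count_map_eq_count' f _ hf, Multiset.count_map_eq_count' f _ hf,
      Multiset.count_map_eq_count' f _ hf, Multiset.count_sub]
  · have h0 : ∀ C : Multiset α, (C.map f).count b = 0 := fun C =>
      Multiset.count_eq_zero.2 fun h => by
        obtain ⟨a, -, ha⟩ := Multiset.mem_map.1 h
        exact hb ⟨a, ha⟩
    rw [Multiset.count_sub, h0, h0, h0]

/-! ### Splitting off a column -/

/-- For `l ≥ 1`, the sum `min l 1 + min l (s - 1)` exceeds `min l s` by 1 if `l < s` and equals it
otherwise. -/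
lemma vacancy_split {t : AffineType} {L : MultArray n} {r : Fin n} {s : ℕ} (hs : 1 ≤ s)
    (h : (r, s) ∈ L) (ν : Config n) (a : Fin n) {l : ℕ} (hl : 1 ≤ l) :
    vacancy t (L.split r s) ν a l = vacancy t L ν a l + if a = r ∧ l < s then 1 else 0 := by
  have e : resource (L.split r s) a l = resource L a l + if a = r ∧ l < s then 1 else 0 := by
    conv_rhs => rw [← Multiset.cons_erase h]
    simp only [MultArray.split, resource_cons]
    by_cases ha : r = a
    · simp only [ha, if_true, true_and]
      split_ifs <;> omega
    · simp [ha, Ne.symm ha]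
  change resource _ _ _ - _ = resource _ _ _ - _ + _
  rw [e]
  ring

lemma jTilde_eq (r : Fin n) (s : ℕ) (J : Strings n) :
    jTilde r s J = fun a => (J a).map fun x => (x.1, x.2 + if a = r ∧ x.1 < s then 1 else 0) := by
  funext a
  refine Multiset.map_congr rfl fun x _ => ?_
  split_ifs <;> simp

lemma shape_jTilde (r : Fin n) (s : ℕ) (J : Strings n) : shape (jTilde r s J) = shape J := by
  funext a
  simp [shape, jTilde_eq]

lemma jTilde_injective (r : Fin n) (s : ℕ) (a : Fin n) : Function.Injective
    fun x : ℕ × ℤ => (x.1, x.2 + if a = r ∧ x.1 < s then (1 : ℤ) else 0) := by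
  rintro ⟨x1, x2⟩ ⟨y1, y2⟩ h
  obtain ⟨rfl, h2⟩ := Prod.mk.inj h
  simp only [add_left_inj] at h2
  rw [h2]

/-- Riggings and vacancy numbers shift together, so each length has as many singular strings as
before. -/
lemma selected_jTilde {t : AffineType} {L : MultArray n} {r : Fin n} {s : ℕ} (hs : 1 ≤ s)
    (h : (r, s) ∈ L) {J : Strings n} (hJ : Positive J) :
    selected t (L.split r s) (jTilde r s J) = selected t L J := by
  refine (selected_congr (firstSingular_congr hJ (shape_jTilde r s J).symm fun a l hl => ?_)).symm
  rw [shape_jTilde, vacancy_split hs h _ _ hl, jTilde_eq]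
  exact (Multiset.count_map_eq_count' _ _ (jTilde_injective r s a)
    (l, vacancy t L (shape J) a l)).symm

theorem jTilde_deltaBar (t : AffineType) [NeZero n] {L : MultArray n} {r : Fin n} {s : ℕ} (hs : 1 ≤ s)
    (h : ({(0, 1), (r, s)} : MultArray n) ≤ L) {J : Strings n} (hJ : Positive J) :
    jTilde r s (deltaBar t L J) = deltaBar t (L.split r s) (jTilde r s J) := by
  have h1 : (r, s) ∈ L := Multiset.mem_of_le h (by simp)
  have e1 := selected_jTilde (t := t) hs h1 hJ
  have e2 : ∀ a, shortened t (L.split r s) (jTilde r s J) a = shortened t L J a := fun a => by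
    rw [shortened, e1, shortened]
  have e3 : newShape t (L.split r s) (jTilde r s J) = newShape t L J := by
    funext a
    rw [newShape, newShape, e1, e2, shape_jTilde]
  rw [jTilde_eq]
  funext a
  rw [deltaBar, deltaBar, e1, e2, e3, shape_jTilde, split_hat h, Multiset.map_add,
    map_sub_of_injective (jTilde_injective r s a), Multiset.map_map, Multiset.map_map,
    jTilde_eq]
  refine congrArg₂ (· + ·) (congrArg (Multiset.map _ (J a) - ·) ?_) ?_
  · refine Multiset.map_congr rfl fun l hl => ?_
    rw [vacancy_split hs h1 _ _ (one_le_of_mem_selected hl)]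
    rfl
  · refine Multiset.map_congr rfl fun l hl => ?_
    rw [vacancy_split hs (mem_hat_of_pair_le h) _ _ (Multiset.mem_filter.1 hl).2]
    rfl

lemma theta_split {t : AffineType} {L : MultArray n} {r : Fin n} {s : ℕ} (hs : 1 ≤ s)
    (h : (r, s) ∈ L) {J : Strings n} (hJ : Positive J) : theta t (L.split r s) J = jTilde r s (theta t L J) := by
  rw [jTilde_eq]
  funext a
  rw [theta, theta, Multiset.map_map]
  refine Multiset.map_congr rfl fun x hx => ?_
  rw [vacancy_split hs h _ _ (hJ a x hx)]
  simp only [Function.comp_apply]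
  congr 1
  ring

lemma theta_split_jTilde {t : AffineType} {L : MultArray n} {r : Fin n} {s : ℕ} (hs : 1 ≤ s)
    (h : (r, s) ∈ L) {J : Strings n} (hJ : Positive J) : theta t (L.split r s) (jTilde r s J) = theta t L J := by
  funext a
  rw [theta, shape_jTilde, jTilde_eq, theta, Multiset.map_map]
  refine Multiset.map_congr rfl fun x hx => ?_
  simp only [Function.comp_apply]
  rw [vacancy_split hs h _ _ (hJ a x hx)]
  congr 1
  ring

/-- Complementing with respect to the larger vacancy numbers turns unchanged riggings into riggings
shifted by `jTilde`, so this is the `theta`-conjugate of `jTilde_deltaBar`. -/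
theorem deltaTilde_split (t : AffineType) [NeZero n] {L : MultArray n} {r : Fin n} {s : ℕ} (hs : 1 ≤ s)
    (h : ({(0, 1), (r, s)} : MultArray n) ≤ L) {J : Strings n} (hJ : Positive J) :
    deltaTilde t L J = deltaTilde t (L.split r s) J := by
  have h1 : (r, s) ∈ L := Multiset.mem_of_le h (by simp)
  rw [deltaTilde, deltaTilde, theta_split hs h1 hJ, ← jTilde_deltaBar t hs h hJ.theta, split_hat h,
    theta_split_jTilde hs (mem_hat_of_pair_le h) hJ.theta.deltaBar]

/-! ### Splitting off a box -/

lemma sum_cartan_A (r a : Fin n) :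
    ∑ b, (if b < r then cartan .A n a b else 0) = eps .A n 0 a - eps .A n r a := by
  simp only [cartan_A_eq, Fin.lt_def]
  rw [Fin.sum_univ_eq_sum_range
    (fun k => if k < r.val then eps .A n k a - eps .A n (k + 1) a else 0), ← Finset.sum_filter,
    ← Finset.sum_range_sub' fun k => eps .A n k a]
  refine Finset.sum_congr (Finset.ext fun k => ?_) fun _ _ => rfl
  have := r.isLt
  simp only [Finset.mem_filter, Finset.mem_range]
  omega

/-- The new factors change the vacancy number by `eps 0 - eps r`; the Cartan columns of the new
strings telescope to the same difference with the opposite effect. -/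
lemma vacancy_boxSplit [NeZero n] {L : MultArray n} {r : Fin n} (h : (r, 1) ∈ L) (hr : r ≠ 0)
    (ν : Config n) (a : Fin n) {l : ℕ} (hl : 1 ≤ l) :
    vacancy .A (L.boxSplit r) (fun a => if a < r then 1 ::ₘ ν a else ν a) a l
      = vacancy .A L ν a l := by
  have hr' : r.val ≠ 0 := fun h => hr (Fin.ext (by rw [h, Fin.val_zero]))
  have e1 : resource (L.boxSplit r) a l = resource L a l + (eps .A n 0 a - eps .A n r a) := by
    conv_rhs => rw [← Multiset.cons_erase h]
    have h0 : (0 = a) = (a.val = 0) := by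
      rw [eq_comm (a := (0 : Fin n)), Fin.ext_iff, Fin.val_zero]
    simp only [MultArray.boxSplit, resource_cons, min_eq_right hl, h0, Fin.ext_iff, eps]
    split_ifs <;> first | contradiction | omega
  have e2 : ∀ b, cartan .A n a b * (((if b < r then 1 ::ₘ ν b else ν b)).map
      fun j => ((min l j : ℕ) : ℤ)).sum
      = cartan .A n a b * ((ν b).map fun j => ((min l j : ℕ) : ℤ)).sum
        + if b < r then cartan .A n a b else 0 := by
    intro b
    split_ifs
    · rw [Multiset.map_cons, Multiset.sum_cons, min_eq_right hl]
      push_cast; ring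
    · ring
  change resource _ _ _ - _ = resource _ _ _ - _
  rw [e1, Finset.sum_congr rfl fun b _ => e2 b, Finset.sum_add_distrib, sum_cartan_A]
  ring

lemma shape_iTilde (r : Fin n) (J : Strings n) :
    shape (iTilde r J) = fun a => if a < r then 1 ::ₘ shape J a else shape J a := by
  funext a
  simp only [shape, iTilde]
  split_ifs <;> simp

lemma shape_iBar (t : AffineType) [NeZero n] (r : Fin n) (L : MultArray n) (J : Strings n) :
    shape (iBar t r L J) = shape (iTilde r J) := by
  funext a
  simp only [shape, iTilde, iBar]
  split_ifs <;> simp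

lemma mem_of_firstSingular_eq {t : AffineType} {L : MultArray n} {J : Strings n} {a : Fin n}
    {lo : WithTop ℕ} {l : ℕ} (h : firstSingular t L J a lo (fun _ => 1) = l) :
    (l, vacancy t L (shape J) a l) ∈ J a := by
  rw [firstSingular, dif_pos a.isLt] at h
  exact Multiset.count_pos.1 (Finset.mem_filter.1 (Finset.mem_of_min h)).2.2

lemma firstSingular_one_congr {t : AffineType} {L L' : MultArray n} {J J' : Strings n} {a : ℕ}
    {lo : WithTop ℕ} (h : ∀ (c : Fin n), c.val = a → ∀ l : ℕ, lo ≤ l →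
      ((l, vacancy t L (shape J) c l) ∈ J c ↔ (l, vacancy t L' (shape J') c l) ∈ J' c)) :
    firstSingular t L J a lo (fun _ => 1) = firstSingular t L' J' a lo fun _ => 1 := by
  rw [firstSingular, firstSingular]
  split_ifs with ha
  · refine congrArg Finset.min (Finset.ext fun l => ?_)
    simp only [Finset.mem_filter, Multiset.mem_toFinset, Nat.one_le_iff_ne_zero, Multiset.count_ne_zero]
    constructor
    · rintro ⟨-, h1, h2⟩
      have := (h ⟨a, ha⟩ rfl l h1).1 h2
      exact ⟨Multiset.mem_map_of_mem Prod.fst this, h1, this⟩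
    · rintro ⟨-, h1, h2⟩
      have := (h ⟨a, ha⟩ rfl l h1).2 h2
      exact ⟨Multiset.mem_map_of_mem Prod.fst this, h1, this⟩
  · rfl

lemma singular_of_chain_eq_one [NeZero n] {L : MultArray n} {lam : Fin n → ℤ} {J : Strings n}
    (hJ : J ∈ RC .A L lam) (hL : (0, 1) ∈ L) {a : Fin n} (h : chain .A L J a = 1)
    (hv : vacancy .A L (shape J) a 1 = 0) : (1, 0) ∈ J a := by
  -- Only the concavity inequality is used and no run, so the top level 0 and the zero weight of the
  -- second particle do not matter.
  set D := vectorData .A (by simp) L.hat 0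
  let s : Pair n := ⟨J, eps .A n 0, 0, 1, 1⟩
  have hQ : ∀ l, D.Q s a l = vacancy .A L (shape J) a l := by
    intro l
    have e : D.Q s a l = resource L.hat a l - ∑ b, cartan .A n a b * boxes (J b) l
      + (if 1 ≤ l then eps .A n 0 a else 0) + (if 1 ≤ l then 0 else 0) := rfl
    rw [e, vacancy_shape]
    rcases Nat.eq_zero_or_pos l with rfl | hl
    · simp [resource_zero]
    · replace hl : 1 ≤ l := hl
      rw [resource_hat hL a hl, if_pos hl, if_pos hl, eps_zero .A (by simp)]
      ring
  have h1 : D.Q s a 0 + D.Q s a 2 + D.nbr s a 1 - 2 * mult (J a) 1 + eps .A n 0 a + 0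
      ≤ 2 * D.Q s a 1 := D.second_difference_at_level (s := s) le_rfl rfl a
  rw [hQ, hQ, hQ, hv, vacancy_zero] at h1
  have h2 := RC.vacancy_nonneg hJ a 2
  -- At the first node the unit comes from the factor `B^{1,1}`, at any later node from the string
  -- of length 1 selected at the preceding node. With vacancy number 0 at length 1, concavity then
  -- forces a string of length 1 at `a`.
  have h3 : 1 ≤ D.nbr s a 1 + eps .A n 0 a := by
    rw [eps_zero .A (by simp)]
    by_cases ha : 0 = a
    · rw [if_pos ha]
      have := D.nbr_nonneg s a 1
      omega
    · rw [if_neg ha]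
      by_contra hlt
      have ha' : a.val ≠ 0 := fun h => ha (Fin.ext (by rw [h, Fin.val_zero]))
      let b : Fin n := ⟨a - 1, by omega⟩
      have hb : a.val = b.val + 1 := by simp only [b]; omega
      have hab : a ≠ b := fun h => by rw [h] at hb; omega
      rw [hb, chain] at h
      have hm := mem_of_firstSingular_eq (a := b) (l := 1) h
      have h0 : cartan .A n a b = 0 := D.orthogonal_of_nbr (s := s) (l := 1) (by omega) hab hm
      rw [cartan_A_eq] at h0
      simp only [eps] at h0
      split_ifs at h0 <;> omega
  obtain ⟨x, hx⟩ := exists_mem_of_mult_pos (K := J a) (l := 1) (by omega)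
  have := hJ.2.2 a _ hx
  simp only [hv] at this
  rwa [show x = 0 by omega] at hx

/-- The added string is singular only if the vacancy number at length 1 vanishes, and it is then
considered only if the chain is still at length 1; in that case an equal string was already present.
-/
lemma chain_iTilde [NeZero n] {L : MultArray n} {lam : Fin n → ℤ} {J : Strings n}
    (hJ : J ∈ RC .A L lam) {r : Fin n} (hr : r ≠ 0) (h : ({(0, 1), (r, 1)} : MultArray n) ≤ L)
    (k : ℕ) : chain .A (L.boxSplit r) (iTilde r J) k = chain .A L J k := by
  induction k with
  | zero => rfl
  | succ k ih =>
    rw [chain, chain, ih]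
    refine firstSingular_one_congr fun c hc l hl => ?_
    have hl' : 1 ≤ l := by exact_mod_cast (one_le_chain .A L J k).trans hl
    rw [shape_iTilde, vacancy_boxSplit (Multiset.mem_of_le h (by simp)) hr _ _ hl', iTilde]
    split_ifs
    · refine ⟨fun hm => ?_, Multiset.mem_cons_of_mem⟩
      rcases Multiset.mem_cons.1 hm with hm | hm
      · obtain ⟨rfl, hv⟩ := Prod.mk.inj hm
        rw [hv]
        refine singular_of_chain_eq_one hJ (Multiset.mem_of_le h (by simp)) ?_ hv
        rw [hc]
        exact le_antisymm hl (one_le_chain .A L J k)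
      · exact hm
    · rfl

lemma selected_map_le {L : MultArray n} {J : Strings n} (a : Fin n) :
    (selected .A L J a).map (fun i => (i, vacancy .A L (shape J) a i)) ≤ J a := by
  have e : selected .A L J a = finiteLengths (chain .A L J (a + 1)) := add_zero _
  rw [e]
  obtain h | ⟨l, h⟩ := eq_top_or_exists_nat (chain .A L J (a + 1))
  · rw [h]
    exact Multiset.zero_le _
  · rw [h]
    exact Multiset.singleton_le.2 (mem_of_firstSingular_eq h)

/-- The selection is unchanged and contained in the old strings, so subtracting the selected strings
can leave the added one in place, even if it equals a selected one. -/
theorem iTilde_deltaBar [NeZero n] {L : MultArray n} {lam : Fin n → ℤ} {J : Strings n}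
    (hJ : J ∈ RC .A L lam) {r : Fin n} (hr : r ≠ 0) (h : ({(0, 1), (r, 1)} : MultArray n) ≤ L) :
    iTilde r (deltaBar .A L J) = deltaBar .A (L.boxSplit r) (iTilde r J) := by
  have h1 : (r, 1) ∈ L := Multiset.mem_of_le h (by simp)
  have e1 : selected .A (L.boxSplit r) (iTilde r J) = selected .A L J := by
    funext a
    simp only [selected, ell, ellBar, chain_iTilde hJ hr h]
  have e2 : ∀ a, shortened .A (L.boxSplit r) (iTilde r J) a = shortened .A L J a := fun a => by
    rw [shortened, e1, shortened]
  have e3 : newShape .A (L.boxSplit r) (iTilde r J)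
      = fun a => if a < r then 1 ::ₘ newShape .A L J a else newShape .A L J a := by
    funext a
    have hle : selected .A L J a ≤ shape J a := by
      have := Multiset.map_le_map (f := Prod.fst) (selected_map_le (L := L) (J := J) a)
      rwa [Multiset.map_map, Function.comp_def, Multiset.map_id'] at this
    simp only [newShape]
    rw [e1, e2, shape_iTilde]
    dsimp only
    split_ifs
    · rw [Multiset.cons_sub_of_le _ hle, Multiset.cons_add]
    · rfl
  have e4 : ∀ a, (selected .A L J a).map
      (fun i => (i, vacancy .A (L.boxSplit r) (shape (iTilde r J)) a i))
      = (selected .A L J a).map fun i => (i, vacancy .A L (shape J) a i) := by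
    intro a
    refine Multiset.map_congr rfl fun l hl => ?_
    rw [shape_iTilde, vacancy_boxSplit h1 hr _ _ (one_le_of_mem_selected hl)]
  have e5 : ∀ a, (shortened .A L J a).map
      (fun i => (i, vacancy .A (L.boxSplit r).hat
        (newShape .A (L.boxSplit r) (iTilde r J)) a i))
      = (shortened .A L J a).map fun i => (i, vacancy .A L.hat (newShape .A L J) a i) := by
    intro a
    refine Multiset.map_congr rfl fun l hl => ?_
    rw [e3, boxSplit_hat h, vacancy_boxSplit (mem_hat_of_pair_le h) hr _ _
      (Multiset.mem_filter.1 hl).2]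
  funext a
  rw [deltaBar, e1, e2, e4, e5]
  simp only [iTilde]
  split_ifs
  · rw [Multiset.cons_sub_of_le _ (selected_map_le a), Multiset.cons_add, deltaBar]
  · rfl

lemma theta_boxSplit_iBar [NeZero n] {L : MultArray n} {r : Fin n} (h : (r, 1) ∈ L) (hr : r ≠ 0)
    {J : Strings n} (hJ : Positive J) :
    theta .A (L.boxSplit r) (iBar .A r L J) = iTilde r (theta .A L J) := by
  have e : ∀ a, (J a).map (fun x => (x.1, vacancy .A (L.boxSplit r) (shape (iTilde r J)) a x.1 - x.2))
      = theta .A L J a := fun a => by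
    refine Multiset.map_congr rfl fun x hx => ?_
    rw [shape_iTilde, vacancy_boxSplit h hr _ _ (hJ a x hx)]
  funext a
  rw [theta, shape_iBar]
  simp only [iBar, iTilde]
  split_ifs
  · rw [Multiset.map_cons, e, sub_self]
  · exact e a

lemma theta_boxSplit_iTilde [NeZero n] {L : MultArray n} {r : Fin n} (h : (r, 1) ∈ L) (hr : r ≠ 0)
    {J : Strings n} (hJ : Positive J) :
    theta .A (L.boxSplit r) (iTilde r J) = iBar .A r L (theta .A L J) := by
  have e : ∀ a, (J a).map (fun x => (x.1, vacancy .A (L.boxSplit r) (shape (iTilde r J)) a x.1 - x.2))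
      = theta .A L J a := fun a => by
    refine Multiset.map_congr rfl fun x hx => ?_
    rw [shape_iTilde, vacancy_boxSplit h hr _ _ (hJ a x hx)]
  have e' : shape (iTilde r (theta .A L J)) = shape (iTilde r J) := by
    rw [shape_iTilde, shape_iTilde, shape_theta]
  funext a
  rw [theta, iBar, e']
  rw [show iTilde r J a = if a < r then (1, 0) ::ₘ J a else J a from rfl]
  split_ifs
  · rw [Multiset.map_cons, e, sub_zero]
  · exact e a

theorem iBar_deltaTilde [NeZero n] {L : MultArray n} {lam : Fin n → ℤ} {J : Strings n}
    (hJ : J ∈ RC .A L lam) {r : Fin n} (hr : r ≠ 0) (h : ({(0, 1), (r, 1)} : MultArray n) ≤ L) :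
    iBar .A r L.hat (deltaTilde .A L J) = deltaTilde .A (L.boxSplit r) (iBar .A r L J) := by
  have hp := RC.positive hJ
  rw [deltaTilde, deltaTilde, theta_boxSplit_iBar (Multiset.mem_of_le h (by simp)) hr hp,
    ← iTilde_deltaBar (theta_mem_RC hJ) hr h, boxSplit_hat h,
    theta_boxSplit_iTilde (mem_hat_of_pair_le h) hr hp.theta.deltaBar]

/-- The vacancy number that serves as rigging of the added singular string grows by 1 exactly where
`jTilde` raises riggings of length 1. -/
theorem iBar_jTilde (t : AffineType) [NeZero n] {L : MultArray n} {r r' : Fin n} {s : ℕ}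
    (hs : 1 ≤ s) (h : ({(r, 1), (r', s)} : MultArray n) ≤ L) (J : Strings n) :
    iBar t r (L.split r' s) (jTilde r' s J) = jTilde r' s (iBar t r L J) := by
  have hm : (r', s) ∈ L.boxSplit r := by
    obtain ⟨K, rfl⟩ := exists_eq_cons_cons h
    simp [MultArray.boxSplit]
  have e : shape (iTilde r (jTilde r' s J)) = shape (iTilde r J) := by
    rw [shape_iTilde, shape_iTilde, shape_jTilde]
  funext a
  rw [iBar, split_boxSplit h, e, vacancy_split hs hm _ _ le_rfl, jTilde_eq, jTilde_eq]
  simp only [iBar]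
  split_ifs <;> simp_all

end RiggedConfiguration

open RiggedConfiguration in
theorem mainTheorem9 (t : AffineType) (n : ℕ) [NeZero n] (hn : t = AffineType.D → 4 ≤ n)
    (L : MultArray n) (hL : IsKRArray t L) (lam : Fin n → ℤ)
    (J : Strings n) (hJ : J ∈ RC t L lam) :
    -- two distinguished factors `B^{1,1}`
    (({(0, 1), (0, 1)} : MultArray n) ≤ L →
      deltaBar t L.hat (deltaTilde t L J) = deltaTilde t L.hat (deltaBar t L J)) ∧
    -- distinguished factors `B^{1,1}` and `B^{r,s}`
    (∀ (r : Fin n) (s : ℕ), 2 ≤ s → ({(0, 1), (r, s)} : MultArray n) ≤ L →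
      jTilde r s (deltaBar t L J) = deltaBar t (L.split r s) (jTilde r s J) ∧
      jBar r s (deltaTilde t L J) = deltaTilde t (L.split r s) (jBar r s J)) ∧
    -- distinguished factors `B^{r,s}` and `B^{r',s'}`
    (∀ (r r' : Fin n) (s s' : ℕ), 2 ≤ s → 2 ≤ s' → ({(r, s), (r', s')} : MultArray n) ≤ L →
      jBar r s (jTilde r' s' J) = jTilde r' s' (jBar r s J)) ∧
    -- type `A`, distinguished factors `B^{1,1}` and `B^{r,1}`
    (t = AffineType.A → ∀ r : Fin n, r ≠ 0 → ({(0, 1), (r, 1)} : MultArray n) ≤ L →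
      iTilde r (deltaBar t L J) = deltaBar t (L.boxSplit r) (iTilde r J) ∧
      iBar t r L.hat (deltaTilde t L J) = deltaTilde t (L.boxSplit r) (iBar t r L J)) ∧
    -- type `A`, distinguished factors `B^{r,1}` and `B^{r',s'}`
    (t = AffineType.A → ∀ (r r' : Fin n) (s' : ℕ), r ≠ 0 → 2 ≤ s' →
      ({(r, 1), (r', s')} : MultArray n) ≤ L →
      iTilde r (jBar r' s' J) = jBar r' s' (iTilde r J) ∧
      iBar t r (L.split r' s') (jTilde r' s' J) = jTilde r' s' (iBar t r L J)) := by
  have hp := RC.positive hJ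
  refine ⟨deltaBar_deltaTilde t hn L lam J hJ,
    fun r s hs h => ⟨jTilde_deltaBar t (by omega) h hp, deltaTilde_split t (by omega) h hp⟩, fun _ _ _ _ _ _ _ => rfl, ?_,
    fun _ r r' s' _ hs h => ⟨rfl, iBar_jTilde t (by omega) h J⟩⟩
  rintro rfl r hr h
  exact ⟨iTilde_deltaBar hJ hr h, iBar_deltaTilde hJ hr h⟩
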